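/- Let $f\in\mathbb{C}[x,y]$ be a squarefree polynomial, let $C=\{f=0\}\subset\mathbb{C}^2$ be the reduced plane curve that it defines, and let $\mathcal{U}=\mathbb{C}^2\setminus C$. Put $G=\pi_1(\mathcal{U})$ and let $\psi:G\to\mathbb{Z}$ be the total linking number homomorphism, which sends the class of a loop $\gamma$ to the winding number of $f\circ\gamma$ about $0$. The rational derived series of a group $H$ is given by $H_r^{(0)}=H$ and $$H_r^{(n+1)}=\{g\in H_r^{(n)} \mid g^k\in[H_r^{(n)},H_r^{(n)}]\text{ for some }k\in\mathbb{Z}\setminus\{0\}\}.$$ Let $\Gamma_n=G/G_r^{(n+1)}$, and let $\bar\Gamma_n$ be the kernel of the homomorphism $\Gamma_n\to\mathbb{Z}$ induced by $\psi$. The group ring $\mathbb{Z}\bar\Gamma_n$ is a right Ore domain; let $\mathbb{K}_n$ be its skew field of right fractions and let $R_n=(\mathbb{Z}\Gamma_n)(\mathbb{Z}\bar\Gamma_n\setminus\{0\})^{-1}$. The $n$-th order degree $\delta_n=\delta_n(C)$ is the rank over $\mathbb{K}_n$ of the right $R_n$-module $$H_1(\mathcal{U};R_n)=\left(G_r^{(n+1)}/[G_r^{(n+1)},G_r^{(n+1)}]\right)\otimes_{\mathbb{Z}\Gamma_n}R_n,$$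 where $\Gamma_n$ acts on the first factor from the right by conjugation, $[x]\cdot g=[g^{-1}xg]$. Let $\mathfrak{B}_4=\langle\sigma_1,\sigma_2,\sigma_3\mid\sigma_1\sigma_3=\sigma_3\sigma_1,\ \sigma_1\sigma_2\sigma_1=\sigma_2\sigma_1\sigma_2,\ \sigma_2\sigma_3\sigma_2=\sigma_3\sigma_2\sigma_3\rangle$ be the braid group on four strands (the Artin group of type $A_3$), and put $z=\sigma_3\sigma_1^{-1}$. Suppose that $\pi_1(\mathcal{U})\cong\mathfrak{B}_4$. Then $\delta_0=2$ and $\delta_1=1$. For every $n\ge 2$, $\delta_n=1$ if $z\in(\mathfrak{B}_4)_r^{(n+1)}$, and $\delta_n=0$ if $z\notin(\mathfrak{B}_4)_r^{(n+1)}$. In particular, $\delta_2=1$. -/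

import Mathlib

open scoped Pointwise

universe u

namespace CurveComplement

/-! ### Group rings of poly-torsion-free-abelian groups are Ore domains -/

theorem pow_subset_image {Q : Type*} [CommGroup Q] [DecidableEq Q] (T : Finset Q) (k : ℕ) :
    T ^ k ⊆ (Fintype.piFinset fun _ : T => Finset.range (k + 1)).image
      fun f => ∏ t : T, (t : Q) ^ f t := by
  classical
  induction k with
  | zero =>
    intro x hx
    simp only [pow_zero, Finset.mem_one] at hx
    refine Finset.mem_image.2 ⟨fun _ => 0, by simp, by simp [hx]⟩
  | succ k ih =>
    intro x hx
    rw [pow_succ] at hx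
    obtain ⟨y, hy, s, hs, rfl⟩ := Finset.mem_mul.1 hx
    obtain ⟨f, hf, rfl⟩ := Finset.mem_image.1 (ih hy)
    refine Finset.mem_image.2 ⟨f + Pi.single ⟨s, hs⟩ 1, ?_, ?_⟩
    · rw [Fintype.mem_piFinset] at hf ⊢
      intro a
      have := hf a
      simp only [Finset.mem_range, Pi.add_apply] at this ⊢
      have h2 : (Pi.single (⟨s, hs⟩ : T) 1 : T → ℕ) a ≤ 1 := by
        by_cases h : a = ⟨s, hs⟩
        · subst h; simp
        · simp [h]
      omega
    · simp only [Pi.add_apply, pow_add, Finset.prod_mul_distrib]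
      congr 1
      rw [Finset.prod_eq_single (⟨s, hs⟩ : T)] <;> simp +contextual

theorem exists_card_mul_lt {Q : Type*} [CommGroup Q] [DecidableEq Q] (T : Finset Q) (m : ℕ) :
    ∃ F : Finset Q, m * (T * F).card < (m + 1) * F.card := by
  by_contra! h
  have h1 : ∀ k : ℕ, (m + 1) ^ k ≤ m ^ k * (T ^ k).card := by
    intro k
    induction k with
    | zero => simp
    | succ k ih =>
      calc (m + 1) ^ (k + 1) = (m + 1) * (m + 1) ^ k := by ring
        _ ≤ (m + 1) * (m ^ k * (T ^ k).card) := by gcongr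
        _ = m ^ k * ((m + 1) * (T ^ k).card) := by ring
        _ ≤ m ^ k * (m * (T * T ^ k).card) := Nat.mul_le_mul_left _ (h _)
        _ = m ^ (k + 1) * (T ^ (k + 1)).card := by rw [pow_succ' T]; ring
  have h2 : ∀ k : ℕ, (T ^ k).card ≤ (k + 1) ^ T.card := by
    intro k
    refine (Finset.card_le_card (pow_subset_image T k)).trans (Finset.card_image_le.trans ?_)
    simp
  rcases Nat.eq_zero_or_pos m with rfl | hm
  · simpa using h1 1
  have hr : (1 : ℝ) < ((m : ℝ) + 1) / m := by
    have : (0 : ℝ) < m := by exact_mod_cast hm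
    rw [lt_div_iff₀ this]; linarith
  have ht := (tendsto_pow_const_div_const_pow_of_one_lt T.card hr)
  have hε : (0 : ℝ) < 1 / 2 ^ T.card := by positivity
  obtain ⟨k, hk, hk1⟩ := ((ht.eventually_lt_const hε).and (Filter.eventually_ge_atTop 1)).exists
  have hm' : (0 : ℝ) < m := by exact_mod_cast hm
  have h3 : ((m : ℝ) + 1) ^ k ≤ m ^ k * (2 * k) ^ T.card := by
    have := (h1 k).trans (Nat.mul_le_mul_left _ ((h2 k).trans
      (Nat.pow_le_pow_left (show k + 1 ≤ 2 * k by omega) _)))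
    exact_mod_cast this
  rw [div_pow, div_div_eq_mul_div, div_lt_div_iff₀ (by positivity) (by positivity)] at hk
  rw [mul_pow] at h3
  nlinarith

theorem strongRankCondition_of_extension {X : Type*} [Group X] (N : Subgroup X) [N.Normal]
    (hab : ∀ x y : X, x * y * x⁻¹ * y⁻¹ ∈ N) [StrongRankCondition (MonoidAlgebra ℤ N)] :
    StrongRankCondition (MonoidAlgebra ℤ X) := by
  classical
  let ι : MonoidAlgebra ℤ N →+* MonoidAlgebra ℤ X := MonoidAlgebra.mapDomainRingHom ℤ N.subtype
  let : CommGroup (X ⧸ N) :=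
    { (inferInstance : Group (X ⧸ N)) with
      mul_comm := by
        intro a b
        obtain ⟨x, rfl⟩ := QuotientGroup.mk_surjective a
        obtain ⟨y, rfl⟩ := QuotientGroup.mk_surjective b
        rw [← QuotientGroup.mk_mul, ← QuotientGroup.mk_mul, QuotientGroup.eq]
        have := hab y⁻¹ x⁻¹
        simpa [mul_assoc] using this }
  let r : X ⧸ N → X := Quotient.out
  have hr : ∀ q, (QuotientGroup.mk (r q) : X ⧸ N) = q := fun q => Quotient.out_eq' q
  let : Module (MonoidAlgebra ℤ N) (MonoidAlgebra ℤ X) := Module.compHom _ ι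
  have hsmul : ∀ (b : MonoidAlgebra ℤ N) (a : MonoidAlgebra ℤ X), b • a = ι b * a :=
    fun _ _ => rfl
  have : IsScalarTower (MonoidAlgebra ℤ N) (MonoidAlgebra ℤ X) (MonoidAlgebra ℤ X) :=
    ⟨fun a b c => by simp only [hsmul, smul_eq_mul, mul_assoc]⟩
  rw [strongRankCondition_iff_succ]
  intro m f hf
  let T : Finset (X ⧸ N) := Finset.univ.biUnion fun i : Fin (m + 1) => Finset.univ.biUnion
    fun j : Fin m => (f (Pi.single i 1) j).coeff.support.image QuotientGroup.mk
  obtain ⟨F, hF⟩ := exists_card_mul_lt T m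
  let v : Fin (m + 1) × F → (Fin (m + 1) → MonoidAlgebra ℤ X) :=
    fun p => Pi.single p.1 (MonoidAlgebra.single (r p.2) 1)
  have hv : LinearIndependent (MonoidAlgebra ℤ N) v := by
    rw [Fintype.linearIndependent_iff]
    rintro g hg ⟨i, q⟩
    have h1 := congrFun hg i
    ext n
    have h2 := congrArg (fun a : MonoidAlgebra ℤ X => a.coeff ((n : X) * r q)) h1
    simp only [v, Finset.sum_apply, Pi.smul_apply, Pi.zero_apply,
      MonoidAlgebra.coeff_sum, Finsupp.finsetSum_apply] at h2
    rw [Fintype.sum_eq_single (i, q)] at h2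
    · simpa [hsmul, ι] using h2
    · rintro ⟨i', q'⟩ hne
      by_cases hi : i' = i
      · subst hi
        have hq : q' ≠ q := fun h => hne (by rw [h])
        have hnot : (n : X) * r q * (r q')⁻¹ ∉ Set.range (N.subtype : N → X) := by
          rintro ⟨k, hk⟩
          apply hq
          have h3 : (QuotientGroup.mk ((n : X) * r q * (r q')⁻¹) : X ⧸ N) = 1 := by
            rw [← hk, QuotientGroup.eq_one_iff]; exact k.2
          have h4 : (QuotientGroup.mk (n : X) : X ⧸ N) = 1 := (QuotientGroup.eq_one_iff _).2 n.2
          rw [QuotientGroup.mk_mul, QuotientGroup.mk_mul, QuotientGroup.mk_inv, hr, hr, h4,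
            one_mul, mul_inv_eq_one] at h3
          exact Subtype.ext h3.symm
        have h5 : (MonoidAlgebra.mapDomain (N.subtype : N → X) (g (i', q'))).coeff
            ((n : X) * r q * (r q')⁻¹) = 0 := by
          rw [MonoidAlgebra.coeff_mapDomain]
          exact Finsupp.mapDomain_of_notMem_range _ _ hnot
        rw [Pi.single_eq_same, hsmul, MonoidAlgebra.coeff_mul_single_apply, mul_one]
        exact h5
      · simp [Pi.single_eq_of_ne (Ne.symm hi)]
  have hv' : LinearIndependent (MonoidAlgebra ℤ N) (fun p => f (v p)) :=
    hv.map' (f.restrictScalars (MonoidAlgebra ℤ N)) (LinearMap.ker_eq_bot.2 hf)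
  let w : Finset (Fin m → MonoidAlgebra ℤ X) :=
    (Finset.univ ×ˢ (T * F)).image fun p : Fin m × (X ⧸ N) =>
      Pi.single p.1 (MonoidAlgebra.single (r p.2) 1)
  have hw : w.card ≤ m * (T * F).card := by
    refine Finset.card_image_le.trans ?_
    simp [Finset.card_product]
  have hspan : Set.range (fun p => f (v p)) ≤
      (Submodule.span (MonoidAlgebra ℤ N) (w : Set (Fin m → MonoidAlgebra ℤ X)) : Set _) := by
    have key : ∀ (j : Fin m) (a : MonoidAlgebra ℤ X),
        (∀ x ∈ a.coeff.support, (QuotientGroup.mk x : X ⧸ N) ∈ T * F) →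
        (Pi.single j a : Fin m → MonoidAlgebra ℤ X) ∈
          Submodule.span (MonoidAlgebra ℤ N) (w : Set (Fin m → MonoidAlgebra ℤ X)) := by
      intro j a ha
      have h1 : a = ∑ x ∈ a.coeff.support, MonoidAlgebra.single x (a.coeff x) := by
        ext y
        simp only [MonoidAlgebra.coeff_sum, Finsupp.finsetSum_apply, MonoidAlgebra.coeff_single,
          Finsupp.single_apply]
        simp
      have h2 : (Pi.single j a : Fin m → MonoidAlgebra ℤ X) =
          ∑ x ∈ a.coeff.support, Pi.single j (MonoidAlgebra.single x (a.coeff x)) := by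
        conv_lhs => rw [h1]
        exact map_sum (AddMonoidHom.single (fun _ : Fin m => MonoidAlgebra ℤ X) j) _ _
      rw [h2]
      refine Submodule.sum_mem _ fun x hx => ?_
      have hxN : x * (r (QuotientGroup.mk x))⁻¹ ∈ N := by
        rw [← QuotientGroup.eq_one_iff, QuotientGroup.mk_mul, QuotientGroup.mk_inv, hr]
        simp
      have h3 : (Pi.single j (MonoidAlgebra.single x (a.coeff x)) : Fin m → MonoidAlgebra ℤ X) =
          (MonoidAlgebra.single (⟨_, hxN⟩ : N) (a.coeff x) : MonoidAlgebra ℤ N) •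
          (Pi.single j (MonoidAlgebra.single (r (QuotientGroup.mk x)) 1) :
            Fin m → MonoidAlgebra ℤ X) := by
        rw [← Pi.single_smul, hsmul]
        congr 1
        simp [ι, MonoidAlgebra.single_mul_single]
      rw [h3]
      refine Submodule.smul_mem _ _ (Submodule.subset_span ?_)
      exact Finset.mem_coe.2 (Finset.mem_image.2 ⟨(j, QuotientGroup.mk x), by simp [ha x hx], rfl⟩)
    rintro _ ⟨⟨i, q⟩, rfl⟩
    have h1 : v (i, q) = (MonoidAlgebra.single (r q) (1 : ℤ)) •
        (Pi.single i (1 : MonoidAlgebra ℤ X) : Fin (m + 1) → MonoidAlgebra ℤ X) := by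
      rw [← Pi.single_smul, smul_eq_mul, mul_one]
    simp only [h1, map_smul]
    rw [SetLike.mem_coe, ← Finset.univ_sum_single (_ • f (Pi.single i 1))]
    refine Submodule.sum_mem _ fun j _ => key j _ fun x hx => ?_
    simp only [Pi.smul_apply, smul_eq_mul, Finsupp.mem_support_iff,
      MonoidAlgebra.coeff_single_mul_apply, one_mul] at hx
    have h2 : (QuotientGroup.mk ((r q)⁻¹ * x) : X ⧸ N) ∈ T :=
      Finset.mem_biUnion.2 ⟨i, Finset.mem_univ _, Finset.mem_biUnion.2 ⟨j, Finset.mem_univ _,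
        Finset.mem_image_of_mem _ (Finsupp.mem_support_iff.2 hx)⟩⟩
    refine Finset.mem_mul.2 ⟨_, h2, q, q.2, ?_⟩
    rw [QuotientGroup.mk_mul, QuotientGroup.mk_inv, hr, mul_comm, mul_inv_cancel_left]
  have h5 := linearIndependent_le_span_aux' _ hv' (w : Set (Fin m → MonoidAlgebra ℤ X)) hspan
  simp only [Fintype.card_prod, Fintype.card_fin, Fintype.card_coe, Finset.coe_sort_coe] at h5
  exact absurd (h5.trans hw) (not_le.2 hF)

theorem uniqueProds_of_torsionFree {Q : Type*} [CommGroup Q]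
    (h : ∀ (x : Q) (k : ℤ), k ≠ 0 → x ^ k = 1 → x = 1) : UniqueProds Q := by
  have : IsMulTorsionFree Q := by
    constructor
    intro n hn x y hxy
    simp only at hxy
    rw [← mul_inv_eq_one]
    refine h _ n (by exact_mod_cast hn) ?_
    rw [mul_zpow, zpow_natCast, hxy, inv_zpow, zpow_natCast, mul_inv_cancel]
  have h1 : UniqueSums (Additive Q) := UniqueSums.of_injective_addHom
    (DivisibleHull.coeAddMonoidHom (M := Additive Q)).toAddHom
    DivisibleHull.coe_injective inferInstance
  exact (inferInstance : UniqueProds (Multiplicative (Additive Q)))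

theorem uniqueProds_of_extension {X : Type*} [Group X] (N : Subgroup X) [N.Normal]
    [UniqueProds N] [UniqueProds (X ⧸ N)] : UniqueProds X := by
  classical
  refine ⟨fun {A B} hA hB => ?_⟩
  obtain ⟨a, ha, b, hb, hab⟩ := UniqueProds.uniqueMul_of_nonempty
    (hA.image (QuotientGroup.mk' N)) (hB.image (QuotientGroup.mk' N))
  obtain ⟨x, hx, rfl⟩ := Finset.mem_image.1 ha
  obtain ⟨y, hy, rfl⟩ := Finset.mem_image.1 hb
  have ix : Function.Injective fun n : N => x * n := fun a b h => Subtype.ext (mul_left_cancel h)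
  have iy : Function.Injective fun n : N => (n : X) * y :=
    fun a b h => Subtype.ext (mul_right_cancel h)
  have hx' : ∀ n : N, n ∈ A.preimage (fun n : N => x * n) ix.injOn ↔ x * n ∈ A :=
    fun n => Finset.mem_preimage
  have hy' : ∀ n : N, n ∈ B.preimage (fun n : N => n * y) iy.injOn ↔ n * y ∈ B :=
    fun n => Finset.mem_preimage
  obtain ⟨n, hn, k, hk, hnk⟩ := UniqueProds.uniqueMul_of_nonempty
    (A := A.preimage (fun n : N => x * n) ix.injOn)
    (B := B.preimage (fun n : N => n * y) iy.injOn)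
    ⟨1, (hx' 1).2 (by simpa using hx)⟩ ⟨1, (hy' 1).2 (by simpa using hy)⟩
  rw [hx'] at hn
  rw [hy'] at hk
  refine ⟨x * n, hn, k * y, hk, UniqueMul.of_image_filter (QuotientGroup.mk' N : X →ₙ* X ⧸ N)
    (aH := QuotientGroup.mk' N x) (bH := QuotientGroup.mk' N y) ?_ ?_ hab ?_⟩
  · simp
  · simp
  · intro a b ha hb h
    simp only [Finset.mem_filter] at ha hb
    have ha2 : x⁻¹ * a ∈ N := QuotientGroup.eq.1 ha.2.symm
    have hb2 : b * y⁻¹ ∈ N := by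
      have := hb.2
      rw [← QuotientGroup.eq_one_iff, QuotientGroup.mk_mul, QuotientGroup.mk_inv]
      exact mul_inv_eq_one.2 this
    have := hnk (a := ⟨_, ha2⟩) (b := ⟨_, hb2⟩) ((hx' _).2 (by simpa using ha.1))
      ((hy' _).2 (by simpa using hb.1)) (Subtype.ext (by
        simp only [Subgroup.coe_mul]
        calc x⁻¹ * a * (b * y⁻¹) = x⁻¹ * (a * b) * y⁻¹ := by group
          _ = x⁻¹ * (x * n * (k * y)) * y⁻¹ := by rw [h]
          _ = n * k := by group))
    constructor
    · rw [← this.1]; simp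
    · rw [← this.2]; simp

theorem uniqueProds_and_strongRankCondition_of_chain (m : ℕ) :
    ∀ (X : Type u) [Group X] (c : ℕ → Subgroup X), c 0 = ⊤ → c m = ⊥ →
      (∀ i < m, ∀ x ∈ c i, ∀ y ∈ c i, x * y * x⁻¹ * y⁻¹ ∈ c (i + 1)) →
      (∀ i < m, ∀ x ∈ c i, ∀ k : ℤ, k ≠ 0 → x ^ k ∈ c (i + 1) → x ∈ c (i + 1)) →
      UniqueProds X ∧ StrongRankCondition (MonoidAlgebra ℤ X) := by
  induction m with
  | zero =>
    intro X _ c h0 hm _ _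
    have h1 : ∀ x : X, x = 1 := fun x => by
      have : x ∈ c 0 := h0 ▸ Subgroup.mem_top x
      rwa [hm, Subgroup.mem_bot] at this
    let : CommGroup X :=
      { (inferInstance : Group X) with mul_comm := fun a b => by rw [h1 a, h1 b] }
    have : Subsingleton X := ⟨fun a b => (h1 a).trans (h1 b).symm⟩
    refine ⟨⟨fun {A B} hA hB => ⟨1, ?_, 1, ?_, UniqueMul.of_subsingleton⟩⟩,
      (inferInstance : StrongRankCondition (MonoidAlgebra ℤ X))⟩
    · obtain ⟨a, ha⟩ := hA; rwa [h1 a] at ha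
    · obtain ⟨a, ha⟩ := hB; rwa [h1 a] at ha
  | succ m ih =>
    intro X _ c h0 hm hcomm htf
    have hab : ∀ x y : X, x * y * x⁻¹ * y⁻¹ ∈ c 1 := fun x y =>
      hcomm 0 m.succ_pos x (h0 ▸ Subgroup.mem_top x) y (h0 ▸ Subgroup.mem_top y)
    have : (c 1).Normal := ⟨fun n hn g => by
      have := (c 1).mul_mem (hab g n) hn
      simpa using this⟩
    obtain ⟨h1, h2⟩ := ih (c 1) (fun i => (c (i + 1)).subgroupOf (c 1)) (by simp)
      (by simp only [hm]; simp)
      (fun i hi x hx y hy => hcomm (i + 1) (by omega) x hx y hy)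
      (fun i hi x hx k hk hxk => htf (i + 1) (by omega) x hx k hk (by simpa [Subgroup.mem_subgroupOf] using hxk))
    let : CommGroup (X ⧸ c 1) :=
      { (inferInstance : Group (X ⧸ c 1)) with
        mul_comm := by
          intro a b
          obtain ⟨x, rfl⟩ := QuotientGroup.mk_surjective a
          obtain ⟨y, rfl⟩ := QuotientGroup.mk_surjective b
          rw [← QuotientGroup.mk_mul, ← QuotientGroup.mk_mul, QuotientGroup.eq]
          have := hab y⁻¹ x⁻¹
          simpa [mul_assoc] using this }
    have h3 : UniqueProds (X ⧸ c 1) := uniqueProds_of_torsionFree (by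
      intro a k hk h
      obtain ⟨x, rfl⟩ := QuotientGroup.mk_surjective a
      refine (QuotientGroup.eq_one_iff x).2 (htf 0 m.succ_pos x (h0 ▸ Subgroup.mem_top x) k hk ?_)
      exact (QuotientGroup.eq_one_iff (x ^ k)).1 h)
    exact ⟨uniqueProds_of_extension (c 1), strongRankCondition_of_extension (c 1) hab⟩

/-- The anti-automorphism `g ↦ g⁻¹` of an integral group ring. -/
noncomputable def groupRingInv (X : Type u) [Group X] :
    MonoidAlgebra ℤ X →ₐ[ℤ] (MonoidAlgebra ℤ X)ᵐᵒᵖ :=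
  MonoidAlgebra.lift ℤ _ X
    { toFun := fun x => MulOpposite.op (MonoidAlgebra.single x⁻¹ 1)
      map_one' := by simp [MonoidAlgebra.one_def]
      map_mul' := fun x y => by
        rw [← MulOpposite.op_mul, MonoidAlgebra.single_mul_single, mul_inv_rev, mul_one] }

theorem groupRingInv_groupRingInv {X : Type u} [Group X] (a : MonoidAlgebra ℤ X) :
    (groupRingInv X (groupRingInv X a).unop).unop = a := by
  induction a using MonoidAlgebra.induction_on with
  | of g => simp [groupRingInv]
  | add x y hx hy => simp only [map_add, MulOpposite.unop_add, hx, hy]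
  | smul r x hx => simp only [map_zsmul, MulOpposite.unop_smul, hx]

/-- The right Ore condition for integral group rings. -/
theorem exists_mul_eq_mul {X : Type u} [Group X] [UniqueProds X]
    [StrongRankCondition (MonoidAlgebra ℤ X)] (r s : MonoidAlgebra ℤ X) (hs : s ≠ 0) :
    ∃ r' s' : MonoidAlgebra ℤ X, s' ≠ 0 ∧ r * s' = s * r' := by
  have : IsDomain (MonoidAlgebra ℤ X) := NoZeroDivisors.to_isDomain _
  obtain ⟨hO⟩ := nonempty_oreSet_of_strongRankCondition (R := MonoidAlgebra ℤ X)
  have hinj : ∀ a : MonoidAlgebra ℤ X, a ≠ 0 → (groupRingInv X a).unop ≠ 0 := fun a ha h => ha (by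
    rw [← groupRingInv_groupRingInv a, h, map_zero, MulOpposite.unop_zero])
  obtain ⟨r', s', h⟩ := (OreLocalization.nonempty_oreSet_iff_of_noZeroDivisors.1 ⟨hO⟩)
    (groupRingInv X r).unop ⟨_, mem_nonZeroDivisors_of_ne_zero (hinj s hs)⟩
  refine ⟨(groupRingInv X r').unop, (groupRingInv X s').unop,
    hinj _ (nonZeroDivisors.ne_zero s'.2), ?_⟩
  have := congrArg (fun a => (groupRingInv X a).unop) h
  simpa only [map_mul, MulOpposite.unop_mul, groupRingInv_groupRingInv] using this

/-! ### The rational derived series -/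

section RationalDerivedSeries

variable {G : Type u} [Group G]

theorem abelianization_of_eq_one_iff (H : Subgroup G) (x : H) :
    Abelianization.of x = 1 ↔ (x : G) ∈ ⁅H, H⁆ := by
  rw [← MonoidHom.mem_ker, Abelianization.ker_of, ← Subgroup.map_subtype_commutator,
    Subgroup.mem_map]
  constructor
  · exact fun h => ⟨x, h, rfl⟩
  · rintro ⟨y, hy, h⟩
    rwa [← Subtype.ext h]

/-- The subgroup of those elements of `H` that have a nonzero power in `[H, H]`. -/
def rationalDerived (H : Subgroup G) : Subgroup G where
  carrier := {g | g ∈ H ∧ ∃ k : ℤ, k ≠ 0 ∧ g ^ k ∈ ⁅H, H⁆}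
  one_mem' := ⟨H.one_mem, 1, one_ne_zero, by simp⟩
  inv_mem' := by
    rintro x ⟨hx, k, hk, hxk⟩
    exact ⟨H.inv_mem hx, k, hk, by rw [inv_zpow]; exact inv_mem hxk⟩
  mul_mem' := by
    rintro x y ⟨hx, k, hk, hxk⟩ ⟨hy, l, hl, hyl⟩
    refine ⟨H.mul_mem hx hy, k * l, mul_ne_zero hk hl, ?_⟩
    have h1 := (abelianization_of_eq_one_iff H (⟨x, hx⟩ ^ k)).2 hxk
    have h2 := (abelianization_of_eq_one_iff H (⟨y, hy⟩ ^ l)).2 hyl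
    refine (abelianization_of_eq_one_iff H ((⟨x, hx⟩ * ⟨y, hy⟩) ^ (k * l))).1 ?_
    rw [map_zpow] at h1 h2
    rw [map_zpow, map_mul, mul_zpow, zpow_mul, h1, one_zpow, mul_comm k, zpow_mul, h2, one_zpow,
      one_mul]

variable (G) in
/-- The rational derived series of `G`: `G_r^{(0)} = G`, and `G_r^{(n+1)}` consists of the elements
of `G_r^{(n)}` that have a nonzero power in `[G_r^{(n)}, G_r^{(n)}]`. -/
def rationalDerivedSeries : ℕ → Subgroup G
  | 0 => ⊤
  | n + 1 => rationalDerived (rationalDerivedSeries n)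

theorem rationalDerivedSeries_antitone : Antitone (rationalDerivedSeries G) :=
  antitone_nat_of_succ_le fun _ _ h => h.1

instance rationalDerivedSeries_normal (n : ℕ) : (rationalDerivedSeries G n).Normal := by
  induction n with
  | zero => exact (inferInstance : (⊤ : Subgroup G).Normal)
  | succ n ih =>
    refine ⟨fun x hx g => ?_⟩
    obtain ⟨hx, k, hk, hxk⟩ := hx
    refine ⟨ih.conj_mem x hx g, k, hk, ?_⟩
    rw [conj_zpow]
    exact (Subgroup.commutator_normal _ _).conj_mem _ hxk g

theorem mem_rationalDerivedSeries_of_zpow_mem (n : ℕ) {x : G} (hx : x ∈ rationalDerivedSeries G n)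
    {k : ℤ} (hk : k ≠ 0) (h : x ^ k ∈ rationalDerivedSeries G (n + 1)) :
    x ∈ rationalDerivedSeries G (n + 1) := by
  obtain ⟨-, l, hl, h⟩ := h
  exact ⟨hx, k * l, mul_ne_zero hk hl, by rwa [zpow_mul]⟩

theorem commutator_mem_rationalDerivedSeries (n : ℕ) {x y : G}
    (hx : x ∈ rationalDerivedSeries G n) (hy : y ∈ rationalDerivedSeries G n) :
    x * y * x⁻¹ * y⁻¹ ∈ rationalDerivedSeries G (n + 1) := by
  have h : x * y * x⁻¹ * y⁻¹ ∈ ⁅rationalDerivedSeries G n, rationalDerivedSeries G n⁆ :=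
    Subgroup.commutator_mem_commutator hx hy
  exact ⟨Subgroup.commutator_le_left _ _ h, 1, one_ne_zero, by simpa using h⟩

variable (G) in
/-- The quotient `Γₙ` of `G` by the `(n+1)`-st term of its rational derived series. -/
abbrev Gam (n : ℕ) : Type u := G ⧸ rationalDerivedSeries G (n + 1)

theorem uniqueProds_and_strongRankCondition_of_injective {n : ℕ} {X : Type u} [Group X]
    (j : X →* Gam G n) (hj : Function.Injective j) :
    UniqueProds X ∧ StrongRankCondition (MonoidAlgebra ℤ X) := by
  have key : ∀ i ≤ n + 1, ∀ g : G, (QuotientGroup.mk g : Gam G n) ∈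
      (rationalDerivedSeries G i).map (QuotientGroup.mk' _) ↔ g ∈ rationalDerivedSeries G i := by
    intro i hi g
    constructor
    · rintro ⟨h, hh, e⟩
      have h1 : h⁻¹ * g ∈ rationalDerivedSeries G (n + 1) := QuotientGroup.eq.1 e
      have := Subgroup.mul_mem _ hh (rationalDerivedSeries_antitone hi h1)
      rwa [mul_inv_cancel_left] at this
    · exact fun h => ⟨g, h, rfl⟩
  refine uniqueProds_and_strongRankCondition_of_chain (n + 1) X
    (fun i => ((rationalDerivedSeries G i).map (QuotientGroup.mk' _)).comap j) ?_ ?_ ?_ ?_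
  · rw [eq_top_iff]
    intro x _
    obtain ⟨g, hg⟩ := QuotientGroup.mk_surjective (j x)
    exact ⟨g, Subgroup.mem_top g, hg⟩
  · rw [eq_bot_iff]
    intro x hx
    obtain ⟨g, hg⟩ := QuotientGroup.mk_surjective (j x)
    rw [Subgroup.mem_comap, ← hg, key _ le_rfl, ← QuotientGroup.eq_one_iff, hg] at hx
    exact hj (hx.trans (map_one j).symm)
  · intro i hi x hx y hy
    obtain ⟨g, hg⟩ := QuotientGroup.mk_surjective (j x)
    obtain ⟨h, hh⟩ := QuotientGroup.mk_surjective (j y)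
    rw [Subgroup.mem_comap, ← hg, key _ hi.le] at hx
    rw [Subgroup.mem_comap, ← hh, key _ hi.le] at hy
    rw [Subgroup.mem_comap, map_mul, map_mul, map_mul, map_inv, map_inv, ← hg, ← hh]
    exact (key (i + 1) hi _).2 (commutator_mem_rationalDerivedSeries i hx hy)
  · intro i hi x hx k hk hxk
    obtain ⟨g, hg⟩ := QuotientGroup.mk_surjective (j x)
    rw [Subgroup.mem_comap, ← hg, key _ hi.le] at hx
    rw [Subgroup.mem_comap, map_zpow, ← hg] at hxk
    rw [Subgroup.mem_comap, ← hg, key _ hi]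
    exact mem_rationalDerivedSeries_of_zpow_mem i hx hk ((key (i + 1) hi (g ^ k)).1 hxk)

instance (n : ℕ) : UniqueProds (Gam G n) :=
  (uniqueProds_and_strongRankCondition_of_injective (MonoidHom.id _) Function.injective_id).1

instance (n : ℕ) (P : Subgroup (Gam G n)) : UniqueProds P :=
  (uniqueProds_and_strongRankCondition_of_injective P.subtype P.subtype_injective).1

instance (n : ℕ) (P : Subgroup (Gam G n)) : StrongRankCondition (MonoidAlgebra ℤ P) :=
  (uniqueProds_and_strongRankCondition_of_injective P.subtype P.subtype_injective).2

end RationalDerivedSeries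

/-! ### Higher-order Alexander modules and degrees -/

section Degrees

variable {G : Type u} [Group G]

theorem rationalDerivedSeries_le_ker (ψ : G →* Multiplicative ℤ) (n : ℕ) :
    rationalDerivedSeries G (n + 1) ≤ ψ.ker := by
  intro x hx
  obtain ⟨-, k, hk, h⟩ := rationalDerivedSeries_antitone (Nat.le_add_left 1 n) hx
  have h1 : ψ (x ^ k) = 1 :=
    Abelianization.commutator_subset_ker ψ h
  rw [map_zpow] at h1
  have h2 : k * (ψ x).toAdd = 0 := by simpa using congrArg Multiplicative.toAdd h1
  exact (mul_eq_zero.1 h2).resolve_left hk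

/-- The homomorphism `Γₙ → ℤ` induced by `ψ : G → ℤ`. -/
def psiBar (ψ : G →* Multiplicative ℤ) (n : ℕ) : Gam G n →* Multiplicative ℤ :=
  QuotientGroup.lift _ ψ (rationalDerivedSeries_le_ker ψ n)

/-- The kernel `Γ̄ₙ` of the homomorphism `Γₙ → ℤ` induced by `ψ`. -/
def GamBar (ψ : G →* Multiplicative ℤ) (n : ℕ) : Subgroup (Gam G n) := (psiBar ψ n).ker

instance (ψ : G →* Multiplicative ℤ) (n : ℕ) : (GamBar ψ n).Normal :=
  (inferInstance : (psiBar ψ n).ker.Normal)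

/-- The opposite of the group ring `ℤΓₙ`: a right `ℤΓₙ`-module is a module over this ring. -/
abbrev GamRingOp (G : Type u) [Group G] (n : ℕ) : Type u := (MonoidAlgebra ℤ (Gam G n))ᵐᵒᵖ

/-- The opposite of the group ring `ℤΓ̄ₙ`. -/
abbrev GamBarRingOp (ψ : G →* Multiplicative ℤ) (n : ℕ) : Type u :=
  (MonoidAlgebra ℤ (GamBar ψ n))ᵐᵒᵖ

/-- The inclusion of `ℤΓ̄ₙ` into `ℤΓₙ` (on opposite rings). -/
noncomputable def gamBarIncl (ψ : G →* Multiplicative ℤ) (n : ℕ) :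
    GamBarRingOp ψ n →+* GamRingOp G n :=
  RingHom.op (MonoidAlgebra.mapDomainRingHom ℤ (GamBar ψ n).subtype)

theorem gamBarIncl_injective (ψ : G →* Multiplicative ℤ) (n : ℕ) :
    Function.Injective (gamBarIncl ψ n) := by
  intro a b h
  have := MulOpposite.op_injective h
  exact MulOpposite.unop_injective
    (MonoidAlgebra.mapDomain_injective (GamBar ψ n).subtype_injective this)

noncomputable instance (ψ : G →* Multiplicative ℤ) (n : ℕ) :
    OreLocalization.OreSet (nonZeroDivisors (GamBarRingOp ψ n)) :=
  Classical.choice <| by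
    rw [OreLocalization.nonempty_oreSet_iff_of_noZeroDivisors]
    rintro r ⟨s, hs⟩
    obtain ⟨r', s', hs', h⟩ := exists_mul_eq_mul r.unop s.unop
      (fun h => nonZeroDivisors.ne_zero hs (MulOpposite.unop_injective h))
    exact ⟨MulOpposite.op r', ⟨MulOpposite.op s', mem_nonZeroDivisors_of_ne_zero
      (fun h => hs' (MulOpposite.op_injective h))⟩, MulOpposite.unop_injective h⟩

/-- The (opposite of the) right ring of quotients `𝕂ₙ` of `ℤΓ̄ₙ`, a skew field. -/
abbrev KOp (ψ : G →* Multiplicative ℤ) (n : ℕ) : Type u :=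
  OreLocalization (nonZeroDivisors (GamBarRingOp ψ n)) (GamBarRingOp ψ n)

/-- The set `Sₙ` of nonzero elements of `ℤΓ̄ₙ`, as a submonoid of (the opposite of) `ℤΓₙ`. -/
noncomputable def nonzeroBar (ψ : G →* Multiplicative ℤ) (n : ℕ) : Submonoid (GamRingOp G n) :=
  (nonZeroDivisors (GamBarRingOp ψ n)).map (gamBarIncl ψ n)

theorem exists_mul_eq_mul_of_bar (ψ : G →* Multiplicative ℤ) (n : ℕ)
    (a : MonoidAlgebra ℤ (Gam G n)) :
    ∀ b : MonoidAlgebra ℤ (GamBar ψ n), b ≠ 0 →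
      ∃ (a' : MonoidAlgebra ℤ (Gam G n)) (b' : MonoidAlgebra ℤ (GamBar ψ n)), b' ≠ 0 ∧
        a * MonoidAlgebra.mapDomainRingHom ℤ (GamBar ψ n).subtype b' =
          MonoidAlgebra.mapDomainRingHom ℤ (GamBar ψ n).subtype b * a' := by
  induction a using MonoidAlgebra.induction_on with
  | of m =>
    intro b hb
    have h : ∀ b : MonoidAlgebra ℤ (GamBar ψ n),
        MonoidAlgebra.of ℤ _ m * MonoidAlgebra.mapDomainRingHom ℤ (GamBar ψ n).subtype
          (MonoidAlgebra.mapDomainRingHom ℤ (MulAut.conjNormal m⁻¹).toMonoidHom b) =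
        MonoidAlgebra.mapDomainRingHom ℤ (GamBar ψ n).subtype b * MonoidAlgebra.of ℤ _ m := by
      intro b
      induction b using MonoidAlgebra.induction_on with
      | of k =>
        simp only [MonoidAlgebra.of_apply, MonoidAlgebra.mapDomainRingHom_apply,
          MonoidAlgebra.mapDomain_single, MonoidAlgebra.single_mul_single]
        congr 1
        simp [mul_assoc]
      | add x y hx hy => simp only [map_add, mul_add, add_mul, hx, hy]
      | smul r x hx => simp only [map_zsmul, mul_smul_comm, smul_mul_assoc, hx]
    refine ⟨_, _, fun h0 => hb ?_, h b⟩
    exact MonoidAlgebra.mapDomain_injective (MulAut.conjNormal m⁻¹).injective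
      (h0.trans (MonoidAlgebra.mapDomain_zero _).symm)
  | add x y hx hy =>
    intro b hb
    obtain ⟨x', b₁, hb₁, h₁⟩ := hx b hb
    obtain ⟨y', b₂, hb₂, h₂⟩ := hy b hb
    obtain ⟨u, v, hv, h⟩ := exists_mul_eq_mul b₁ b₂ hb₂
    refine ⟨x' * MonoidAlgebra.mapDomainRingHom ℤ (GamBar ψ n).subtype v +
      y' * MonoidAlgebra.mapDomainRingHom ℤ (GamBar ψ n).subtype u, b₁ * v,
      mul_ne_zero hb₁ hv, ?_⟩
    rw [add_mul, mul_add]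
    congr 1
    · rw [map_mul, ← mul_assoc, h₁, mul_assoc]
    · rw [h, map_mul, ← mul_assoc, h₂, mul_assoc]
  | smul r x hx =>
    intro b hb
    obtain ⟨x', b', hb', h⟩ := hx b hb
    exact ⟨r • x', b', hb', by rw [smul_mul_assoc, h, mul_smul_comm]⟩

theorem exists_mul_eq_mul_nonzeroBar (ψ : G →* Multiplicative ℤ) (n : ℕ) (r : GamRingOp G n) :
    ∀ s : nonzeroBar ψ n, ∃ (r' : GamRingOp G n) (s' : nonzeroBar ψ n), (s' : GamRingOp G n) * r =
      r' * s := by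
  rintro ⟨_, s, hs, rfl⟩
  obtain ⟨a', b', hb', h⟩ := exists_mul_eq_mul_of_bar ψ n r.unop s.unop
    (fun h => nonZeroDivisors.ne_zero hs (MulOpposite.unop_injective h))
  exact ⟨MulOpposite.op a', ⟨gamBarIncl ψ n (MulOpposite.op b'), Submonoid.mem_map_of_mem _
    (mem_nonZeroDivisors_of_ne_zero fun h => hb' (MulOpposite.op_injective h))⟩,
    MulOpposite.unop_injective h⟩

noncomputable instance (ψ : G →* Multiplicative ℤ) (n : ℕ) :
    OreLocalization.OreSet (nonzeroBar ψ n) :=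
  Classical.choice <| OreLocalization.nonempty_oreSet_iff_of_noZeroDivisors.2
    (exists_mul_eq_mul_nonzeroBar ψ n)

/-- The (opposite of the) localization `Rₙ = (ℤΓₙ)Sₙ⁻¹`. -/
abbrev ROp (ψ : G →* Multiplicative ℤ) (n : ℕ) : Type u :=
  OreLocalization (nonzeroBar ψ n) (GamRingOp G n)

/-- The homomorphism `𝕂ₙ → Rₙ` that extends the inclusion `ℤΓ̄ₙ → ℤΓₙ` (on opposite rings). -/
noncomputable def KToR (ψ : G →* Multiplicative ℤ) (n : ℕ) : KOp ψ n →+* ROp ψ n :=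
  let f : GamBarRingOp ψ n →+* ROp ψ n :=
    OreLocalization.numeratorRingHom.comp (gamBarIncl ψ n)
  OreLocalization.universalHom f
    (IsUnit.liftRight (f.toMonoidHom.comp (nonZeroDivisors (GamBarRingOp ψ n)).subtype)
      fun s => OreLocalization.numerator_isUnit
        (⟨gamBarIncl ψ n s, Submonoid.mem_map_of_mem _ s.2⟩ : nonzeroBar ψ n))
    fun _ => rfl

variable (G) in
/-- The `n`-th order Alexander module `G_r^{(n+1)} / [G_r^{(n+1)}, G_r^{(n+1)}]`, which is
`H₁(𝒰; ℤΓₙ)`, the first homology of the covering with deck group `Γₙ`, when `G = π₁(𝒰)`. -/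
def AlexanderModule (n : ℕ) : Type u := Additive (Abelianization (rationalDerivedSeries G (n + 1)))

noncomputable instance (n : ℕ) : AddCommGroup (AlexanderModule G n) :=
  inferInstanceAs (AddCommGroup (Additive (Abelianization (rationalDerivedSeries G (n + 1)))))

variable (G) in
/-- The class in the Alexander module of an element of `G_r^{(n+1)}`. -/
def AlexanderModule.mk (n : ℕ) (x : rationalDerivedSeries G (n + 1)) : AlexanderModule G n :=
  Additive.ofMul (Abelianization.of x)

theorem AlexanderModule.mk_surjective (n : ℕ) : Function.Surjective (AlexanderModule.mk G n) := by
  intro a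
  obtain ⟨x, hx⟩ := QuotientGroup.mk_surjective (Additive.toMul a : Abelianization _)
  exact ⟨x, congrArg Additive.ofMul hx⟩

variable (G) in
/-- The right action of `G` on its `n`-th order Alexander module by `[x] · g = [g⁻¹ x g]`. -/
noncomputable def conjAction (n : ℕ) : G →* (AddMonoid.End (AlexanderModule G n))ᵐᵒᵖ where
  toFun g := MulOpposite.op (MonoidHom.toAdditive (Abelianization.map
    (MulAut.conjNormal (H := rationalDerivedSeries G (n + 1)) g⁻¹).toMonoidHom))
  map_one' := by
    refine MulOpposite.unop_injective (AddMonoidHom.ext fun a => ?_)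
    obtain ⟨x, rfl⟩ := AlexanderModule.mk_surjective n a
    refine congrArg (AlexanderModule.mk G n) (Subtype.ext ?_)
    simp
  map_mul' g h := by
    refine MulOpposite.unop_injective (AddMonoidHom.ext fun a => ?_)
    obtain ⟨x, rfl⟩ := AlexanderModule.mk_surjective n a
    refine congrArg (AlexanderModule.mk G n) (Subtype.ext ?_)
    simp [mul_assoc]

theorem conjAction_mk (n : ℕ) (g : G) (x : rationalDerivedSeries G (n + 1)) :
    (conjAction G n g).unop (AlexanderModule.mk G n x) =
      AlexanderModule.mk G n (MulAut.conjNormal g⁻¹ x) :=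
  rfl

variable (G) in
/-- The induced action of `Γₙ`. -/
noncomputable def gamAction (n : ℕ) : Gam G n →* (AddMonoid.End (AlexanderModule G n))ᵐᵒᵖ :=
  QuotientGroup.lift _ (conjAction G n) (by
    intro g hg
    refine MulOpposite.unop_injective (AddMonoidHom.ext fun a => ?_)
    obtain ⟨x, rfl⟩ := AlexanderModule.mk_surjective n a
    refine (conjAction_mk n g x).trans ?_
    have h : MulAut.conjNormal g⁻¹ x = (⟨g, hg⟩ : rationalDerivedSeries G (n + 1))⁻¹ * x * ⟨g, hg⟩ :=
      Subtype.ext (by simp)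
    rw [h]
    change Abelianization.of _ = Abelianization.of _
    rw [map_mul, map_mul, map_inv, mul_comm, mul_inv_cancel_left])

/-- The `n`-th order Alexander module as a right `ℤΓₙ`-module. -/
noncomputable instance (n : ℕ) : Module (GamRingOp G n) (AlexanderModule G n) :=
  Module.compHom _ ((RingEquiv.opOp (AddMonoid.End (AlexanderModule G n))).symm.toRingHom.comp
    (RingHom.op (MonoidAlgebra.lift ℤ _ _ (gamAction G n)).toRingHom))

theorem op_single_smul_mk (n : ℕ) (g : G) (x : rationalDerivedSeries G (n + 1)) :
    (MulOpposite.op (MonoidAlgebra.single (QuotientGroup.mk g) 1) : GamRingOp G n) •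
        AlexanderModule.mk G n x =
      AlexanderModule.mk G n (MulAut.conjNormal g⁻¹ x) := by
  rw [← conjAction_mk]
  change ((MonoidAlgebra.lift ℤ _ _ (gamAction G n)) (MonoidAlgebra.single _ 1)).unop _ = _
  rw [MonoidAlgebra.lift_single, one_smul]
  rfl

/-- The localized Alexander module `H₁(𝒰; Rₙ) = H₁(𝒰; ℤΓₙ) ⊗ Rₙ`, for `G = π₁(𝒰)`, as a right
`Rₙ`-module: the module of fractions `x s⁻¹` with `x` in the Alexander module and `s ∈ Sₙ`. -/
def LocalizedAlexanderModule (ψ : G →* Multiplicative ℤ) (n : ℕ) : Type u :=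
  OreLocalization (nonzeroBar ψ n) (AlexanderModule G n)

noncomputable instance (ψ : G →* Multiplicative ℤ) (n : ℕ) :
    AddCommGroup (LocalizedAlexanderModule ψ n) :=
  inferInstanceAs (AddCommGroup (OreLocalization (nonzeroBar ψ n) (AlexanderModule G n)))

noncomputable instance (ψ : G →* Multiplicative ℤ) (n : ℕ) :
    Module (ROp ψ n) (LocalizedAlexanderModule ψ n) :=
  inferInstanceAs (Module (ROp ψ n) (OreLocalization (nonzeroBar ψ n) (AlexanderModule G n)))

noncomputable instance (ψ : G →* Multiplicative ℤ) (n : ℕ) :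
    Module (KOp ψ n) (LocalizedAlexanderModule ψ n) :=
  Module.compHom _ (KToR ψ n)

/-- The `n`-th order degree of `(G, ψ)`: the rank over the skew field `𝕂ₙ` of the localized
Alexander module. -/
noncomputable def degree (ψ : G →* Multiplicative ℤ) (n : ℕ) : Cardinal.{u} :=
  Module.rank (KOp ψ n) (LocalizedAlexanderModule ψ n)

end Degrees

/-! ### Plane curve complements -/

/-- The complement in `ℂ²` of the curve `f = 0`. -/
abbrev Complement (f : MvPolynomial (Fin 2) ℂ) : Type :=
  {p : Fin 2 → ℂ // MvPolynomial.eval p f ≠ 0}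

/-- The map `f : ℂ² ∖ C → ℂ ∖ {0}`. -/
noncomputable def evalMap (f : MvPolynomial (Fin 2) ℂ) : C(Complement f, {z : ℂ // z ≠ 0}) where
  toFun p := ⟨MvPolynomial.eval p.1 f, p.2⟩
  continuous_toFun :=
    Continuous.subtype_mk ((MvPolynomial.continuous_eval f).comp continuous_subtype_val) _

/-- The isomorphism `k ↦ 2πik` from `ℤ` onto the group of periods of `exp`. -/
noncomputable def intEquivPeriods :
    ℤ ≃+ AddSubgroup.zmultiples (2 * Real.pi * Complex.I) :=
  AddEquiv.ofBijective ((zmultiplesHom _) ⟨_, AddSubgroup.mem_zmultiples _⟩) (by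
    constructor
    · rw [injective_iff_map_eq_zero]
      intro k hk
      have h := congrArg Subtype.val hk
      simpa [Complex.two_pi_I_ne_zero] using h
    · rintro ⟨_, k, rfl⟩
      exact ⟨k, rfl⟩)

/-- The winding number about `0` of loops in `ℂ ∖ {0}`: if `w` is a continuous logarithm along the
loop, it is `(w(1) - w(0)) / 2πi`. -/
noncomputable def windingNumber (z : {z : ℂ // z ≠ 0}) :
    FundamentalGroup {z : ℂ // z ≠ 0} z →* Multiplicative ℤ :=
  (AddEquiv.toMultiplicative intEquivPeriods.symm).toMonoidHom.comp
    (MulOpposite.opMulEquiv.symm.toMonoidHom.comp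
      (Complex.isAddQuotientCoveringMap_exp.fundamentalGroupToMulOpposite
        ⟨Complex.log z, Subtype.ext (Complex.exp_log z.2)⟩))

theorem windingNumber_spec {z : {z : ℂ // z ≠ 0}} (γ : Path z z) (w : C(unitInterval, ℂ))
    (hw : ∀ t, Complex.exp (w t) = γ t) :
    w 1 - w 0 = 2 * Real.pi * Complex.I *
      ((windingNumber z (FundamentalGroup.fromPath (Path.Homotopic.Quotient.mk γ))).toAdd : ℤ) := by
  let e : (fun z : ℂ ↦ (⟨_, z.exp_ne_zero⟩ : {z : ℂ // z ≠ 0})) ⁻¹' {z} :=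
    ⟨Complex.log z, Subtype.ext (Complex.exp_log z.2)⟩
  let k : ℤ := (windingNumber z (FundamentalGroup.fromPath (Path.Homotopic.Quotient.mk γ))).toAdd
  have h1 : (k • (2 * Real.pi * Complex.I) : ℂ) + Complex.log z =
      Complex.isCoveringMap_exp.liftPath γ (e : ℂ) (γ.source.trans e.2.symm) 1 := by
    have := Complex.isAddQuotientCoveringMap_exp.unop_fundamentalGroupToMulOpposite_smul (e := e)
      (γ := FundamentalGroup.fromPath (Path.Homotopic.Quotient.mk γ))
    refine Eq.trans ?_ this
    have h2 : intEquivPeriods k = (MulOpposite.unop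
        (Complex.isAddQuotientCoveringMap_exp.fundamentalGroupToMulOpposite e
          (FundamentalGroup.fromPath (Path.Homotopic.Quotient.mk γ)))).toAdd :=
      intEquivPeriods.apply_symm_apply _
    have h3 := congrArg Subtype.val h2
    exact congrArg (· + Complex.log z) h3
  have hw0 : Complex.exp (Complex.log z - w 0) = 1 := by
    rw [Complex.exp_sub, hw, γ.source, Complex.exp_log z.2, div_self z.2]
  have h2 := (Complex.isCoveringMap_exp.eq_liftPath_iff' (γ := γ) (e := (e : ℂ))
    (γ.source.trans e.2.symm) (Γ := w + ContinuousMap.const _ (Complex.log z - w 0))).2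
    ⟨by
      ext t
      simp [Complex.exp_add, hw0, hw], by simp [e]⟩
  rw [← h2] at h1
  simp only [ContinuousMap.add_apply, ContinuousMap.const_apply, zsmul_eq_mul] at h1
  change _ = 2 * Real.pi * Complex.I * (k : ℂ)
  linear_combination -h1

/-- The total linking number homomorphism `π₁(ℂ² ∖ C) → ℤ`: it sends the class of a loop to the
winding number about `0` of its image under `f`. For a reduced equation `f` of `C` it has the value `1` on every meridian of `C`. -/
noncomputable def linkingNumber (f : MvPolynomial (Fin 2) ℂ) (u : Complement f) :
    FundamentalGroup (Complement f) u →* Multiplicative ℤ :=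
  (windingNumber _).comp (FundamentalGroup.map (evalMap f) u)

/-- The `n`-th order degree `δₙ` of the curve `f = 0` (possibly infinite, hence a cardinal),
computed at the base point `u`. -/
noncomputable def higherOrderDegree (f : MvPolynomial (Fin 2) ℂ) (u : Complement f) (n : ℕ) :
    Cardinal.{0} :=
  degree (linkingNumber f u) n

/-- The relations of the braid group on four strands, where the generator `i` stands for
`σᵢ₊₁`. -/
def braidRels : Set (FreeGroup (Fin 3)) :=
  let σ : Fin 3 → FreeGroup (Fin 3) := FreeGroup.of
  {σ 0 * σ 2 * (σ 2 * σ 0)⁻¹,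
    σ 0 * σ 1 * σ 0 * (σ 1 * σ 0 * σ 1)⁻¹,
    σ 1 * σ 2 * σ 1 * (σ 2 * σ 1 * σ 2)⁻¹}

/-- The braid group on four strands. -/
abbrev BraidGroup4 : Type := PresentedGroup braidRels

/-- The standard generators `σ₁, σ₂, σ₃` of the braid group. -/
def sigma (i : Fin 3) : BraidGroup4 := PresentedGroup.of i

end CurveComplement

/-! ### Ore localizations of modules -/

namespace OreLocalization

variable {R : Type*} [Ring R] {S : Submonoid R} [OreSet S]
  {X : Type*} [AddCommGroup X] [Module R X] {Y : Type*} [AddCommGroup Y] [Module R Y]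

/-! Put A = z = σ₃σ₁⁻¹, W = σ₁⁻¹σ₂, P = σ₂σ₁⁻¹. Right modules become left G-modules by g • x = x
g⁻¹, and a, w, p, t, s denote the actions of A, W, P, σ₁, σ₂.

Only the nontriviality of ψ matters: 𝔅₄ has abelianization ℤ, so ker ψ = G_r^{(1)} for every ψ ≠ 1.
The linking number is nontrivial because on a complex line where f is not constant, some loop has
nonzero winding number, the number of roots that it encloses (`linkingNumber_ne_one_of_braidGroup`).

For n ≥ 1 the Alexander module is studied through derivations. Its localization embeds in a
localized coinduced module carrying a derivation of G that extends x ↦ [x]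
(`exists_embedding_isDerivation`), so upper bounds follow from a description of all derivations c of
G into Rₙ-modules. Inner derivations vanish on G_r^{(n+1)}, which acts trivially.

If A ∉ G_r^{(n+1)}, then a - 1 is invertible, and c can be normalized to vanish on A. It then
vanishes on σ₁ and σ₃, because these commute with A, and the braid relations together with an Ore
relation force c(σ₂) = 0. So c is inner and δₙ = 0 (`degree_eq_zero_of_notMem`).

If A ∈ G_r^{(n+1)}, then w - 1 is still invertible, and c can be normalized to vanish on W. The
class of A is killed by w² - 3w + 1, hence is zero, so c takes one value d on all generators. The
braid relation becomes (p - w)t d = (w - 1)d, so all values of c lie on the 𝕂ₙ-line through d, and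
δₙ ≤ 1 (`degree_le_one`). Conversely, the cyclic module with this single relation carries such a
derivation. If the localized Alexander module were zero, d would die after localization, and a
binomial of nonzero degree in t would divide an element of Sₙ, which degrees forbid
(`exists_locMk_ne_zero`).

The class α of A satisfies tα = α and tsα = sα - α. In Γ₀ one has t = s, so α = 0 and A ∈ G_r^{(2)}.
In Γ₁ the images of W and P commute, which gives 2α = 0 and A ∈ G_r^{(3)} (`genA_mem_three`). Hence
δ₁ = δ₂ = 1.

For n = 0 the group Γ̄₀ is trivial, and the Alexander module modulo torsion is ℤ², with basis the
classes of W and P (`degree_zero_eq_two`). -/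

theorem oreDiv_one_eq_zero_iff {x : X} :
    x /ₒ (1 : S) = 0 ↔ ∃ s ∈ S, s • x = 0 := by
  rw [OreLocalization.zero_def, oreDiv_eq_iff]
  constructor
  · rintro ⟨u, v, h1, h2⟩
    refine ⟨u, u.2, ?_⟩
    have h3 : (u : R) = v := by simpa using h2
    rw [h3, ← h1, smul_zero]
  · rintro ⟨s, hs, h⟩
    exact ⟨⟨s, hs⟩, s, by simp [h], by simp⟩

theorem oreDiv_eq_smul (x : X) (s : S) :
    x /ₒ s = ((1 : R) /ₒ s) • (x /ₒ (1 : S)) := by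
  rw [OreLocalization.smul_div_one, one_smul]

/-- The linear map between Ore localizations induced by a linear map. -/
def mapModule (f : X →ₗ[R] Y) :
    OreLocalization S X →ₗ[OreLocalization S R] OreLocalization S Y where
  toFun := liftExpand (fun x s => f x /ₒ s) fun x t s hst => by
    rw [map_smul]; exact OreLocalization.expand _ _ _ hst
  map_add' x y := by
    induction x with | _ x s => ?_
    induction y with | _ y t => ?_
    obtain ⟨r, v, h, e⟩ := oreDivAddChar' x y s t
    rw [e, liftExpand_of, liftExpand_of, liftExpand_of, oreDiv_add_char _ _ r v h, map_add,
      Submonoid.smul_def, Submonoid.smul_def, map_smul, map_smul]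
  map_smul' k x := by
    induction k with | _ k s => ?_
    induction x with | _ x t => ?_
    obtain ⟨r, v, h, e⟩ := oreDivSMulChar' k x s t
    rw [e, liftExpand_of, liftExpand_of, RingHom.id_apply, oreDiv_smul_char _ _ _ _ r v h, map_smul]

@[simp]
theorem mapModule_oreDiv (f : X →ₗ[R] Y) (x : X) (s : S) : mapModule f (x /ₒ s) = f x /ₒ s :=
  rfl

/-- After the denominator of x/s is cleared, some t in S kills f x; then t kills x, since f is
injective and linear. -/
theorem mapModule_injective (f : X →ₗ[R] Y) (hf : Function.Injective f) :
    Function.Injective (mapModule (S := S) f) := by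
  rw [injective_iff_map_eq_zero]
  intro x hx
  induction x with | _ x s => ?_
  rw [mapModule_oreDiv, oreDiv_eq_smul] at hx
  have h1 : f x /ₒ (1 : S) = 0 := by
    have h2 := congrArg (fun y => ((s : R) /ₒ (1 : S)) • y) hx
    simp only [smul_zero] at h2
    rwa [← mul_smul, show ((s : R) /ₒ (1 : S)) * ((1 : R) /ₒ s) = 1 from
      OreLocalization.mul_inv s 1, one_smul] at h2
  obtain ⟨t, ht, h⟩ := oreDiv_one_eq_zero_iff.1 h1
  rw [← map_smul, map_eq_zero_iff f hf] at h
  rw [oreDiv_eq_smul, oreDiv_one_eq_zero_iff.2 ⟨t, ht, h⟩, smul_zero]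

end OreLocalization

namespace CurveComplement

/-! ### Identities in the braid group -/

section BraidIdentities

variable {G : Type*} [Group G] {s₁ s₂ s₃ : G}

theorem braid_conj (h₁₂ : s₁ * s₂ * s₁ = s₂ * s₁ * s₂) : s₂⁻¹ * s₁ * s₂ = s₁ * s₂ * s₁⁻¹ := by
  rw [eq_mul_inv_iff_mul_eq, mul_assoc, mul_assoc, inv_mul_eq_iff_eq_mul, ← mul_assoc, h₁₂,
    mul_assoc]

/-- Conjugation by σ₁ sends P to W⁻¹P. Together with W ↦ P this is the action of order six on the
rational abelianization of the commutator subgroup. -/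
theorem braid_conj_commutator (h₁₂ : s₁ * s₂ * s₁ = s₂ * s₁ * s₂) :
    s₁ * (s₂ * s₁⁻¹) * s₁⁻¹ = (s₁⁻¹ * s₂)⁻¹ * (s₂ * s₁⁻¹) := by
  have := braid_conj h₁₂
  rw [mul_inv_rev, inv_inv, ← mul_assoc, ← mul_assoc, this]

/-- With A = σ₃σ₁⁻¹ and b = σ₂Aσ₂⁻¹, conjugation by σ₁ sends b to A⁻¹b. Linearized, this is the
relation tsα = sα - α on the class α of A. -/
theorem braid_conj_conj (h₁₂ : s₁ * s₂ * s₁ = s₂ * s₁ * s₂)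
    (h₂₃ : s₂ * s₃ * s₂ = s₃ * s₂ * s₃) :
    s₁ * (s₂ * (s₃ * s₁⁻¹) * s₂⁻¹) * s₁⁻¹ = (s₃ * s₁⁻¹)⁻¹ * (s₂ * (s₃ * s₁⁻¹) * s₂⁻¹) := by
  have h1 : s₁⁻¹ * s₂⁻¹ * s₁⁻¹ = s₂⁻¹ * s₁⁻¹ * s₂⁻¹ := by
    have := congrArg (fun x => x⁻¹) h₁₂
    simpa [mul_assoc] using this
  have h2 : s₂ * s₃ * s₂⁻¹ = s₃⁻¹ * s₂ * s₃ := (braid_conj h₂₃).symm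
  calc s₁ * (s₂ * (s₃ * s₁⁻¹) * s₂⁻¹) * s₁⁻¹ = s₁ * s₂ * s₃ * (s₁⁻¹ * s₂⁻¹ * s₁⁻¹) := by group
    _ = s₁ * (s₂ * s₃ * s₂⁻¹) * s₁⁻¹ * s₂⁻¹ := by rw [h1]; group
    _ = _ := by rw [h2]; group

end BraidIdentities

/-! ### Derivations -/

section Derivations

variable {G : Type*} [Group G] {B : Type*} [Ring B] {U : Type*} [AddCommGroup U] [Module B U]

/-- Derivations (crossed homomorphisms) from a group to a module on which it acts through `lam`. -/
def IsDerivation (lam : G →* B) (c : G → U) : Prop :=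
  ∀ g h, c (g * h) = c g + lam g • c h

namespace IsDerivation

variable {lam : G →* B} {c c' : G → U}

theorem map_one (hc : IsDerivation lam c) : c 1 = 0 := by
  simpa using hc 1 1

theorem map_inv (hc : IsDerivation lam c) (g : G) : c g⁻¹ = -(lam g⁻¹ • c g) := by
  have := hc g⁻¹ g
  rw [inv_mul_cancel, hc.map_one] at this
  exact eq_neg_of_add_eq_zero_left this.symm

theorem map_mul_inv (hc : IsDerivation lam c) (g h : G) :
    c (g * h⁻¹) = c g - lam (g * h⁻¹) • c h := by
  rw [hc, hc.map_inv, smul_neg, ← mul_smul, ← _root_.map_mul, sub_eq_add_neg]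

theorem map_inv_mul (hc : IsDerivation lam c) (g h : G) :
    c (g⁻¹ * h) = lam g⁻¹ • (c h - c g) := by
  rw [hc, hc.map_inv, smul_sub]; abel

theorem map_conj (hc : IsDerivation lam c) (g : G) {h : G} (hh : lam h = 1) :
    c (g * h * g⁻¹) = lam g • c h := by
  rw [hc.map_mul_inv, hc, _root_.map_mul, _root_.map_mul, hh, mul_one, ← _root_.map_mul,
    mul_inv_cancel, _root_.map_one, one_smul, add_sub_cancel_left]

theorem sub_inner (hc : IsDerivation lam c) (v : U) :
    IsDerivation lam fun g => c g - (lam g • v - v) := by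
  intro g h
  simp only [hc g h, _root_.map_mul, mul_smul, smul_sub]
  abel

/-- If `s₁` and `s₂` satisfy the braid relation, the values of a derivation at them satisfy the
linearized relation. -/
theorem braid (hc : IsDerivation lam c) {s₁ s₂ : G} (h₁₂ : s₁ * s₂ * s₁ = s₂ * s₁ * s₂) :
    c s₁ + lam s₁ • c s₂ + lam s₁ • lam s₂ • c s₁ =
      c s₂ + lam s₂ • c s₁ + lam s₂ • lam s₁ • c s₂ := by
  have h := congrArg c h₁₂
  rwa [hc, hc, hc, hc, _root_.map_mul, _root_.map_mul, mul_smul, mul_smul] at h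

end IsDerivation

/-- Derivations of the braid group are given by solutions of the linearized relations. -/
theorem exists_isDerivation_braidGroup (lam : BraidGroup4 →* B) (d : Fin 3 → U)
    (h₀₂ : d 0 + lam (sigma 0) • d 2 = d 2 + lam (sigma 2) • d 0)
    (h₀₁ : d 0 + lam (sigma 0) • d 1 + lam (sigma 0) • lam (sigma 1) • d 0 =
      d 1 + lam (sigma 1) • d 0 + lam (sigma 1) • lam (sigma 0) • d 1)
    (h₁₂ : d 1 + lam (sigma 1) • d 2 + lam (sigma 1) • lam (sigma 2) • d 1 =
      d 2 + lam (sigma 2) • d 1 + lam (sigma 2) • lam (sigma 1) • d 2) :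
    ∃ c : BraidGroup4 → U, IsDerivation lam c ∧ ∀ i, c (sigma i) = d i := by
  -- A derivation is the translation part of an action by affine maps v ↦ λ(g)v + c(g). The
  -- linearized relations say exactly that the three affine maps below satisfy the braid relations.
  let f : Fin 3 → Equiv.Perm U := fun i =>
    { toFun := fun v => lam (sigma i) • v + d i
      invFun := fun v => lam (sigma i)⁻¹ • (v - d i)
      left_inv := fun v => by
        simp only [add_sub_cancel_right]
        rw [← mul_smul, ← map_mul, inv_mul_cancel, map_one, one_smul]
      right_inv := fun v => by
        simp only
        rw [← mul_smul, ← map_mul, mul_inv_cancel, map_one, one_smul, sub_add_cancel] }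
  have hl : ∀ {g h : BraidGroup4}, g = h → ∀ v : U, lam g • v = lam h • v := by
    rintro g _ rfl v; rfl
  have hσ : ∀ r ∈ braidRels, (PresentedGroup.mk braidRels r) = 1 := fun r hr =>
    PresentedGroup.one_of_mem hr
  have e₀₂ : sigma 0 * sigma 2 = sigma 2 * sigma 0 := mul_inv_eq_one.1 <| by
    simpa using! hσ _ (Or.inl rfl)
  have e₀₁ : sigma 0 * sigma 1 * sigma 0 = sigma 1 * sigma 0 * sigma 1 := mul_inv_eq_one.1 <| by
    simpa using! hσ _ (Or.inr (Or.inl rfl))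
  have e₁₂ : sigma 1 * sigma 2 * sigma 1 = sigma 2 * sigma 1 * sigma 2 := mul_inv_eq_one.1 <| by
    simpa using! hσ _ (Or.inr (Or.inr rfl))
  have hf : ∀ r ∈ braidRels, FreeGroup.lift f r = 1 := by
    rintro r (rfl | rfl | rfl)
    · simp only [map_mul, map_inv, FreeGroup.lift_apply_of, mul_inv_eq_one]
      ext v
      simp only [f, Equiv.Perm.mul_apply, Equiv.coe_fn_mk, smul_add, ← mul_smul, ← map_mul]
      rw [e₀₂, add_assoc, add_assoc, add_comm (_ • d 2), h₀₂, add_comm (d 2)]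
    · simp only [map_mul, map_inv, FreeGroup.lift_apply_of, mul_inv_eq_one]
      ext v
      have := hl e₀₁ v
      simp only [map_mul, mul_smul] at this
      simp only [f, Equiv.Perm.mul_apply, Equiv.coe_fn_mk, smul_add]
      rw [this]
      rw [← sub_eq_zero] at h₀₁ ⊢
      rw [← h₀₁]; abel
    · simp only [map_mul, map_inv, FreeGroup.lift_apply_of, mul_inv_eq_one]
      ext v
      have := hl e₁₂ v
      simp only [map_mul, mul_smul] at this
      simp only [f, Equiv.Perm.mul_apply, Equiv.coe_fn_mk, smul_add]
      rw [this]
      rw [← sub_eq_zero] at h₁₂ ⊢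
      rw [← h₁₂]; abel
  let F : BraidGroup4 →* Equiv.Perm U := PresentedGroup.toGroup hf
  have hF : ∀ i v, F (sigma i) v = lam (sigma i) • v + d i := fun i v => by
    simp only [F, sigma, PresentedGroup.toGroup.of]; rfl
  -- Every F g is affine with linear part λ(g), so g ↦ F g 0 is the required derivation.
  have key : ∀ g, ∀ v, F g v = lam g • v + F g 0 := by
    intro g
    have hg : g ∈ Subgroup.closure (Set.range (PresentedGroup.of (rels := braidRels))) := by
      rw [PresentedGroup.closure_range_of]; trivial
    induction hg using Subgroup.closure_induction with
    | mem x hx =>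
      obtain ⟨i, rfl⟩ := hx
      intro v
      have h0 : F (sigma i) 0 = d i := by rw [hF, smul_zero, zero_add]
      exact (hF i v).trans (congrArg (_ + ·) h0.symm)
    | one => intro v; simp
    | mul x y _ _ hx hy =>
      intro v
      rw [map_mul, Equiv.Perm.mul_apply, Equiv.Perm.mul_apply, hy, hx, hx (F y 0), map_mul,
        mul_smul, smul_add, add_assoc]
    | inv x _ hx =>
      intro v
      rw [map_inv, Equiv.Perm.inv_eq_iff_eq, hx, smul_add, ← mul_smul, ← map_mul, mul_inv_cancel,
        map_one, one_smul, add_assoc, ← hx, ← Equiv.Perm.mul_apply,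
        mul_inv_cancel, Equiv.Perm.one_apply, add_zero]
  refine ⟨fun g => F g 0, fun g h => ?_, fun i => (hF i 0).trans (by simp)⟩
  simp only [map_mul, Equiv.Perm.mul_apply]
  rw [key g (F h 0), add_comm]

end Derivations

/-! ### Groups isomorphic to the braid group -/

section Generators

variable {G : Type u} [Group G] (e : G ≃* BraidGroup4)

/-- The standard generators, transported along an isomorphism with the braid group. -/
def gen (i : Fin 3) : G := e.symm (sigma i)

@[simp]
theorem apply_gen (i : Fin 3) : e (gen e i) = sigma i := e.apply_symm_apply _

theorem gen_comm : gen e 0 * gen e 2 = gen e 2 * gen e 0 := e.injective <| by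
  simp only [map_mul, apply_gen]
  exact mul_inv_eq_one.1 (by
    simpa using! PresentedGroup.one_of_mem (rels := braidRels) (Or.inl rfl))

theorem gen_braid₀₁ : gen e 0 * gen e 1 * gen e 0 = gen e 1 * gen e 0 * gen e 1 :=
  e.injective <| by
    simp only [map_mul, apply_gen]
    exact mul_inv_eq_one.1
      (by simpa using! PresentedGroup.one_of_mem (rels := braidRels) (Or.inr (Or.inl rfl)))

theorem gen_braid₁₂ : gen e 1 * gen e 2 * gen e 1 = gen e 2 * gen e 1 * gen e 2 :=
  e.injective <| by
    simp only [map_mul, apply_gen]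
    exact mul_inv_eq_one.1
      (by simpa using! PresentedGroup.one_of_mem (rels := braidRels) (Or.inr (Or.inr rfl)))

theorem mem_of_gen_mem {P : Subgroup G} (h : ∀ i, gen e i ∈ P) (g : G) : g ∈ P := by
  have h1 : (P.comap e.symm.toMonoidHom) = ⊤ := by
    rw [eq_top_iff, ← PresentedGroup.closure_range_of, Subgroup.closure_le]
    rintro _ ⟨i, rfl⟩
    exact h i
  have h2 : e g ∈ P.comap e.symm.toMonoidHom := h1 ▸ Subgroup.mem_top _
  simpa using h2

theorem exists_isDerivation {B : Type*} [Ring B] {U : Type*} [AddCommGroup U] [Module B U]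
    (lam : G →* B) (d : Fin 3 → U)
    (h₀₂ : d 0 + lam (gen e 0) • d 2 = d 2 + lam (gen e 2) • d 0)
    (h₀₁ : d 0 + lam (gen e 0) • d 1 + lam (gen e 0) • lam (gen e 1) • d 0 =
      d 1 + lam (gen e 1) • d 0 + lam (gen e 1) • lam (gen e 0) • d 1)
    (h₁₂ : d 1 + lam (gen e 1) • d 2 + lam (gen e 1) • lam (gen e 2) • d 1 =
      d 2 + lam (gen e 2) • d 1 + lam (gen e 2) • lam (gen e 1) • d 2) :
    ∃ c : G → U, IsDerivation lam c ∧ ∀ i, c (gen e i) = d i := by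
  obtain ⟨c, hc, hd⟩ := exists_isDerivation_braidGroup (lam.comp e.symm.toMonoidHom) d h₀₂ h₀₁ h₁₂
  refine ⟨c ∘ e, fun g h => ?_, fun i => ?_⟩
  · have := hc (e g) (e h)
    rw [← map_mul] at this
    simpa using this
  · simpa using hd i

/-- The homomorphism to `ℤ` that sends the standard generators to `1`. -/
noncomputable def exponentSum : G →* Multiplicative ℤ :=
  (PresentedGroup.toGroup (f := fun _ => Multiplicative.ofAdd (1 : ℤ)) (by
    rintro r (rfl | rfl | rfl) <;> simp)).comp e.toMonoidHom

@[simp]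
theorem exponentSum_gen (i : Fin 3) : exponentSum e (gen e i) = Multiplicative.ofAdd 1 := by
  simp [exponentSum, sigma]

/-- In the abelianization the relation xyx = yxy forces x = y, so all three generators have the
class of σ₁. -/
theorem exists_zpow_mul_mem_commutator (g : G) :
    ∃ k : ℤ, (gen e 0 ^ k)⁻¹ * g ∈ commutator G := by
  have h₁ : Abelianization.of (gen e 1) = Abelianization.of (gen e 0) := by
    have := congrArg Abelianization.of (gen_braid₀₁ e)
    simp only [map_mul] at this
    rw [mul_comm (Abelianization.of (gen e 1)) (Abelianization.of (gen e 0))] at this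
    rw [mul_left_cancel this]
  have h₂ : Abelianization.of (gen e 2) = Abelianization.of (gen e 0) := by
    have := congrArg Abelianization.of (gen_braid₁₂ e)
    simp only [map_mul] at this
    rw [mul_comm (Abelianization.of (gen e 2)) (Abelianization.of (gen e 1))] at this
    rw [← mul_left_cancel this, h₁]
  have h := mem_of_gen_mem e
    (P := (Subgroup.zpowers (Abelianization.of (gen e 0))).comap Abelianization.of) (by
      intro i
      rw [Subgroup.mem_comap]
      fin_cases i
      · exact Subgroup.mem_zpowers _
      · exact h₁ ▸ Subgroup.mem_zpowers _
      · exact h₂ ▸ Subgroup.mem_zpowers _) g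
  obtain ⟨k, hk⟩ := h
  refine ⟨k, ?_⟩
  rw [← Abelianization.ker_of, MonoidHom.mem_ker, map_mul, map_inv, map_zpow]
  exact inv_mul_eq_one.2 hk

theorem commutator_le_rationalDerivedSeries : commutator G ≤ rationalDerivedSeries G 1 :=
  fun x hx => ⟨Subgroup.mem_top x, 1, one_ne_zero, by
    rw [zpow_one]; exact hx⟩

theorem apply_gen_ne_one (e : G ≃* BraidGroup4) {ψ : G →* Multiplicative ℤ} (hψ : ψ ≠ 1) :
    ψ (gen e 0) ≠ 1 := by
  intro h
  refine hψ (MonoidHom.ext fun g => ?_)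
  obtain ⟨k, hk⟩ := exists_zpow_mul_mem_commutator e g
  have h2 : ψ ((gen e 0 ^ k)⁻¹ * g) = 1 := Abelianization.commutator_subset_ker ψ hk
  rwa [map_mul, map_inv, map_zpow, h, one_zpow, inv_one, one_mul] at h2

/-- Modulo commutators every element is a power σ₁^k, and ψ(σ₁) has infinite order, so the kernel
forces k = 0. The kernel is thus independent of ψ, and membership in G_r^{(1)} can be tested with
the exponent sum. -/
theorem ker_eq_rationalDerivedSeries (e : G ≃* BraidGroup4) {ψ : G →* Multiplicative ℤ}
    (hψ : ψ ≠ 1) : ψ.ker = rationalDerivedSeries G 1 := by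
  refine le_antisymm (fun g hg => ?_) (rationalDerivedSeries_le_ker ψ 0)
  obtain ⟨k, hk⟩ := exists_zpow_mul_mem_commutator e g
  have h2 : ψ ((gen e 0 ^ k)⁻¹ * g) = 1 := Abelianization.commutator_subset_ker ψ hk
  rw [map_mul, map_inv, map_zpow, hg, mul_one, inv_eq_one] at h2
  have h3 : k * (ψ (gen e 0)).toAdd = 0 := by simpa using congrArg Multiplicative.toAdd h2
  obtain rfl : k = 0 := (mul_eq_zero.1 h3).resolve_right fun h => apply_gen_ne_one e hψ h
  exact commutator_le_rationalDerivedSeries (by simpa using hk)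

theorem exponentSum_ne_one : exponentSum e ≠ 1 := fun h => by
  have h1 := DFunLike.congr_fun h (gen e 0)
  rw [exponentSum_gen] at h1
  exact absurd (congrArg Multiplicative.toAdd h1) (by simp)

/-- The element `σ₃σ₁⁻¹`. -/
def genA : G := gen e 2 * (gen e 0)⁻¹

/-- The element `σ₂σ₁⁻¹`. -/
def genP : G := gen e 1 * (gen e 0)⁻¹

/-- The element `σ₁⁻¹σ₂`. -/
def genW : G := (gen e 0)⁻¹ * gen e 1

theorem genA_mem : genA e ∈ rationalDerivedSeries G 1 := by
  rw [← ker_eq_rationalDerivedSeries e (exponentSum_ne_one e), MonoidHom.mem_ker]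
  simp [genA]

theorem genP_mem : genP e ∈ rationalDerivedSeries G 1 := by
  rw [← ker_eq_rationalDerivedSeries e (exponentSum_ne_one e), MonoidHom.mem_ker]
  simp [genP]

theorem genW_mem : genW e ∈ rationalDerivedSeries G 1 := by
  rw [← ker_eq_rationalDerivedSeries e (exponentSum_ne_one e), MonoidHom.mem_ker]
  simp [genW]

theorem genA_mul_gen : genA e * gen e 0 = gen e 2 := by simp [genA]

theorem gen_mul_genA : gen e 0 * genA e = gen e 2 := by
  rw [genA, ← mul_assoc, gen_comm, mul_inv_cancel_right]

theorem genP_mul_gen : genP e * gen e 0 = gen e 1 := by simp [genP]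

theorem gen_mul_genW : gen e 0 * genW e = gen e 1 := by simp [genW]

theorem conj_genW : gen e 0 * genW e * (gen e 0)⁻¹ = genP e := by rw [gen_mul_genW]; rfl

theorem conj_genP : gen e 0 * genP e * (gen e 0)⁻¹ = (genW e)⁻¹ * genP e :=
  braid_conj_commutator (gen_braid₀₁ e)

theorem conj_genA : gen e 0 * genA e * (gen e 0)⁻¹ = genA e := by rw [gen_mul_genA]; rfl

theorem conj_conj_genA : gen e 0 * (gen e 1 * genA e * (gen e 1)⁻¹) * (gen e 0)⁻¹ =
    (genA e)⁻¹ * (gen e 1 * genA e * (gen e 1)⁻¹) :=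
  braid_conj_conj (gen_braid₀₁ e) (gen_braid₁₂ e)

/-- The automorphism of order six of `ℤ²` through which the generators act on the rational
abelianization of the commutator subgroup. -/
def hexRotation : (AddMonoid.End (ℤ × ℤ))ˣ where
  val :=
    { toFun := fun v => (-v.2, v.1 + v.2)
      map_zero' := rfl
      map_add' := fun v w => by ext <;> simp <;> ring }
  inv :=
    { toFun := fun v => (v.1 + v.2, -v.1)
      map_zero' := rfl
      map_add' := fun v w => by ext <;> simp <;> ring }
  val_inv := AddMonoidHom.ext fun v => by
    change ((- -v.1, v.1 + v.2 + -v.1) : ℤ × ℤ) = v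
    simp
  inv_val := AddMonoidHom.ext fun v => by
    change ((-v.2 + (v.1 + v.2), - -v.2) : ℤ × ℤ) = v
    simp

/-- The rational abelianization of the commutator subgroup of the braid group is `ℤ²`. -/
theorem exists_abelianization_commutator : ∃ c : G → ℤ × ℤ,
    (∀ g ∈ rationalDerivedSeries G 1, ∀ h, c (g * h) = c g + c h) ∧
    (∀ g ∈ rationalDerivedSeries G 2, c g = 0) ∧ c (genW e) = (1, 0) ∧ c (genP e) = (0, 1) := by
  let lam : G →* AddMonoid.End (ℤ × ℤ) :=
    (Units.coeHom _).comp ((zpowersHom _ hexRotation).comp (exponentSum e))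
  have hlam : ∀ i v, lam (gen e i) • v = ((-v.2, v.1 + v.2) : ℤ × ℤ) := fun i v => by
    simp [lam]; rfl
  have hlam1 : ∀ g ∈ rationalDerivedSeries G 1, lam g = 1 := fun g hg => by
    have : exponentSum e g = 1 := rationalDerivedSeries_le_ker (exponentSum e) 0 hg
    simp [lam, this]
  -- With value 0 at σ₁ and σ₃, the braid relations at v = c(σ₂) read tv = v + t²v, which holds
  -- because the rotation t of order six satisfies t² - t + 1 = 0.
  obtain ⟨c, hc, hd⟩ := exists_isDerivation e (U := ℤ × ℤ) lam ![0, (0, 1), 0]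
    (by simp [hlam]) (by simp [hlam]) (by simp [hlam])
  have hmul : ∀ g ∈ rationalDerivedSeries G 1, ∀ h, c (g * h) = c g + c h := fun g hg h => by
    rw [hc, hlam1 g hg, one_smul]
  have hW : c (genW e) = (1, 0) := by
    have h := hc (gen e 0) (genW e)
    rw [gen_mul_genW, hd, hd, hlam] at h
    simp only [Fin.isValue, Matrix.cons_val_one, Matrix.cons_val_zero, zero_add, Prod.mk.injEq] at h
    exact Prod.ext (by simp; omega) (by simp; omega)
  refine ⟨c, hmul, ?_, hW, ?_⟩
  -- The target is abelian and torsion-free, so this homomorphism kills every element with a nonzero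
  -- power in the commutator subgroup.
  · let F : rationalDerivedSeries G 1 →* Multiplicative (ℤ × ℤ) :=
      { toFun := fun g => Multiplicative.ofAdd (c g)
        map_one' := congrArg Multiplicative.ofAdd hc.map_one
        map_mul' := fun g h => congrArg Multiplicative.ofAdd (hmul g g.2 h) }
    rintro g ⟨hg, k, hk, hgk⟩
    have h1 : F (⟨g, hg⟩ ^ k) = 1 := by
      refine Abelianization.commutator_subset_ker F ?_
      rw [← Abelianization.ker_of]
      exact (abelianization_of_eq_one_iff _ _).2 hgk
    rw [map_zpow] at h1
    exact (smul_eq_zero.1 (show k • c g = 0 from congrArg Multiplicative.toAdd h1)).resolve_left hk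
  · rw [← conj_genW, hc.map_conj _ (hlam1 _ (genW_mem e)), hlam, hW]
    rfl

/-- The elements W, P and W⁻¹P have nonzero images in ℤ². For n ≥ 1 this makes w - 1, p - 1 and p -
w nonzero in the group ring of Γ̄ₙ, hence invertible after localization. -/
theorem genW_notMem : genW e ∉ rationalDerivedSeries G 2 := by
  obtain ⟨c, -, h, hw, -⟩ := exists_abelianization_commutator e
  exact fun hm => by simpa using congrArg Prod.fst ((h _ hm).symm.trans hw)

theorem genP_notMem : genP e ∉ rationalDerivedSeries G 2 := by
  obtain ⟨c, -, h, -, hp⟩ := exists_abelianization_commutator e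
  exact fun hm => by simpa using congrArg Prod.snd ((h _ hm).symm.trans hp)

theorem genW_inv_mul_genP_notMem : (genW e)⁻¹ * genP e ∉ rationalDerivedSeries G 2 := by
  obtain ⟨c, hc, h, hw, hp⟩ := exists_abelianization_commutator e
  intro hm
  have := hc _ (genW_mem e) ((genW e)⁻¹ * genP e)
  rw [h _ hm, mul_inv_cancel_left, hp, hw] at this
  simp at this

end Generators

/-! ### The left action of `G` on right modules over `ℤΓₙ` -/

section LeftAction

variable (G : Type u) [Group G] (n : ℕ)

/-- The homomorphism from `G` to the opposite of `ℤΓₙ` that corresponds to the left action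
`g • x = x g⁻¹` on right modules. -/
noncomputable def gamLeft : G →* GamRingOp G n where
  toFun g := MulOpposite.op (MonoidAlgebra.single (QuotientGroup.mk g⁻¹) 1)
  map_one' := by simp [MonoidAlgebra.one_def]
  map_mul' g h := by
    rw [← MulOpposite.op_mul, MonoidAlgebra.single_mul_single, mul_inv_rev, mul_one]
    rfl

variable {G n}

theorem gamLeft_apply (g : G) :
    gamLeft G n g = MulOpposite.op (MonoidAlgebra.single (QuotientGroup.mk g⁻¹) 1) := rfl

theorem gamLeft_eq_iff {g h : G} :
    gamLeft G n g = gamLeft G n h ↔ g⁻¹ * h ∈ rationalDerivedSeries G (n + 1) := by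
  rw [← QuotientGroup.eq, gamLeft_apply, gamLeft_apply, MulOpposite.op_inj,
    MonoidAlgebra.single_left_inj one_ne_zero, QuotientGroup.mk_inv, QuotientGroup.mk_inv, inv_inj]

theorem gamLeft_eq_one_iff {g : G} :
    gamLeft G n g = 1 ↔ g ∈ rationalDerivedSeries G (n + 1) := by
  rw [← map_one (gamLeft G n), eq_comm, gamLeft_eq_iff, inv_one, one_mul]

theorem gamLeft_smul_mk (g : G) (x : rationalDerivedSeries G (n + 1)) :
    gamLeft G n g • AlexanderModule.mk G n x = AlexanderModule.mk G n (MulAut.conjNormal g x) := by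
  rw [gamLeft_apply, op_single_smul_mk, inv_inv]

theorem AlexanderModule.mk_mul (x y : rationalDerivedSeries G (n + 1)) :
    AlexanderModule.mk G n (x * y) = AlexanderModule.mk G n x + AlexanderModule.mk G n y :=
  congrArg Additive.ofMul (map_mul Abelianization.of x y)

theorem AlexanderModule.mk_inv (x : rationalDerivedSeries G (n + 1)) :
    AlexanderModule.mk G n x⁻¹ = -AlexanderModule.mk G n x :=
  congrArg Additive.ofMul (map_inv Abelianization.of x)

theorem mem_of_zsmul_mk_eq_zero (x : rationalDerivedSeries G (n + 1)) {k : ℤ} (hk : k ≠ 0)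
    (h : k • AlexanderModule.mk G n x = 0) : (x : G) ∈ rationalDerivedSeries G (n + 2) := by
  refine ⟨x.2, k, hk, ?_⟩
  exact (abelianization_of_eq_one_iff _ (x ^ k)).1
    ((map_zpow Abelianization.of x k).trans (congrArg Additive.toMul h))

end LeftAction

/-! ### The class of σ₃σ₁⁻¹ in the Alexander modules -/

section GenA

variable {G : Type u} [Group G] (e : G ≃* BraidGroup4)

/-- Consequences of the relations of the class of `σ₃σ₁⁻¹` in a module over the braid group. -/
theorem genA_module_relations {B : Type*} [Ring B] {U : Type*} [AddCommGroup U] [Module B U]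
    (lam : G →* B) {α : U} (h₁ : lam (gen e 0) • α = α)
    (h₂ : lam (gen e 0) • lam (gen e 1) • α = lam (gen e 1) • α - α) :
    lam (genW e) • lam (genW e) • α = (3 : ℤ) • lam (genW e) • α - α ∧
    (lam (genW e) • lam (genP e) • α = lam (genP e) • lam (genW e) • α →
      (2 : ℤ) • α = 0) := by
  have hinv : ∀ g (v : U), lam g⁻¹ • lam g • v = v := fun g v => by
    rw [← mul_smul, ← map_mul, inv_mul_cancel, map_one, one_smul]
  have hinv' : ∀ g (v : U), lam g • lam g⁻¹ • v = v := fun g v => by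
    rw [← mul_smul, ← map_mul, mul_inv_cancel, map_one, one_smul]
  have h₁' : lam (gen e 0)⁻¹ • α = α := by
    conv_lhs => rw [← h₁]
    exact hinv _ _
  have h₂' : lam (gen e 0)⁻¹ • lam (gen e 1) • α = lam (gen e 1) • α + α := by
    have := congrArg (lam (gen e 0)⁻¹ • ·) h₂
    simp only [hinv, smul_sub, h₁'] at this
    exact (eq_add_of_sub_eq this.symm)
  -- The identity σ₂⁻¹σ₁σ₂ = σ₁σ₂σ₁⁻¹ applied to α, multiplied by σ₂, gives s²α = 2sα - α.
  have h₃ : lam (gen e 1) • lam (gen e 1) • α = (2 : ℤ) • lam (gen e 1) • α - α := by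
    have h := congrArg (fun g => lam g • α) (braid_conj (gen_braid₀₁ e))
    simp only [map_mul, mul_smul, h₁', h₂, smul_sub, hinv] at h
    have h' := congrArg (lam (gen e 1) • ·) h
    simp only [smul_sub, hinv'] at h'
    rw [two_zsmul, add_sub_assoc, h']
    abel
  have hW : ∀ v : U, lam (genW e) • v = lam (gen e 0)⁻¹ • lam (gen e 1) • v := fun v => by
    rw [genW, map_mul, mul_smul]
  have hP : ∀ v : U, lam (genP e) • v = lam (gen e 1) • lam (gen e 0)⁻¹ • v := fun v => by
    rw [genP, map_mul, mul_smul]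
  constructor
  · simp only [hW, h₂', smul_add, h₃, smul_sub, smul_comm _ (2 : ℤ), h₁']
    abel
  · intro h
    simp only [hW, hP, h₂', h₁', smul_add, h₃, smul_sub, smul_comm _ (2 : ℤ)] at h
    -- Expanded in α and sα, the commutation of w and p on α is 2sα = 2α. Applying t⁻¹, which sends
    -- sα to sα + α, gives 2sα + 2α = 2α, so both sides vanish.
    have h4 : (2 : ℤ) • lam (gen e 1) • α = (2 : ℤ) • α := by
      rw [← sub_eq_zero] at h ⊢
      rw [← neg_eq_zero, ← h]
      abel
    have h5 := congrArg (lam (gen e 0)⁻¹ • ·) h4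
    simp only [smul_comm _ (2 : ℤ), h₂', h₁', smul_add] at h5
    rw [← h4, ← add_eq_right, h5]

variable {n : ℕ}

theorem gen_smul_genA (h : genA e ∈ rationalDerivedSeries G (n + 1)) :
    gamLeft G n (gen e 0) • AlexanderModule.mk G n ⟨genA e, h⟩ =
      AlexanderModule.mk G n ⟨genA e, h⟩ := by
  rw [gamLeft_smul_mk]
  exact congrArg _ (Subtype.ext (conj_genA e))

theorem gen_smul_gen_smul_genA (h : genA e ∈ rationalDerivedSeries G (n + 1)) :
    gamLeft G n (gen e 0) • gamLeft G n (gen e 1) • AlexanderModule.mk G n ⟨genA e, h⟩ =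
      gamLeft G n (gen e 1) • AlexanderModule.mk G n ⟨genA e, h⟩ -
        AlexanderModule.mk G n ⟨genA e, h⟩ := by
  rw [gamLeft_smul_mk, gamLeft_smul_mk, sub_eq_neg_add, ← AlexanderModule.mk_inv,
    ← AlexanderModule.mk_mul]
  exact congrArg _ (Subtype.ext (conj_conj_genA e))

/-- Since σ₁ and σ₂ agree in Γ₀ and σ₁ fixes the class α, the relation tsα = sα - α collapses to α =
α - α. -/
theorem mk_genA_zero : AlexanderModule.mk G 0 ⟨genA e, genA_mem e⟩ = 0 := by
  have h1 : gamLeft G 0 (gen e 1) = gamLeft G 0 (gen e 0) := (gamLeft_eq_iff.2 (genW_mem e)).symm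
  have h2 := gen_smul_gen_smul_genA e (genA_mem e)
  rw [h1, gen_smul_genA, gen_smul_genA, sub_self] at h2
  exact h2

theorem genA_mem_two : genA e ∈ rationalDerivedSeries G 2 :=
  mem_of_zsmul_mk_eq_zero ⟨genA e, genA_mem e⟩ one_ne_zero (by rw [mk_genA_zero, smul_zero])

/-- The elements W and P of G_r^{(1)} commute in Γ₁, so twice the class of A is zero; the rational
derived series ignores this torsion. -/
theorem genA_mem_three : genA e ∈ rationalDerivedSeries G 3 := by
  refine mem_of_zsmul_mk_eq_zero ⟨genA e, genA_mem_two e⟩ two_ne_zero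
    ((genA_module_relations e (gamLeft G 1) (gen_smul_genA e _) (gen_smul_gen_smul_genA e _)).2 ?_)
  rw [← mul_smul, ← mul_smul, ← map_mul, ← map_mul]
  congr 1
  rw [gamLeft_eq_iff]
  have := commutator_mem_rationalDerivedSeries 1
    ((rationalDerivedSeries G 1).inv_mem (genP_mem e))
    ((rationalDerivedSeries G 1).inv_mem (genW_mem e))
  simpa [mul_assoc] using this

end GenA

/-! ### Subrings of the group ring of `Γₙ` -/

section OpRange

variable {G : Type u} [Group G] {n : ℕ}

/-- The (opposite of the) group ring of a subgroup of `Γₙ`, as a subring of that of `Γₙ`. -/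
noncomputable def opRange (X : Subgroup (Gam G n)) : Subring (GamRingOp G n) :=
  (RingHom.op (MonoidAlgebra.mapDomainRingHom ℤ X.subtype)).range

variable {X : Subgroup (Gam G n)}

theorem opRange_mono {Y : Subgroup (Gam G n)} (h : X ≤ Y) : opRange X ≤ opRange Y := by
  rintro _ ⟨r, rfl⟩
  refine ⟨MulOpposite.op (MonoidAlgebra.mapDomainRingHom ℤ (Subgroup.inclusion h) r.unop), ?_⟩
  refine MulOpposite.unop_injective ?_
  change ((MonoidAlgebra.mapDomainRingHom ℤ Y.subtype).comp
    (MonoidAlgebra.mapDomainRingHom ℤ (Subgroup.inclusion h))) r.unop = _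
  rw [← MonoidAlgebra.mapDomainRingHom_comp]
  rfl

theorem mem_of_mem_support {x : GamRingOp G n} (hx : x ∈ opRange X) {k : Gam G n}
    (hk : x.unop.coeff k ≠ 0) : k ∈ X := by
  classical
  obtain ⟨r, rfl⟩ := hx
  by_contra h
  refine hk ?_
  change (MonoidAlgebra.mapDomain (X.subtype : X → Gam G n) r.unop).coeff k = 0
  rw [MonoidAlgebra.coeff_mapDomain]
  exact Finsupp.mapDomain_of_notMem_range _ _ (by rintro ⟨y, rfl⟩; exact h y.2)

theorem gamLeft_mem_opRange {g : G} (hg : (QuotientGroup.mk g : Gam G n) ∈ X) :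
    gamLeft G n g ∈ opRange X := by
  refine ⟨MulOpposite.op (MonoidAlgebra.single (⟨QuotientGroup.mk g, hg⟩⁻¹ : X) 1),
    MulOpposite.unop_injective ?_⟩
  change MonoidAlgebra.mapDomain _ (MonoidAlgebra.single _ _) = _
  rw [MonoidAlgebra.mapDomain_single]
  rfl

/-- The point of the Ore condition for a subgroup X is that the multipliers stay in ℤX, which
controls their supports. -/
theorem exists_mul_eq_mul_opRange {x y : GamRingOp G n} (hx : x ∈ opRange X) (hy : y ∈ opRange X)
    (hy0 : y ≠ 0) : ∃ m ∈ opRange X, ∃ m' ∈ opRange X, m ≠ 0 ∧ m * x = m' * y := by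
  obtain ⟨r, rfl⟩ := hx
  obtain ⟨s, rfl⟩ := hy
  have hs : s.unop ≠ 0 := fun h => hy0 (by rw [(MulOpposite.unop_eq_zero_iff _).1 h, map_zero])
  obtain ⟨r', s', hs', h⟩ := exists_mul_eq_mul r.unop s.unop hs
  refine ⟨_, ⟨MulOpposite.op s', rfl⟩, _, ⟨MulOpposite.op r', rfl⟩, ?_, ?_⟩
  · intro h0
    exact hs' (MonoidAlgebra.mapDomain_injective X.subtype_injective
      ((congrArg MulOpposite.unop h0).trans (MonoidAlgebra.mapDomain_zero _).symm))
  · rw [← map_mul, ← map_mul]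
    exact congrArg _ (MulOpposite.unop_injective h)

theorem conj_mem_opRange [X.Normal] (g : G) {x : GamRingOp G n} (hx : x ∈ opRange X) :
    gamLeft G n g * x * gamLeft G n g⁻¹ ∈ opRange X := by
  obtain ⟨r, rfl⟩ := hx
  induction r using MulOpposite.rec' with | _ r => ?_
  induction r using MonoidAlgebra.induction_on with
  | of k =>
    have h : RingHom.op (MonoidAlgebra.mapDomainRingHom ℤ X.subtype)
        (MulOpposite.op (MonoidAlgebra.of ℤ X k)) =
        MulOpposite.op (MonoidAlgebra.single (k : Gam G n) 1) :=
      MulOpposite.unop_injective (MonoidAlgebra.mapDomain_single ..)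
    obtain ⟨y, hy⟩ := QuotientGroup.mk_surjective (k : Gam G n)
    have h2 : MulOpposite.op (MonoidAlgebra.single (k : Gam G n) (1 : ℤ)) = gamLeft G n y⁻¹ := by
      rw [gamLeft_apply, inv_inv, hy]
    rw [h, h2, ← map_mul, ← map_mul]
    refine gamLeft_mem_opRange ?_
    have h3 : (QuotientGroup.mk (g * y⁻¹ * g⁻¹) : Gam G n) =
        QuotientGroup.mk g * (k : Gam G n)⁻¹ * (QuotientGroup.mk g)⁻¹ := by rw [← hy]; rfl
    rw [h3]
    exact Subgroup.Normal.conj_mem inferInstance _ (X.inv_mem k.2) _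
  | add x y hx hy =>
    rw [MulOpposite.op_add, map_add, mul_add, add_mul]
    exact add_mem hx hy
  | smul r x hx =>
    rw [MulOpposite.op_smul, map_zsmul, mul_smul_comm, smul_mul_assoc]
    exact zsmul_mem hx r

/-- The two summands are supported in different cosets of X, so they cannot cancel. -/
theorem add_mul_gamLeft_ne_zero {m m' : GamRingOp G n} (hm : m ∈ opRange X) (hm0 : m ≠ 0)
    (hm' : m' ∈ opRange X) {g : G} (hg : (QuotientGroup.mk g : Gam G n) ∉ X) :
    m' + m * gamLeft G n g ≠ 0 := by
  intro h
  have h1 : m * gamLeft G n g ∈ opRange X := by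
    rw [← neg_eq_of_add_eq_zero_right h]
    exact neg_mem hm'
  obtain ⟨k, hk⟩ : ∃ k, m.unop.coeff k ≠ 0 := by
    by_contra! h0
    exact hm0 ((MulOpposite.unop_eq_zero_iff _).1 (MonoidAlgebra.ext (Finsupp.ext h0)))
  have h2 : (m * gamLeft G n g).unop.coeff (QuotientGroup.mk g⁻¹ * k) ≠ 0 := by
    rw [gamLeft_apply, MulOpposite.unop_mul, MulOpposite.unop_op,
      MonoidAlgebra.coeff_single_mul_apply, inv_mul_cancel_left, one_mul]
    exact hk
  have h3 := X.mul_mem (mem_of_mem_support h1 h2) (X.inv_mem (mem_of_mem_support hm hk))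
  rw [mul_inv_cancel_right, QuotientGroup.mk_inv] at h3
  exact hg (inv_mem_iff.1 h3)

variable {ψ : G →* Multiplicative ℤ}

theorem mem_nonzeroBar {x : GamRingOp G n} (hx : x ∈ opRange (GamBar ψ n)) (hx0 : x ≠ 0) :
    x ∈ nonzeroBar ψ n := by
  obtain ⟨r, rfl⟩ := hx
  exact Submonoid.mem_map_of_mem _ (mem_nonZeroDivisors_of_ne_zero fun h => hx0 (by
    rw [h, map_zero]))

theorem mem_opRange_of_mem_nonzeroBar {x : GamRingOp G n} (hx : x ∈ nonzeroBar ψ n) :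
    x ∈ opRange (GamBar ψ n) := by
  obtain ⟨r, -, rfl⟩ := hx
  exact ⟨r, rfl⟩

theorem ne_zero_of_mem_nonzeroBar {x : GamRingOp G n} (hx : x ∈ nonzeroBar ψ n) : x ≠ 0 := by
  obtain ⟨r, hr, rfl⟩ := hx
  exact fun h => nonZeroDivisors.ne_zero hr (gamBarIncl_injective ψ n (h.trans (map_zero _).symm))

theorem mk_mem_gamBar_iff {g : G} : (QuotientGroup.mk g : Gam G n) ∈ GamBar ψ n ↔ ψ g = 1 :=
  Iff.rfl

theorem gamLeft_mem_opRange_gamBar {g : G} (hg : ψ g = 1) :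
    gamLeft G n g ∈ opRange (GamBar ψ n) :=
  gamLeft_mem_opRange (mk_mem_gamBar_iff.2 hg)

/-- The homomorphism from `ℤΓₙ` to Laurent polynomials over it that records the degree. -/
noncomputable def degreeHom (ψ : G →* Multiplicative ℤ) (n : ℕ) :
    MonoidAlgebra ℤ (Gam G n) →ₐ[ℤ] MonoidAlgebra (MonoidAlgebra ℤ (Gam G n)) (Multiplicative ℤ) :=
  MonoidAlgebra.lift ℤ _ _
    { toFun := fun g => MonoidAlgebra.single (psiBar ψ n g) (MonoidAlgebra.single g 1)
      map_one' := by simp [MonoidAlgebra.one_def]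
      map_mul' := fun g h => by simp [MonoidAlgebra.single_mul_single] }

theorem degreeHom_single (g : Gam G n) :
    degreeHom ψ n (MonoidAlgebra.single g 1) =
      MonoidAlgebra.single (psiBar ψ n g) (MonoidAlgebra.single g 1) := by
  simp [degreeHom]

theorem degreeHom_of_mem {x : GamRingOp G n} (hx : x ∈ opRange (GamBar ψ n)) :
    degreeHom ψ n x.unop = MonoidAlgebra.single 1 x.unop := by
  obtain ⟨r, rfl⟩ := hx
  change degreeHom ψ n (MonoidAlgebra.mapDomainRingHom ℤ (GamBar ψ n).subtype r.unop) =
    MonoidAlgebra.single 1 (MonoidAlgebra.mapDomainRingHom ℤ (GamBar ψ n).subtype r.unop)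
  induction r.unop using MonoidAlgebra.induction_on with
  | of k =>
    rw [MonoidAlgebra.of_apply, MonoidAlgebra.mapDomainRingHom_apply,
      MonoidAlgebra.mapDomain_single, degreeHom_single]
    congr 1
    exact k.2
  | add x y hx hy => simp only [map_add, hx, hy, MonoidAlgebra.single_add]
  | smul r x hx => simp only [map_zsmul, hx, MonoidAlgebra.smul_single]

theorem degreeHom_injective : Function.Injective (degreeHom ψ n) := by
  let aug : MonoidAlgebra (MonoidAlgebra ℤ (Gam G n)) (Multiplicative ℤ) →+
      MonoidAlgebra ℤ (Gam G n) :=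
    (Finsupp.liftAddHom fun _ => AddMonoidHom.id _).comp
      MonoidAlgebra.coeffAddEquiv.toAddMonoidHom
  have h : ∀ x, aug (degreeHom ψ n x) = x := by
    intro x
    induction x using MonoidAlgebra.induction_on with
    | of g =>
      rw [MonoidAlgebra.of_apply, degreeHom_single]
      exact (Finsupp.liftAddHom_apply_single (fun _ => AddMonoidHom.id _) _ _)
    | add x y hx hy => rw [map_add, map_add, hx, hy]
    | smul r x hx => rw [map_zsmul, map_zsmul, hx]
  exact Function.LeftInverse.injective h

/-- A binomial of positive degree is not invertible in `Rₙ`. -/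
theorem mul_sub_notMem_nonzeroBar {g : G} (hg : ψ g ≠ 1) {a b : GamRingOp G n}
    (ha : a ∈ opRange (GamBar ψ n)) (ha0 : a ≠ 0) (hb : b ∈ opRange (GamBar ψ n)) (hb0 : b ≠ 0)
    (x : GamRingOp G n) : x * (a * gamLeft G n g - b) ∉ nonzeroBar ψ n := by
  intro hy
  set y := x * (a * gamLeft G n g - b) with hydef
  have hy0 := ne_zero_of_mem_nonzeroBar hy
  have hT := degreeHom_of_mem (mem_opRange_of_mem_nonzeroBar hy)
  have hx0 : degreeHom ψ n x.unop ≠ 0 := fun h => hy0 (by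
    have := degreeHom_injective (h.trans (map_zero _).symm)
    rw [hydef, (MulOpposite.unop_eq_zero_iff _).1 this, zero_mul])
  set T := degreeHom ψ n x.unop with hTdef
  set A : MonoidAlgebra ℤ (Gam G n) := MonoidAlgebra.single (QuotientGroup.mk g⁻¹) 1 * a.unop
    with hA
  have hA0 : A ≠ 0 := by
    refine mul_ne_zero (by simp) fun h => ha0 ((MulOpposite.unop_eq_zero_iff _).1 h)
  have hB0 : b.unop ≠ 0 := fun h => hb0 ((MulOpposite.unop_eq_zero_iff _).1 h)
  have hY0 : y.unop ≠ 0 := fun h => hy0 ((MulOpposite.unop_eq_zero_iff _).1 h)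
  set d : Multiplicative ℤ := ψ g⁻¹ with hd
  have hd1 : d ≠ 1 := fun h => hg (by rwa [hd, map_inv, inv_eq_one] at h)
  -- Comparison of the homogeneous parts of degree k. The right side is concentrated in degree zero,
  -- written multiplicatively as 1, because y comes from ℤΓ̄ₙ.
  have hcoeff : ∀ k, A * T.coeff (d⁻¹ * k) - b.unop * T.coeff k =
      (MonoidAlgebra.single (1 : Multiplicative ℤ) y.unop).coeff k := by
    intro k
    rw [← hT, hydef, MulOpposite.unop_mul, MulOpposite.unop_sub,
      map_mul (degreeHom ψ n), map_sub (degreeHom ψ n), degreeHom_of_mem hb, MulOpposite.unop_mul,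
      map_mul (degreeHom ψ n), degreeHom_of_mem ha, gamLeft_apply,
      MulOpposite.unop_op, degreeHom_single, MonoidAlgebra.single_mul_single, mul_one, sub_mul,
      MonoidAlgebra.coeff_sub, Finsupp.sub_apply, MonoidAlgebra.coeff_single_mul_apply,
      MonoidAlgebra.coeff_single_mul_apply, inv_one, one_mul]
    rfl
  have hone : ∀ k, A * T.coeff (d⁻¹ * k) - b.unop * T.coeff k ≠ 0 → k = 1 := by
    intro k hk
    by_contra h1
    rw [hcoeff, MonoidAlgebra.coeff_single, Finsupp.single_eq_of_ne h1] at hk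
    exact hk rfl
  have hne : T.coeff.support.Nonempty :=
    Finsupp.support_nonempty_iff.2 fun h => hx0 (MonoidAlgebra.coeff_eq_zero.1 h)
  have hM := Finset.max'_mem _ hne
  have hm := Finset.min'_mem _ hne
  have hlt : ∀ k, T.coeff.support.max' hne < k → T.coeff k = 0 := fun k hk => by
    by_contra h
    exact absurd (Finset.le_max' _ _ (Finsupp.mem_support_iff.2 h)) (not_le.2 hk)
  have hgt : ∀ k, k < T.coeff.support.min' hne → T.coeff k = 0 := fun k hk => by
    by_contra h
    exact absurd (Finset.min'_le _ _ (Finsupp.mem_support_iff.2 h)) (not_le.2 hk)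
  have hle := Finset.min'_le_max' _ hne
  rw [Finsupp.mem_support_iff] at hM hm
  -- In a domain the extreme terms of the product survive. The one shifted by d and the unshifted
  -- one at the opposite end have different degrees, but both would have to be of degree zero.
  rcases lt_or_gt_of_ne hd1 with h | h
  · have h1 := hone (d * T.coeff.support.min' hne) (by
      rw [inv_mul_cancel_left, hgt _ (mul_lt_of_lt_one_left' _ h), mul_zero, sub_zero]
      exact mul_ne_zero hA0 hm)
    have h2 := hone (T.coeff.support.max' hne) (by
      rw [hlt _ (lt_mul_of_one_lt_left' _ (one_lt_inv'.2 h)), mul_zero, zero_sub]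
      exact neg_ne_zero.2 (mul_ne_zero hB0 hM))
    rw [h2] at hle
    have := mul_lt_one_of_lt_of_le h hle
    exact this.ne h1
  · have h1 := hone (d * T.coeff.support.max' hne) (by
      rw [inv_mul_cancel_left, hlt _ (lt_mul_of_one_lt_left' _ h), mul_zero, sub_zero]
      exact mul_ne_zero hA0 hM)
    have h2 := hone (T.coeff.support.min' hne) (by
      rw [hgt _ (mul_lt_of_lt_one_left' _ (inv_lt_one'.2 h)), mul_zero, zero_sub]
      exact neg_ne_zero.2 (mul_ne_zero hB0 hm))
    rw [h2] at hle
    have := one_lt_mul_of_lt_of_le' h hle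
    exact this.ne' h1

end OpRange

/-! ### The universal derivation -/

section Coinduced

variable {G : Type u} [Group G] {n : ℕ}

/-- An additive map that commutes with the action of `G` is linear over the group ring. -/
def linearMapOfCommutes {M M' : Type*} [AddCommGroup M] [AddCommGroup M']
    [Module (GamRingOp G n) M] [Module (GamRingOp G n) M'] (f : M →+ M')
    (h : ∀ g v, f (gamLeft G n g • v) = gamLeft G n g • f v) : M →ₗ[GamRingOp G n] M' :=
  { f with
    map_smul' := by
      intro r v
      induction r using MulOpposite.rec' with | _ r => ?_
      change f _ = MulOpposite.op r • f v
      induction r using MonoidAlgebra.induction_on with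
      | of k =>
        obtain ⟨y, rfl⟩ := QuotientGroup.mk_surjective k
        have := h y⁻¹ v
        rwa [gamLeft_apply, inv_inv] at this
      | add x y hx hy => rw [MulOpposite.op_add, add_smul, add_smul, map_add, hx, hy]
      | smul r x hx => rw [MulOpposite.op_smul, smul_assoc, smul_assoc, map_zsmul, hx] }

variable (G n) in
/-- The module coinduced from the Alexander module. -/
def Coinduced : Type u := Gam G n → AlexanderModule G n

noncomputable instance : AddCommGroup (Coinduced G n) :=
  inferInstanceAs (AddCommGroup (Gam G n → AlexanderModule G n))

/-- The right action of `Γₙ` by translations on the coinduced module. -/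
noncomputable def coinducedAction : Gam G n →* (AddMonoid.End (Coinduced G n))ᵐᵒᵖ where
  toFun g := MulOpposite.op
    { toFun := fun φ => (fun x => φ (g * x) : Gam G n → AlexanderModule G n)
      map_zero' := rfl
      map_add' := fun _ _ => rfl }
  map_one' := MulOpposite.unop_injective <| AddMonoidHom.ext fun φ => funext fun x =>
    congrArg φ (one_mul x)
  map_mul' g h := MulOpposite.unop_injective <| AddMonoidHom.ext fun φ => funext fun x =>
    congrArg φ (mul_assoc g h x)

noncomputable instance : Module (GamRingOp G n) (Coinduced G n) :=
  Module.compHom _ ((RingEquiv.opOp (AddMonoid.End (Coinduced G n))).symm.toRingHom.comp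
    (RingHom.op (MonoidAlgebra.lift ℤ _ _ coinducedAction).toRingHom))

theorem gamLeft_smul_coinduced (g : G) (φ : Coinduced G n) (x : Gam G n) :
    (gamLeft G n g • φ) x = φ (QuotientGroup.mk g⁻¹ * x) := by
  change ((MonoidAlgebra.lift ℤ _ _ coinducedAction) (MonoidAlgebra.single _ 1)).unop φ x = _
  rw [MonoidAlgebra.lift_single, one_smul]
  rfl

variable (G n) in
/-- The embedding of the Alexander module into the coinduced module. -/
noncomputable def toCoinduced : AlexanderModule G n →ₗ[GamRingOp G n] Coinduced G n :=
  linearMapOfCommutes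
    -- Because `gamLeft` inverts, this is the function x ↦ v · x.
    { toFun := fun v => (fun x => gamLeft G n x.out⁻¹ • v : Gam G n → AlexanderModule G n)
      map_zero' := funext fun _ => smul_zero _
      map_add' := fun _ _ => funext fun _ => smul_add _ _ _ } (by
    intro g v
    funext x
    rw [gamLeft_smul_coinduced]
    change gamLeft G n x.out⁻¹ • gamLeft G n g • v = gamLeft G n (Quotient.out _)⁻¹ • v
    rw [← mul_smul, ← map_mul]
    congr 1
    rw [gamLeft_eq_iff, ← QuotientGroup.eq, QuotientGroup.mk_mul, QuotientGroup.mk_inv,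
      QuotientGroup.mk_inv, QuotientGroup.out_eq', QuotientGroup.out_eq', mul_inv_rev,
      QuotientGroup.mk_inv, inv_inv])

theorem toCoinduced_apply (v : AlexanderModule G n) (x : Gam G n) :
    toCoinduced G n v x = gamLeft G n x.out⁻¹ • v := rfl

theorem toCoinduced_injective : Function.Injective (toCoinduced G n) := by
  rw [injective_iff_map_eq_zero]
  intro v hv
  have h := congrFun hv 1
  rw [toCoinduced_apply] at h
  rw [← one_smul (GamRingOp G n) v, ← map_one (gamLeft G n),
    ← inv_mul_cancel (Quotient.out (1 : Gam G n)), map_mul, (gamLeft_eq_one_iff).2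
    ((QuotientGroup.eq_one_iff (Quotient.out (1 : Gam G n))).1 (QuotientGroup.out_eq' 1)), mul_one]
  exact h

/-- A derivation to the coinduced module that extends the canonical map from `G_r^{(n+1)}`. -/
theorem exists_isDerivation_coinduced : ∃ c : G → Coinduced G n, IsDerivation (gamLeft G n) c ∧
    ∀ h : rationalDerivedSeries G (n + 1), c h = toCoinduced G n (AlexanderModule.mk G n h) := by
  -- For the set-theoretic section `Quotient.out`, this is the Schreier element of g at the coset x.
  -- These elements form a cocycle with values in G_r^{(n+1)}, as in the embedding of a group
  -- extension in a wreath product.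
  have hmem : ∀ (g : G) (x : Gam G n), x.out⁻¹ * g * Quotient.out (QuotientGroup.mk g⁻¹ * x) ∈
      rationalDerivedSeries G (n + 1) := by
    intro g x
    rw [← QuotientGroup.eq_one_iff, QuotientGroup.mk_mul, QuotientGroup.mk_mul,
      QuotientGroup.mk_inv, QuotientGroup.out_eq', QuotientGroup.out_eq', QuotientGroup.mk_inv]
    group
  refine ⟨fun g => (fun x => AlexanderModule.mk G n ⟨_, hmem g x⟩ :
    Gam G n → AlexanderModule G n), fun g h => funext fun x => ?_, fun h => funext fun x => ?_⟩
  · refine Eq.trans ?_ (congrArg (_ + ·) (gamLeft_smul_coinduced g _ x).symm)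
    change _ = AlexanderModule.mk G n _ + AlexanderModule.mk G n _
    rw [← AlexanderModule.mk_mul]
    refine congrArg _ (Subtype.ext ?_)
    have : (QuotientGroup.mk (g * h)⁻¹ : Gam G n) * x =
        QuotientGroup.mk h⁻¹ * (QuotientGroup.mk g⁻¹ * x) := by
      rw [mul_inv_rev, QuotientGroup.mk_mul, mul_assoc]
    simp only [Subgroup.coe_mul, this]
    group
  · rw [toCoinduced_apply, gamLeft_smul_mk]
    refine congrArg _ (Subtype.ext ?_)
    have : (QuotientGroup.mk (h : G)⁻¹ : Gam G n) = 1 :=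
      (QuotientGroup.eq_one_iff _).2 (inv_mem h.2)
    simp [this]

end Coinduced

/-! ### Localization -/

section Localization

variable {G : Type u} [Group G] (ψ : G →* Multiplicative ℤ) (n : ℕ)

/-- The action of `G` on left modules over (the opposite of) `Rₙ`. -/
noncomputable def locLeft : G →* ROp ψ n :=
  (OreLocalization.numeratorRingHom (S := nonzeroBar ψ n)).toMonoidHom.comp (gamLeft G n)

/-- The map from the Alexander module to its localization. -/
noncomputable def locMk (x : AlexanderModule G n) : LocalizedAlexanderModule ψ n :=
  OreLocalization.oreDiv x (1 : nonzeroBar ψ n)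

variable {ψ n}

theorem numerator_gamLeft (g : G) :
    OreLocalization.numeratorRingHom (S := nonzeroBar ψ n) (gamLeft G n g) = locLeft ψ n g := rfl

theorem locLeft_eq_one {g : G} (hg : g ∈ rationalDerivedSeries G (n + 1)) : locLeft ψ n g = 1 := by
  rw [← numerator_gamLeft, gamLeft_eq_one_iff.2 hg, map_one]

theorem isUnit_numerator {x : GamRingOp G n} (hx : x ∈ opRange (GamBar ψ n)) (hx0 : x ≠ 0) :
    IsUnit (OreLocalization.numeratorRingHom (S := nonzeroBar ψ n) x) :=
  OreLocalization.numerator_isUnit (⟨x, mem_nonzeroBar hx hx0⟩ : nonzeroBar ψ n)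

theorem KToR_numerator (r : GamBarRingOp ψ n) :
    KToR ψ n (OreLocalization.numeratorRingHom r) =
      OreLocalization.numeratorRingHom (S := nonzeroBar ψ n) (gamBarIncl ψ n r) :=
  OreLocalization.universalHom_commutes _ _ _

theorem exists_KToR_eq {x : GamRingOp G n} (hx : x ∈ opRange (GamBar ψ n)) :
    ∃ k, KToR ψ n k = OreLocalization.numeratorRingHom (S := nonzeroBar ψ n) x := by
  obtain ⟨r, rfl⟩ := hx
  exact ⟨_, KToR_numerator r⟩

theorem exists_KToR_mul_eq_one (s : nonzeroBar ψ n) :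
    ∃ k, KToR ψ n k = OreLocalization.oreDiv (1 : GamRingOp G n) s := by
  obtain ⟨k, hk⟩ := exists_KToR_eq (mem_opRange_of_mem_nonzeroBar s.2)
  have h1 : OreLocalization.oreDiv (1 : GamRingOp G n) s *
      OreLocalization.numeratorRingHom (S := nonzeroBar ψ n) (s : GamRingOp G n) = 1 :=
    OreLocalization.mul_inv 1 s
  -- Otherwise 1 = 0 in Rₙ, so an element of Sₙ would kill 1.
  have hk0 : k ≠ 0 := by
    rintro rfl
    have h2 := ne_zero_of_mem_nonzeroBar s.2
    obtain ⟨r, hr, hrs⟩ := s.2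
    rw [map_zero] at hk
    rw [← hk, mul_zero] at h1
    have h3 := congrArg (· * OreLocalization.numeratorRingHom (S := nonzeroBar ψ n)
      (1 : GamRingOp G n)) h1
    simp only [zero_mul, one_mul] at h3
    obtain ⟨t, ht, h4⟩ := OreLocalization.oreDiv_one_eq_zero_iff.1 h3.symm
    rw [smul_eq_mul, mul_one] at h4
    exact ne_zero_of_mem_nonzeroBar ht h4
  refine ⟨k⁻¹, ?_⟩
  rw [← hk] at h1
  calc KToR ψ n k⁻¹ =
        (OreLocalization.oreDiv (1 : GamRingOp G n) s * KToR ψ n k) * KToR ψ n k⁻¹ := by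
        rw [h1, one_mul]
    _ = _ := by rw [mul_assoc, ← map_mul, mul_inv_cancel₀ hk0, map_one, mul_one]

theorem K_smul_def (k : KOp ψ n) (v : LocalizedAlexanderModule ψ n) : k • v = KToR ψ n k • v := rfl

/-- Denominators come from 𝕂ₙ, so the Alexander module spans its localization over 𝕂ₙ and ranks can
be computed from images of its elements. -/
theorem exists_smul_locMk (v : LocalizedAlexanderModule ψ n) :
    ∃ (k : KOp ψ n) (x : AlexanderModule G n), v = k • locMk ψ n x := by
  obtain ⟨x, s, rfl⟩ : ∃ x s, v = OreLocalization.oreDiv x s := by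
    induction v using OreLocalization.ind with | _ x s => exact ⟨x, s, rfl⟩
  obtain ⟨k, hk⟩ := exists_KToR_mul_eq_one s
  exact ⟨k, x, by rw [K_smul_def, hk]; exact OreLocalization.oreDiv_eq_smul x s⟩

theorem locMk_add (x y : AlexanderModule G n) : locMk ψ n (x + y) = locMk ψ n x + locMk ψ n y :=
  OreLocalization.add_oreDiv.symm

theorem numerator_smul_locMk (r : GamRingOp G n) (x : AlexanderModule G n) :
    OreLocalization.numeratorRingHom (S := nonzeroBar ψ n) r • locMk ψ n x = locMk ψ n (r • x) :=
  OreLocalization.smul_div_one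

theorem locMk_eq_zero_iff {x : AlexanderModule G n} :
    locMk ψ n x = 0 ↔ ∃ s ∈ nonzeroBar ψ n, s • x = 0 :=
  OreLocalization.oreDiv_one_eq_zero_iff

theorem IsDerivation.localize {M : Type*} [AddCommGroup M] [Module (GamRingOp G n) M] {c : G → M}
    (hc : IsDerivation (gamLeft G n) c) :
    IsDerivation (locLeft ψ n) fun g => OreLocalization.oreDiv (c g) (1 : nonzeroBar ψ n) := by
  intro g h
  refine (congrArg (fun x => OreLocalization.oreDiv x (1 : nonzeroBar ψ n)) (hc g h)).trans ?_
  rw [← OreLocalization.add_oreDiv]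
  exact congrArg (_ + ·) OreLocalization.smul_div_one.symm

/-- The localized Alexander module embeds in a module with a derivation from `G` that extends the
canonical map on `G_r^{(n+1)}`. -/
theorem exists_embedding_isDerivation : ∃ (U : Type u) (_ : AddCommGroup U)
    (_ : Module (ROp ψ n) U) (j : LocalizedAlexanderModule ψ n →ₗ[ROp ψ n] U) (c : G → U),
    Function.Injective j ∧ IsDerivation (locLeft ψ n) c ∧
    ∀ h : rationalDerivedSeries G (n + 1), c h = j (locMk ψ n (AlexanderModule.mk G n h)) := by
  obtain ⟨c, hc, hc'⟩ := exists_isDerivation_coinduced (G := G) (n := n)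
  refine ⟨OreLocalization (nonzeroBar ψ n) (Coinduced G n), inferInstance, inferInstance,
    OreLocalization.mapModule (toCoinduced G n),
    fun g => OreLocalization.oreDiv (c g) (1 : nonzeroBar ψ n),
    OreLocalization.mapModule_injective _ toCoinduced_injective, hc.localize, fun h => ?_⟩
  exact congrArg (fun x => OreLocalization.oreDiv x (1 : nonzeroBar ψ n)) (hc' h)

end Localization

/-! ### A criterion for all derivations to be inner -/

section Inner

variable {G : Type u} [Group G] (e : G ≃* BraidGroup4) {B : Type*} [Ring B] {U : Type*}
  [AddCommGroup U] [Module B U] {lam : G →* B} {c : G → U}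

theorem exists_smul_eq_of_isUnit {x : B} (hx : IsUnit x) (v : U) : ∃ y, x • y = v := by
  obtain ⟨x, rfl⟩ := hx
  exact ⟨(↑x⁻¹ : B) • v, by rw [← mul_smul, Units.mul_inv, one_smul]⟩

theorem inv_smul_smul_of_hom (lam : G →* B) (g : G) (v : U) : lam g⁻¹ • lam g • v = v := by
  rw [← mul_smul, ← map_mul, inv_mul_cancel, map_one, one_smul]

theorem IsDerivation.eq_zero_of_gen (hc : IsDerivation lam c) (h : ∀ i, c (gen e i) = 0) (g : G) :
    c g = 0 :=
  mem_of_gen_mem e (P :=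
    { carrier := {g | c g = 0}
      one_mem' := hc.map_one
      mul_mem' := fun {x y} hx hy => by
        rw [Set.mem_ofPred_eq, hc, hx, hy, smul_zero, add_zero]
      inv_mem' := fun {x} hx => by
        rw [Set.mem_ofPred_eq, hc.map_inv, hx, smul_zero, neg_zero] }) h g

/-- If the action of `σ₃σ₁⁻¹` is sufficiently nontrivial, then all derivations are inner. -/
theorem IsDerivation.exists_eq_inner (hc : IsDerivation lam c) (uA : IsUnit (lam (genA e) - 1))
    {m m' : B} (hmm : m * (lam (genA e) - 1) = m' * (lam (gen e 1 * genA e * (gen e 1)⁻¹) - 1))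
    (hu : IsUnit (m' - m + m * lam (genW e))) : ∃ v, ∀ g, c g = lam g • v - v := by
  obtain ⟨v, hv⟩ := exists_smul_eq_of_isUnit uA (c (genA e))
  rw [sub_smul, one_smul] at hv
  refine ⟨v, fun g => sub_eq_zero.1 ?_⟩
  have hc' := hc.sub_inner v
  have hA : c (genA e) - (lam (genA e) • v - v) = 0 := by rw [hv, sub_self]
  generalize hcc : (fun g => c g - (lam g • v - v)) = c' at hc'
  replace hA : c' (genA e) = 0 := by rw [← hcc]; exact hA
  suffices H : ∀ g, c' g = 0 by
    have := H g
    rwa [← hcc] at this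
  -- Expanding c' on σ₁A = Aσ₁ gives (a - 1)c'(σ₁) = 0.
  have h0 : c' (gen e 0) = 0 := by
    rw [← uA.smul_eq_zero, sub_smul, one_smul, sub_eq_zero]
    have h1 := hc' (genA e) (gen e 0)
    rw [genA_mul_gen, ← gen_mul_genA, hc', hA, smul_zero, add_zero, zero_add] at h1
    exact h1.symm
  have h2 : c' (gen e 2) = 0 := by rw [← genA_mul_gen, hc', hA, h0, smul_zero, add_zero]
  refine hc'.eq_zero_of_gen e fun i => ?_
  suffices h1 : c' (gen e 1) = 0 by fin_cases i <;> assumption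
  have r1 := hc'.braid (gen_braid₀₁ e)
  have r2 := hc'.braid (gen_braid₁₂ e)
  generalize c' (gen e 1) = d at r1 r2 ⊢
  simp only [h0, smul_zero, zero_add, add_zero] at r1
  simp only [h2, smul_zero, zero_add, add_zero] at r2
  -- With x = td, ε = (a - 1)x and y = sx, the braid relations yield sε = ε, (b - 1)y = ε and (a -
  -- 1)y = ε - wε, where b is the action of σ₂Aσ₂⁻¹. Multiplying the last two by m' and m gives (m'
  -- - m + mw)ε = 0.
  obtain ⟨x, hx⟩ : ∃ x, x = lam (gen e 0) • d := ⟨_, rfl⟩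
  obtain ⟨ε, hε⟩ : ∃ ε, ε = (lam (genA e) - 1) • x := ⟨_, rfl⟩
  obtain ⟨y, hy⟩ : ∃ y, y = lam (gen e 1) • x := ⟨_, rfl⟩
  rw [← hx, ← hy] at r1
  have hε' : ε = lam (gen e 2) • d - x := by
    rw [hε, sub_smul, one_smul, hx, ← mul_smul, ← map_mul, genA_mul_gen]
  have h1ε : lam (gen e 1) • ε = ε := by
    rw [hε', smul_sub, eq_sub_of_add_eq' r2, ← hy, r1]
    abel
  have hby : (lam (gen e 1 * genA e * (gen e 1)⁻¹) - 1) • y = ε := by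
    rw [← h1ε, hε, sub_smul, one_smul, hy, ← mul_smul, ← map_mul, inv_mul_cancel_right, map_mul,
      sub_smul, one_smul, smul_sub, mul_smul]
  have hAd : (lam (genA e) - 1) • d = lam (genW e) • ε := by
    rw [genW, map_mul, mul_smul, h1ε, hε', smul_sub, hx, inv_smul_smul_of_hom, sub_smul, one_smul,
      ← mul_smul _ _ d, ← map_mul, ← gen_mul_genA, inv_mul_cancel_left]
  have hAy : (lam (genA e) - 1) • y = ε - lam (genW e) • ε := by
    rw [← hAd, hε, ← smul_sub, r1, add_sub_cancel_left]
  have hε0 : ε = 0 := by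
    rw [← hu.smul_eq_zero]
    have h3 := congrArg (fun z => z • y) hmm
    simp only [mul_smul, hAy, hby] at h3
    rw [add_smul, sub_smul, mul_smul, ← h3, smul_sub]
    abel
  have hx0 : x = 0 := uA.smul_eq_zero.1 (hε.symm.trans hε0)
  rw [← inv_smul_smul_of_hom lam (gen e 0) d, ← hx, hx0, smul_zero]

end Inner

/-! ### Vanishing of the degree when σ₃σ₁⁻¹ survives in Γₙ -/

section Degrees

variable {G : Type u} [Group G] (e : G ≃* BraidGroup4) {ψ : G →* Multiplicative ℤ} {n : ℕ}

theorem isUnit_locLeft_sub_one {g : G} (hg : ψ g = 1)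
    (hg' : g ∉ rationalDerivedSeries G (n + 1)) : IsUnit (locLeft ψ n g - 1) := by
  rw [← numerator_gamLeft, ← map_one OreLocalization.numeratorRingHom, ← map_sub]
  refine isUnit_numerator (sub_mem (gamLeft_mem_opRange_gamBar hg) (one_mem _)) fun h => hg' ?_
  exact gamLeft_eq_one_iff.1 (sub_eq_zero.1 h)

theorem apply_eq_one_of_mem (ψ : G →* Multiplicative ℤ) {g : G}
    (hg : g ∈ rationalDerivedSeries G 1) : ψ g = 1 :=
  rationalDerivedSeries_le_ker ψ 0 hg

theorem mk_mem_map_iff {m : ℕ} (h : m ≤ n + 1) {g : G} :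
    (QuotientGroup.mk g : Gam G n) ∈
      (rationalDerivedSeries G m).map (QuotientGroup.mk' (rationalDerivedSeries G (n + 1))) ↔
      g ∈ rationalDerivedSeries G m := by
  constructor
  · rintro ⟨x, hx, hxg⟩
    have h1 : x⁻¹ * g ∈ rationalDerivedSeries G (n + 1) := QuotientGroup.eq.1 hxg
    have := Subgroup.mul_mem _ hx (rationalDerivedSeries_antitone h h1)
    rwa [mul_inv_cancel_left] at this
  · exact fun h => ⟨g, h, rfl⟩

include e in
-- Both A and σ₂Aσ₂⁻¹ lie in G_r^{(2)}, so the Ore multipliers m, m' can be taken over the image X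
-- of that subgroup. Since W lies outside X, m' - m + mw is nonzero and hence a unit; so c is inner,
-- and inner derivations vanish on G_r^{(n+1)}.
theorem derivation_eq_zero_of_genA_notMem {U : Type*} [AddCommGroup U] [Module (ROp ψ n) U]
    {c : G → U} (hn : 1 ≤ n) (hc : IsDerivation (locLeft ψ n) c)
    (ha : genA e ∉ rationalDerivedSeries G (n + 1)) {h : G}
    (hh : h ∈ rationalDerivedSeries G (n + 1)) : c h = 0 := by
  let X : Subgroup (Gam G n) :=
    (rationalDerivedSeries G 2).map (QuotientGroup.mk' (rationalDerivedSeries G (n + 1)))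
  have hX : X ≤ GamBar ψ n := by
    rintro _ ⟨g, hg, rfl⟩
    exact apply_eq_one_of_mem ψ (rationalDerivedSeries_antitone one_le_two hg)
  have hn2 : 2 ≤ n + 1 := by omega
  set b := gen e 1 * genA e * (gen e 1)⁻¹ with hb
  have hbX : b ∈ rationalDerivedSeries G 2 :=
    (rationalDerivedSeries_normal 2).conj_mem _ (genA_mem_two e) _
  have hbn : b ∉ rationalDerivedSeries G (n + 1) := fun h => ha (by
    have := (rationalDerivedSeries_normal (n + 1)).conj_mem _ h (gen e 1)⁻¹
    simpa [hb, mul_assoc] using this)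
  obtain ⟨m, hm, m', hm', hm0, hmm⟩ := exists_mul_eq_mul_opRange (X := X)
    (x := gamLeft G n (genA e) - 1) (y := gamLeft G n b - 1)
    (sub_mem (gamLeft_mem_opRange ((mk_mem_map_iff hn2).2 (genA_mem_two e))) (one_mem _))
    (sub_mem (gamLeft_mem_opRange ((mk_mem_map_iff hn2).2 hbX)) (one_mem _))
    (fun h => hbn (gamLeft_eq_one_iff.1 (sub_eq_zero.1 h)))
  have hz : (m' - m) + m * gamLeft G n (genW e) ≠ 0 :=
    add_mul_gamLeft_ne_zero hm hm0 (sub_mem hm' hm) fun h =>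
      genW_notMem e ((mk_mem_map_iff hn2).1 h)
  have hu := isUnit_numerator (ψ := ψ) (add_mem (opRange_mono hX (sub_mem hm' hm))
    (mul_mem (opRange_mono hX hm)
      (gamLeft_mem_opRange_gamBar (apply_eq_one_of_mem ψ (genW_mem e))))) hz
  rw [map_add, map_sub, map_mul, numerator_gamLeft] at hu
  have hmm' := congrArg (OreLocalization.numeratorRingHom (S := nonzeroBar ψ n)) hmm
  rw [map_mul, map_mul, map_sub, map_sub, map_one, numerator_gamLeft, numerator_gamLeft] at hmm'
  obtain ⟨v, hv⟩ := hc.exists_eq_inner e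
    (isUnit_locLeft_sub_one (apply_eq_one_of_mem ψ (genA_mem e)) ha) hmm' hu
  rw [hv, locLeft_eq_one hh, one_smul, sub_self]

include e in
theorem degree_eq_zero_of_notMem (hn : 1 ≤ n) (ha : genA e ∉ rationalDerivedSeries G (n + 1)) :
    degree ψ n = 0 := by
  obtain ⟨U, _, _, j, c, hj, hc, hcj⟩ := exists_embedding_isDerivation (ψ := ψ) (n := n)
  have h1 : ∀ v : LocalizedAlexanderModule ψ n, v = 0 := fun v => by
    obtain ⟨k, x, rfl⟩ := exists_smul_locMk v
    obtain ⟨h, rfl⟩ := AlexanderModule.mk_surjective n x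
    have : j (locMk ψ n (AlexanderModule.mk G n h)) = 0 := by
      rw [← hcj, derivation_eq_zero_of_genA_notMem e hn hc ha h.2]
    rw [(map_eq_zero_iff j hj).1 this, smul_zero]
  have : Subsingleton (LocalizedAlexanderModule ψ n) := ⟨fun x y => (h1 x).trans (h1 y).symm⟩
  exact rank_subsingleton' _ _

end Degrees

/-! ### Derivations when σ₃σ₁⁻¹ acts trivially -/

section Proportional

variable {G : Type u} [Group G] (e : G ≃* BraidGroup4) {B : Type*} [Ring B] {K : Type*} [Ring K]
  {U : Type*} [AddCommGroup U] [Module B U] {lam : G →* B} {c : G → U}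

/-- If `σ₃σ₁⁻¹` acts trivially, then modulo inner derivations, all derivations to modules over a
skew Laurent polynomial ring have values in a line. -/
theorem exists_sub_inner_proportional (hc : IsDerivation lam c) (κ : K →+* B)
    (hA : lam (genA e) = 1) (hw : lam (genW e) ≠ 1) (hpw : lam (genP e) ≠ lam (genW e))
    (hX : IsUnit (lam (genW e) * lam (genW e) - (3 : ℤ) • lam (genW e) + 1))
    (hconj : ∀ g k, ∃ k', lam g * κ k = κ k' * lam g)
    (hN : ∀ g ∈ rationalDerivedSeries G 1, ∃ k, κ k = lam g)
    (hI : ∀ g ∈ rationalDerivedSeries G 1, ∀ g' ∈ rationalDerivedSeries G 1, lam g ≠ lam g' →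
      ∃ k, IsUnit (lam g - lam g') ∧ κ k * (lam g - lam g') = 1) :
    ∃ v d : U, ∀ g, ∃ k, c g - (lam g • v - v) = κ k • d := by
  have hW := genW_mem e
  have hP := genP_mem e
  have uW : IsUnit (lam (genW e) - 1) := by
    have := hI _ hW 1 (one_mem _) (by rwa [map_one])
    rw [map_one] at this
    exact this.choose_spec.1
  obtain ⟨v, hv⟩ := exists_smul_eq_of_isUnit uW (c (genW e))
  rw [sub_smul, one_smul] at hv
  refine ⟨v, ?_⟩
  have hc' := hc.sub_inner v
  have hW0 : c (genW e) - (lam (genW e) • v - v) = 0 := by rw [hv, sub_self]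
  generalize hcc : (fun g => c g - (lam g • v - v)) = c' at hc'
  replace hW0 : c' (genW e) = 0 := by rw [← hcc]; exact hW0
  suffices H : ∃ d : U, ∀ h, ∃ k, c' h = κ k • d by
    obtain ⟨d, hd⟩ := H
    exact ⟨d, fun h => by have := hd h; rwa [← hcc] at this⟩
  have hA' : lam (genA e)⁻¹ = 1 := by
    rw [← one_mul (lam _), ← hA, ← map_mul, mul_inv_cancel, map_one, hA]
  -- Since A acts trivially, c'(A) satisfies the relations of the class of A, so the unit w² - 3w +
  -- 1 kills it.
  have hα : c' (genA e) = 0 := by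
    have h1 : lam (gen e 0) • c' (genA e) = c' (genA e) := by
      rw [← hc'.map_conj _ hA, conj_genA]
    have h2 : lam (gen e 0) • lam (gen e 1) • c' (genA e) =
        lam (gen e 1) • c' (genA e) - c' (genA e) := by
      have hb : lam (gen e 1 * genA e * (gen e 1)⁻¹) = 1 := by
        rw [map_mul, map_mul, hA, mul_one, ← map_mul, mul_inv_cancel, map_one]
      rw [← hc'.map_conj _ hA, ← hc'.map_conj _ hb, conj_conj_genA, hc'.map_inv_mul, hA', one_smul]
    have h3 := (genA_module_relations e lam h1 h2).1
    rw [← hX.smul_eq_zero, add_smul, sub_smul, mul_smul, h3, one_smul, smul_assoc]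
    abel
  set d := c' (gen e 0) with hd
  have hd2 : c' (gen e 2) = d := by rw [← genA_mul_gen, hc', hα, hA, one_smul, zero_add]
  have hd1 : c' (gen e 1) = d := by rw [← gen_mul_genW, hc', hW0, smul_zero, add_zero]
  -- The braid relation with c'(σ₁) = c'(σ₂) = d reads td + tsd = sd + std. Multiply by t⁻¹ and use
  -- t⁻¹s = w and s = pt.
  have hbr : (lam (genP e) - lam (genW e)) • lam (gen e 0) • d =
      (lam (genW e) - 1) • d := by
    have h1 := hc'.braid (gen_braid₀₁ e)
    rw [hd1, ← hd, add_assoc, add_assoc] at h1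
    have h2 := congrArg (lam (gen e 0)⁻¹ • ·) (add_left_cancel h1)
    have h3 : ∀ x : U, lam (gen e 0)⁻¹ • lam (gen e 1) • x = lam (genW e) • x := fun x => by
      rw [← mul_smul, ← map_mul, genW]
    have h4 : lam (genP e) • lam (gen e 0) • d = lam (gen e 1) • d := by
      rw [← mul_smul, ← map_mul, genP_mul_gen]
    simp only [smul_add, inv_smul_smul_of_hom, h3] at h2
    rw [sub_smul, sub_smul, one_smul, h4, sub_eq_sub_iff_add_eq_add, add_comm, h2]
  -- The K-line through d. As G normalizes the image of K, the line is G-stable once σ₁ and σ₁⁻¹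
  -- move d within it.
  let L : Set U := {y | ∃ k, y = κ k • d}
  have hLadd : ∀ {x y}, x ∈ L → y ∈ L → x + y ∈ L := by
    rintro _ _ ⟨k, rfl⟩ ⟨l, rfl⟩
    exact ⟨k + l, by rw [map_add, add_smul]⟩
  have hLneg : ∀ {x}, x ∈ L → -x ∈ L := by
    rintro _ ⟨k, rfl⟩
    exact ⟨-k, by rw [map_neg, neg_smul]⟩
  have hLK : ∀ k {x}, x ∈ L → κ k • x ∈ L := by
    rintro k _ ⟨l, rfl⟩
    exact ⟨k * l, by rw [map_mul, mul_smul]⟩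
  have hdL : d ∈ L := ⟨1, by rw [map_one, one_smul]⟩
  have hLN : ∀ {x} {g : G}, g ∈ rationalDerivedSeries G 1 → x ∈ L → lam g • x ∈ L := by
    intro x g hg hx
    obtain ⟨k, hk⟩ := hN g hg
    rw [← hk]
    exact hLK k hx
  have hLg : ∀ {g : G}, lam g • d ∈ L → ∀ {x}, x ∈ L → lam g • x ∈ L := by
    rintro g hg _ ⟨k, rfl⟩
    obtain ⟨k', hk'⟩ := hconj g k
    rw [← mul_smul, hk', mul_smul]
    exact hLK k' hg
  have hLsub : ∀ {g g' : G}, g ∈ rationalDerivedSeries G 1 → g' ∈ rationalDerivedSeries G 1 →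
      lam g ≠ lam g' → ∀ {x}, (lam g - lam g') • x ∈ L → x ∈ L := by
    intro g g' hg hg' hgg x hx
    obtain ⟨k, -, hk⟩ := hI g hg g' hg' hgg
    have := hLK k hx
    rwa [← mul_smul, hk, one_smul] at this
  have h0L : lam (gen e 0) • d ∈ L := by
    refine hLsub hP hW hpw ?_
    rw [hbr, sub_smul, one_smul, sub_eq_add_neg]
    exact hLadd (hLN hW hdL) (hLneg hdL)
  -- With w' the action of σ₁⁻¹Wσ₁, the previous relation multiplied by t⁻¹ becomes (w' - 1)t⁻¹d =
  -- (w - w')d.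
  have h0L' : lam (gen e 0)⁻¹ • d ∈ L := by
    set w' := (gen e 0)⁻¹ * genW e * gen e 0 with hw'
    have hψ' : w' ∈ rationalDerivedSeries G 1 := by
      have := (rationalDerivedSeries_normal 1).conj_mem _ hW (gen e 0)⁻¹
      rwa [inv_inv] at this
    have h1 := congrArg (lam (gen e 0)⁻¹ • ·) hbr
    simp only [sub_smul, smul_sub, one_smul] at h1
    simp only [← mul_smul, ← map_mul] at h1
    have h2 : (gen e 0)⁻¹ * (genP e * gen e 0) = genW e := by rw [genP_mul_gen]; rfl
    have h3 : (gen e 0)⁻¹ * (genW e * gen e 0) = w' := by rw [hw', mul_assoc]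
    have h4 : (gen e 0)⁻¹ * genW e = w' * (gen e 0)⁻¹ := by rw [hw', mul_inv_cancel_right]
    rw [h2, h3, h4, map_mul lam w' (gen e 0)⁻¹, mul_smul (lam w')] at h1
    refine hLsub hψ' (one_mem _) ?_ ?_
    · intro h
      refine hw ?_
      have h5 : gen e 0 * w' * (gen e 0)⁻¹ = genW e := by rw [hw']; group
      rw [← h5, map_mul, map_mul, h, ← map_mul, ← map_mul, mul_one, mul_inv_cancel, map_one]
    · rw [map_one, sub_smul, one_smul, ← h1, sub_eq_add_neg]
      exact hLadd (hLN hW hdL) (hLneg (hLN hψ' hdL))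
  have hLG : ∀ g : G, lam g • d ∈ L ∧ lam g⁻¹ • d ∈ L := by
    refine mem_of_gen_mem e (P :=
      { carrier := {g | lam g • d ∈ L ∧ lam g⁻¹ • d ∈ L}
        one_mem' := by
          rw [Set.mem_ofPred_eq, inv_one, map_one, one_smul]
          exact ⟨hdL, hdL⟩
        mul_mem' := fun {x y} hx hy => by
          rw [Set.mem_ofPred_eq, mul_inv_rev, map_mul, map_mul, mul_smul, mul_smul]
          exact ⟨hLg hx.1 hy.1, hLg hy.2 hx.2⟩
        inv_mem' := fun {x} hx => by
          rw [Set.mem_ofPred_eq, inv_inv]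
          exact ⟨hx.2, hx.1⟩ }) ?_
    intro i
    change lam _ • d ∈ L ∧ lam _ • d ∈ L
    have hW' := inv_mem hW
    fin_cases i
    · exact ⟨h0L, h0L'⟩
    · change lam (gen e 1) • d ∈ L ∧ lam (gen e 1)⁻¹ • d ∈ L
      rw [← gen_mul_genW, mul_inv_rev, map_mul, map_mul, mul_smul, mul_smul]
      exact ⟨hLg h0L (hLN hW hdL), hLN hW' h0L'⟩
    · change lam (gen e 2) • d ∈ L ∧ lam (gen e 2)⁻¹ • d ∈ L
      rw [← gen_mul_genA, mul_inv_rev, map_mul, map_mul, hA, hA', one_mul, mul_one]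
      exact ⟨h0L, h0L'⟩
  refine ⟨d, mem_of_gen_mem e (P :=
      { carrier := {g | c' g ∈ L}
        one_mem' := by
          rw [Set.mem_ofPred_eq, hc'.map_one]
          exact ⟨0, by rw [map_zero, zero_smul]⟩
        mul_mem' := fun {x y} hx hy => by
          rw [Set.mem_ofPred_eq, hc']
          exact hLadd hx (hLg (hLG x).1 hy)
        inv_mem' := fun {x} hx => by
          rw [Set.mem_ofPred_eq, hc'.map_inv]
          exact hLneg (hLg (hLG x).2 hx) }) fun i => ?_⟩
  change c' (gen e i) ∈ L
  fin_cases i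
  · exact hdL
  · exact hd1 ▸ hdL
  · exact hd2 ▸ hdL

end Proportional

/-! ### The upper bound when σ₃σ₁⁻¹ is trivial in Γₙ -/

section Degrees

variable {G : Type u} [Group G] (e : G ≃* BraidGroup4) {ψ : G →* Multiplicative ℤ} {n : ℕ}

theorem numerator_injective :
    Function.Injective (OreLocalization.numeratorRingHom (R := GamRingOp G n)
      (S := nonzeroBar ψ n)) := by
  rw [injective_iff_map_eq_zero]
  intro x hx
  obtain ⟨s, hs, h⟩ := OreLocalization.oreDiv_one_eq_zero_iff.1 hx
  exact (mul_eq_zero.1 h).resolve_left (ne_zero_of_mem_nonzeroBar hs)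

theorem exists_KToR_mul_numerator {x : GamRingOp G n} (hx : x ∈ opRange (GamBar ψ n))
    (hx0 : x ≠ 0) :
    ∃ k, KToR ψ n k * OreLocalization.numeratorRingHom (S := nonzeroBar ψ n) x = 1 := by
  obtain ⟨k, hk⟩ := exists_KToR_mul_eq_one ⟨x, mem_nonzeroBar hx hx0⟩
  exact ⟨k, by
    rw [hk]
    exact OreLocalization.mul_inv 1 (⟨x, mem_nonzeroBar hx hx0⟩ : nonzeroBar ψ n)⟩

/-- Conjugation by g preserves ℤΓ̄ₙ, by normality of Γ̄ₙ, and therefore also its fractions. -/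
theorem exists_locLeft_mul_KToR (g : G) (k : KOp ψ n) :
    ∃ k', locLeft ψ n g * KToR ψ n k = KToR ψ n k' * locLeft ψ n g := by
  have hconj : ∀ z : GamRingOp G n, OreLocalization.numeratorRingHom (S := nonzeroBar ψ n)
      (gamLeft G n g * z * gamLeft G n g⁻¹) * locLeft ψ n g =
      locLeft ψ n g * OreLocalization.numeratorRingHom z := fun z => by
    rw [map_mul, map_mul, numerator_gamLeft, numerator_gamLeft, mul_assoc, ← map_mul (locLeft ψ n),
      inv_mul_cancel, map_one, mul_one]
  obtain ⟨r, s, rfl⟩ : ∃ r s, k = OreLocalization.oreDiv r s := by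
    induction k using OreLocalization.ind with | _ r s => exact ⟨r, s, rfl⟩
  have hs0 : gamBarIncl ψ n s ≠ 0 := fun h => nonZeroDivisors.ne_zero s.2
    (gamBarIncl_injective ψ n (h.trans (map_zero _).symm))
  have h1 : OreLocalization.numeratorRingHom (S := nonzeroBar ψ n) (gamBarIncl ψ n s) *
      KToR ψ n (OreLocalization.oreDiv r s) =
      OreLocalization.numeratorRingHom (S := nonzeroBar ψ n) (gamBarIncl ψ n r) := by
    rw [← KToR_numerator, ← KToR_numerator, ← map_mul]
    congr 1
    exact (OreLocalization.mul_cancel (s := s) (t := 1) (r := r))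
  obtain ⟨k₁, hk₁⟩ := exists_KToR_mul_numerator (ψ := ψ)
    (x := gamLeft G n g * gamBarIncl ψ n s * gamLeft G n g⁻¹) (conj_mem_opRange g ⟨_, rfl⟩)
    (fun h => hs0 (by
      have := congrArg (fun z => gamLeft G n g⁻¹ * z * gamLeft G n g) h
      simpa only [mul_assoc, ← map_mul, inv_mul_cancel, map_one, mul_one, mul_zero, zero_mul,
        inv_mul_cancel_left, ← mul_assoc (gamLeft G n g⁻¹) (gamLeft G n g), one_mul] using this))
  obtain ⟨k₂, hk₂⟩ := exists_KToR_eq (ψ := ψ)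
    (x := gamLeft G n g * gamBarIncl ψ n r * gamLeft G n g⁻¹) (conj_mem_opRange g ⟨_, rfl⟩)
  refine ⟨k₁ * k₂, ?_⟩
  rw [map_mul, hk₂, mul_assoc, hconj, ← h1, ← mul_assoc, ← mul_assoc, mul_assoc (KToR ψ n k₁),
    ← hconj, ← mul_assoc, hk₁, one_mul]

theorem genW_relation_ne_zero (hn : 1 ≤ n) :
    gamLeft G n (genW e) * gamLeft G n (genW e) - (3 : ℤ) • gamLeft G n (genW e) + 1 ≠ 0 := by
  intro h
  have hWn : genW e ∉ rationalDerivedSeries G (n + 1) := fun h =>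
    genW_notMem e (rationalDerivedSeries_antitone (by omega) h)
  -- The coefficient at W⁻¹, the group element underlying w. It is -3, because W ≠ 1 in Γₙ separates
  -- w from 1 and w².
  have h4 := congrArg (fun z : GamRingOp G n => z.unop.coeff (QuotientGroup.mk (genW e)⁻¹)) h
  have h5 : (QuotientGroup.mk (genW e)⁻¹ : Gam G n) ≠ 1 := fun h =>
    hWn (inv_mem_iff.1 ((QuotientGroup.eq_one_iff _).1 h))
  have h6 : (QuotientGroup.mk (genW e)⁻¹ : Gam G n) ≠
      QuotientGroup.mk (genW e)⁻¹ * QuotientGroup.mk (genW e)⁻¹ := fun h => h5 (by simpa using h)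
  simp only [gamLeft_apply, MulOpposite.unop_add, MulOpposite.unop_sub, MulOpposite.unop_mul,
    MulOpposite.unop_smul, MulOpposite.unop_op, MulOpposite.unop_one, MulOpposite.unop_zero,
    MonoidAlgebra.single_mul_single, MonoidAlgebra.one_def, MonoidAlgebra.coeff_add,
    MonoidAlgebra.coeff_sub, MonoidAlgebra.coeff_smul, MonoidAlgebra.coeff_single,
    Finsupp.add_apply, Finsupp.sub_apply, Finsupp.smul_apply, Finsupp.single_eq_same,
    Finsupp.single_eq_of_ne h5, Finsupp.single_eq_of_ne h6, MonoidAlgebra.coeff_zero] at h4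
  simp at h4

include e in
-- The hypothesis n ≥ 1 keeps W and W⁻¹P nontrivial in Γₙ; the inner correction vanishes on
-- G_r^{(n+1)}.
theorem exists_proportional {U : Type*} [AddCommGroup U] [Module (ROp ψ n) U] {c : G → U}
    (hn : 1 ≤ n) (hc : IsDerivation (locLeft ψ n) c)
    (ha : genA e ∈ rationalDerivedSeries G (n + 1)) :
    ∃ d : U, ∀ h ∈ rationalDerivedSeries G (n + 1), ∃ k, c h = KToR ψ n k • d := by
  have hn2 : rationalDerivedSeries G (n + 1) ≤ rationalDerivedSeries G 2 :=
    rationalDerivedSeries_antitone (by omega)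
  have hinj : ∀ g g', locLeft ψ n g = locLeft ψ n g' → g⁻¹ * g' ∈ rationalDerivedSeries G (n + 1) :=
    fun g g' h => gamLeft_eq_iff.1 (numerator_injective h)
  have hmem : ∀ {g}, g ∈ rationalDerivedSeries G 1 → gamLeft G n g ∈ opRange (GamBar ψ n) :=
    fun hg => gamLeft_mem_opRange_gamBar (apply_eq_one_of_mem ψ hg)
  obtain ⟨v, d, hd⟩ := exists_sub_inner_proportional e hc (KToR ψ n) (locLeft_eq_one ha)
    (fun h => genW_notMem e (hn2 (inv_mem_iff.1 (by
      have := hinj _ 1 (h.trans (map_one _).symm)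
      rwa [mul_one] at this))))
    (fun h => genW_inv_mul_genP_notMem e (hn2 (hinj _ _ h.symm)))
    (by
      have := isUnit_numerator (ψ := ψ) (add_mem (sub_mem (mul_mem (hmem (genW_mem e))
        (hmem (genW_mem e))) (zsmul_mem (hmem (genW_mem e)) 3)) (one_mem _))
        (genW_relation_ne_zero e hn)
      rwa [map_add, map_sub, map_mul, map_zsmul, map_one, numerator_gamLeft] at this)
    exists_locLeft_mul_KToR (fun g hg => exists_KToR_eq (hmem hg))
    (fun g hg g' hg' hgg => by
      have h1 := sub_mem (hmem hg) (hmem hg')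
      have h2 : gamLeft G n g - gamLeft G n g' ≠ 0 := fun h => hgg (by
        rw [← numerator_gamLeft, sub_eq_zero.1 h, numerator_gamLeft])
      obtain ⟨k, hk⟩ := exists_KToR_mul_numerator h1 h2
      have h3 := isUnit_numerator h1 h2
      rw [map_sub, numerator_gamLeft, numerator_gamLeft] at hk h3
      exact ⟨k, h3, hk⟩)
  refine ⟨d, fun h hh => ?_⟩
  obtain ⟨k, hk⟩ := hd h
  rw [locLeft_eq_one hh, one_smul, sub_self, sub_zero] at hk
  exact ⟨k, hk⟩

include e in
theorem degree_le_one (hn : 1 ≤ n) (ha : genA e ∈ rationalDerivedSeries G (n + 1)) :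
    degree ψ n ≤ 1 := by
  obtain ⟨U, _, _, j, c, hj, hc, hcj⟩ := exists_embedding_isDerivation (ψ := ψ) (n := n)
  obtain ⟨d, hd⟩ := exists_proportional e hn hc ha
  let : Module (KOp ψ n) U := Module.compHom _ (KToR ψ n)
  let j' : LocalizedAlexanderModule ψ n →ₗ[KOp ψ n] U :=
    { toFun := j
      map_add' := map_add j
      map_smul' := fun k v => map_smul j (KToR ψ n k) v }
  have hmem : ∀ v, j' v ∈ Submodule.span (KOp ψ n) {d} := fun v => by
    obtain ⟨k, x, rfl⟩ := exists_smul_locMk v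
    obtain ⟨h, rfl⟩ := AlexanderModule.mk_surjective n x
    rw [map_smul]
    refine Submodule.smul_mem _ _ ?_
    obtain ⟨l, hl⟩ := hd h h.2
    change j _ ∈ _
    rw [← hcj, hl]
    exact Submodule.smul_mem _ l (Submodule.mem_span_singleton_self d)
  have h1 : Function.Injective (j'.codRestrict (Submodule.span (KOp ψ n) {d}) hmem) :=
    fun x y h => hj (congrArg Subtype.val h)
  refine (LinearMap.rank_le_of_injective _ h1).trans ?_
  refine (rank_span_le _).trans ?_
  rw [Cardinal.mk_singleton]

end Degrees

/-! ### The lower bound when σ₃σ₁⁻¹ is trivial in Γₙ -/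

section LowerBound

variable {G : Type u} [Group G] (e : G ≃* BraidGroup4) {ψ : G →* Multiplicative ℤ} {n : ℕ}

/-- A derivation with values in a module over the group ring of `Γₙ` restricts to a linear map on
the Alexander module. -/
theorem IsDerivation.exists_linearMap {M : Type*} [AddCommGroup M] [Module (GamRingOp G n) M]
    {c : G → M} (hc : IsDerivation (gamLeft G n) c) :
    ∃ f : AlexanderModule G n →ₗ[GamRingOp G n] M,
      ∀ h : rationalDerivedSeries G (n + 1), f (AlexanderModule.mk G n h) = c h := by
  have hH : ∀ h : rationalDerivedSeries G (n + 1), gamLeft G n (h : G) = 1 :=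
    fun h => gamLeft_eq_one_iff.2 h.2
  let F : rationalDerivedSeries G (n + 1) →* Multiplicative M :=
    { toFun := fun h => Multiplicative.ofAdd (c h)
      map_one' := congrArg Multiplicative.ofAdd hc.map_one
      map_mul' := fun g h => by
        change Multiplicative.ofAdd _ = Multiplicative.ofAdd (c g + c h)
        rw [Subgroup.coe_mul, hc, hH, one_smul] }
  let f : AlexanderModule G n →+ M := (Abelianization.lift F).toAdditiveLeft
  have hf : ∀ h, f (AlexanderModule.mk G n h) = c h := fun h => rfl
  refine ⟨linearMapOfCommutes f fun g v => ?_, hf⟩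
  obtain ⟨x, rfl⟩ := AlexanderModule.mk_surjective n v
  rw [gamLeft_smul_mk, hf, hf, MulAut.conjNormal_apply, hc.map_conj _ (hH x)]

/-- A derivation that vanishes on `G_r^{(n+1)}` extends linearly to the group ring of `Γₙ`. -/
theorem IsDerivation.smul_eq_smul {U : Type*} [AddCommGroup U] [Module (ROp ψ n) U] {c : G → U}
    (hc : IsDerivation (locLeft ψ n) c) (h0 : ∀ h ∈ rationalDerivedSeries G (n + 1), c h = 0)
    {m m' : GamRingOp G n} {g g' : G}
    (hm : m * (gamLeft G n g - 1) = m' * (gamLeft G n g' - 1)) :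
    OreLocalization.numeratorRingHom (S := nonzeroBar ψ n) m • c g =
      OreLocalization.numeratorRingHom (S := nonzeroBar ψ n) m' • c g' := by
  -- Being constant on cosets of G_r^{(n+1)}, c extends additively to ℤΓₙ, and the extension takes
  -- m(g - 1) to m c(g).
  let C₀ : MonoidAlgebra ℤ (Gam G n) →+ U :=
    (Finsupp.liftAddHom fun x => zmultiplesHom U (c (Quotient.out x)⁻¹)).comp
      MonoidAlgebra.coeffAddEquiv.toAddMonoidHom
  let C : GamRingOp G n →+ U := C₀.comp MulOpposite.opAddEquiv.symm.toAddMonoidHom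
  have hcoset : ∀ x y, x⁻¹ * y ∈ rationalDerivedSeries G (n + 1) → c x = c y := fun x y hxy => by
    have := hc x (x⁻¹ * y)
    rwa [h0 _ hxy, smul_zero, add_zero, mul_inv_cancel_left, eq_comm] at this
  have hC : ∀ g, C (gamLeft G n g) = c g := fun g => by
    refine (Finsupp.liftAddHom_apply_single (fun x : Gam G n => zmultiplesHom U
      (c (Quotient.out x)⁻¹)) (QuotientGroup.mk g⁻¹) 1).trans ?_
    rw [zmultiplesHom_apply, one_zsmul]
    refine hcoset _ _ ?_
    rw [← QuotientGroup.eq, QuotientGroup.mk_inv, QuotientGroup.out_eq', QuotientGroup.mk_inv,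
      inv_inv]
  have key : ∀ (m : GamRingOp G n) g, C (m * (gamLeft G n g - 1)) =
      OreLocalization.numeratorRingHom (S := nonzeroBar ψ n) m • c g := by
    intro m g
    induction m using MulOpposite.rec' with | _ m => ?_
    induction m using MonoidAlgebra.induction_on with
    | of k =>
      obtain ⟨y, rfl⟩ := QuotientGroup.mk_surjective k
      have h1 : MulOpposite.op (MonoidAlgebra.of ℤ (Gam G n) (QuotientGroup.mk y)) =
          gamLeft G n y⁻¹ := by rw [gamLeft_apply, inv_inv]; rfl
      rw [h1, mul_sub, mul_one, ← map_mul, map_sub, hC, hC, hc, add_sub_cancel_left,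
        numerator_gamLeft]
    | add x y hx hy => rw [MulOpposite.op_add, add_mul, map_add, map_add, add_smul, hx, hy]
    | smul r x hx =>
      rw [MulOpposite.op_smul, smul_mul_assoc, map_zsmul, map_zsmul, smul_assoc, hx]
  rw [← key, ← key, hm]

/-- A derivation over `Rₙ` that vanishes on `G_r^{(n+1)}` and takes the same value on `σ₁` and `σ₂`
vanishes on `σ₁`. -/
theorem IsDerivation.apply_gen_eq_zero {U : Type*} [AddCommGroup U] [Module (ROp ψ n) U]
    {c : G → U} (hc : IsDerivation (locLeft ψ n) c) (hn : 1 ≤ n)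
    (h0 : ∀ h ∈ rationalDerivedSeries G (n + 1), c h = 0) (h1 : c (gen e 1) = c (gen e 0)) :
    c (gen e 0) = 0 := by
  have hn2 : rationalDerivedSeries G (n + 1) ≤ rationalDerivedSeries G 2 :=
    rationalDerivedSeries_antitone (by omega)
  have hne : ∀ {g}, g ∉ rationalDerivedSeries G 2 → gamLeft G n g - 1 ≠ 0 :=
    fun hg h => hg (hn2 (gamLeft_eq_one_iff.1 (sub_eq_zero.1 h)))
  have hmem : ∀ {g}, g ∈ rationalDerivedSeries G 1 →
      gamLeft G n g - 1 ∈ opRange (GamBar ψ n) :=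
    fun hg => sub_mem (gamLeft_mem_opRange_gamBar (apply_eq_one_of_mem ψ hg)) (one_mem _)
  have hcW : c (genW e) = 0 := by rw [genW, hc.map_inv_mul, h1, sub_self, smul_zero]
  have hcP : c (genP e) = -((locLeft ψ n (genP e) - 1) • c (gen e 0)) := by
    rw [sub_smul, one_smul, neg_sub, genP, hc.map_mul_inv, h1]
  -- Since c(W) = 0, the relation m(p - 1) = m'(w - 1) gives m c(P) = 0. Here c(P) = -(p - 1)c(σ₁),
  -- and m and p - 1 are invertible.
  obtain ⟨m, hm, m', -, hm0, hmm⟩ := exists_mul_eq_mul_opRange (hmem (genP_mem e))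
    (hmem (genW_mem e)) (hne (genW_notMem e))
  have h2 := hc.smul_eq_smul h0 hmm
  rwa [hcW, smul_zero, (isUnit_numerator hm hm0).smul_eq_zero, hcP, neg_eq_zero,
    (isUnit_locLeft_sub_one (apply_eq_one_of_mem ψ (genP_mem e))
      fun h => genP_notMem e (hn2 h)).smul_eq_zero] at h2

include e in
/-- If `σ₃σ₁⁻¹` is trivial in `Γₙ`, then the localized Alexander module is nonzero. -/
theorem exists_locMk_ne_zero (hψ : ψ ≠ 1) (hn : 1 ≤ n)
    (ha : genA e ∈ rationalDerivedSeries G (n + 1)) : ∃ x, locMk ψ n x ≠ 0 := by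
  by_contra! hV
  have hn2 : rationalDerivedSeries G (n + 1) ≤ rationalDerivedSeries G 2 :=
    rationalDerivedSeries_antitone (by omega)
  have hmem : ∀ {g}, g ∈ rationalDerivedSeries G 1 → gamLeft G n g ∈ opRange (GamBar ψ n) :=
    fun hg => gamLeft_mem_opRange_gamBar (apply_eq_one_of_mem ψ hg)
  have hne : ∀ {g}, g ∉ rationalDerivedSeries G 2 → gamLeft G n g - 1 ≠ 0 :=
    fun hg h => hg (hn2 (gamLeft_eq_one_iff.1 (sub_eq_zero.1 h)))
  set p := gamLeft G n (genP e) with hp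
  set w := gamLeft G n (genW e) with hw
  set t := gamLeft G n (gen e 0) with ht
  set s := gamLeft G n (gen e 1) with hs
  have hpt : p * t = s := by rw [hp, ht, ← map_mul, genP_mul_gen]
  have htw : t * w = s := by rw [hw, ht, ← map_mul, gen_mul_genW]
  have hpw : p - w ≠ 0 := fun h => genW_inv_mul_genP_notMem e
    (hn2 (gamLeft_eq_iff.1 (sub_eq_zero.1 h).symm))
  -- The universal module on one generator d for which the constant assignment σᵢ ↦ d satisfies the
  -- linearized braid relations.
  let I : Submodule (GamRingOp G n) (GamRingOp G n) :=
    Submodule.span _ {(p - w) * t - (w - 1)}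
  let d : GamRingOp G n ⧸ I := Submodule.Quotient.mk 1
  have hd : s • d - (w * t) • d = w • d - d := by
    have h1 : ((p - w) * t - (w - 1)) • d = 0 := by
      rw [← Submodule.Quotient.mk_smul, smul_eq_mul, mul_one, Submodule.Quotient.mk_eq_zero]
      exact Submodule.mem_span_singleton_self _
    rwa [sub_smul, sub_mul, hpt, sub_smul, sub_smul, one_smul, sub_eq_zero] at h1
  have hd' : t • s • d - s • t • d = s • d - t • d := by
    have := congrArg (t • ·) hd
    simp only [smul_sub] at this
    rwa [← mul_smul t w, htw, ← mul_smul t (w * t), ← mul_assoc, htw, mul_smul] at this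
  have h2t : gamLeft G n (gen e 2) = t := by
    rw [← gen_mul_genA, map_mul, gamLeft_eq_one_iff.2 ha, mul_one]
  have h01 : d + t • d + t • s • d = d + s • d + s • t • d := by
    rw [add_assoc, add_assoc, add_right_inj, add_comm (t • d)]
    exact sub_eq_sub_iff_add_eq_add.1 hd'
  obtain ⟨c, hc, hcd⟩ := exists_isDerivation e (gamLeft G n) (fun _ => d) (by rw [h2t]) h01 (by
    rw [h2t]; exact h01.symm)
  obtain ⟨f, hf⟩ := hc.exists_linearMap
  let c₁ : G → OreLocalization (nonzeroBar ψ n) (GamRingOp G n ⧸ I) := fun g =>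
    OreLocalization.oreDiv (c g) (1 : nonzeroBar ψ n)
  have hc₁ : IsDerivation (locLeft ψ n) c₁ := hc.localize
  have h0 : ∀ h ∈ rationalDerivedSeries G (n + 1), c₁ h = 0 := fun h hh => by
    obtain ⟨r, hr, hrh⟩ := locMk_eq_zero_iff.1 (hV (AlexanderModule.mk G n ⟨h, hh⟩))
    refine OreLocalization.oreDiv_one_eq_zero_iff.2 ⟨r, hr, ?_⟩
    have := congrArg f hrh
    rwa [map_smul, map_zero, hf] at this
  have h1 : c₁ (gen e 0) = 0 := hc₁.apply_gen_eq_zero e hn h0 (by simp only [c₁, hcd])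
  obtain ⟨r, hr, hr0⟩ := OreLocalization.oreDiv_one_eq_zero_iff.1 h1
  rw [hcd, ← Submodule.Quotient.mk_smul, smul_eq_mul, mul_one, Submodule.Quotient.mk_eq_zero,
    Submodule.mem_span_singleton] at hr0
  obtain ⟨x, rfl⟩ := hr0
  -- That d dies after localization means that some multiple x((p - w)t - (w - 1)) lies in Sₙ.
  exact mul_sub_notMem_nonzeroBar (apply_gen_ne_one e hψ) (sub_mem (hmem (genP_mem e))
    (hmem (genW_mem e))) hpw (sub_mem (hmem (genW_mem e)) (one_mem _)) (hne (genW_notMem e)) x hr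

include e in
theorem degree_eq_one (hψ : ψ ≠ 1) (hn : 1 ≤ n)
    (ha : genA e ∈ rationalDerivedSeries G (n + 1)) : degree ψ n = 1 := by
  refine le_antisymm (degree_le_one e hn ha) ?_
  obtain ⟨x, hx⟩ := exists_locMk_ne_zero e hψ hn ha
  have : Nontrivial (LocalizedAlexanderModule ψ n) := ⟨_, _, hx⟩
  exact Cardinal.one_le_iff_ne_zero.2 rank_pos.ne'

end LowerBound

/-! ### The degree of order zero -/

section DegreeZero

variable {G : Type u} [Group G] (e : G ≃* BraidGroup4) {ψ : G →* Multiplicative ℤ}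

theorem gen_smul_mk_genW : gamLeft G 0 (gen e 0) • AlexanderModule.mk G 0 ⟨genW e, genW_mem e⟩ =
    AlexanderModule.mk G 0 ⟨genP e, genP_mem e⟩ := by
  rw [gamLeft_smul_mk]
  exact congrArg _ (Subtype.ext (conj_genW e))

theorem gen_smul_mk_genP : gamLeft G 0 (gen e 0) • AlexanderModule.mk G 0 ⟨genP e, genP_mem e⟩ =
    AlexanderModule.mk G 0 ⟨genP e, genP_mem e⟩ - AlexanderModule.mk G 0 ⟨genW e, genW_mem e⟩ := by
  rw [gamLeft_smul_mk, sub_eq_neg_add, ← AlexanderModule.mk_inv, ← AlexanderModule.mk_mul]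
  exact congrArg _ (Subtype.ext (conj_genP e))

/-- The classes of `σ₁⁻¹σ₂` and `σ₂σ₁⁻¹` generate the Alexander module of order zero as an abelian
group. -/
theorem exists_mk_zero_eq (x : rationalDerivedSeries G 1) : ∃ i j : ℤ,
    i • AlexanderModule.mk G 0 ⟨genW e, genW_mem e⟩ +
      j • AlexanderModule.mk G 0 ⟨genP e, genP_mem e⟩ = AlexanderModule.mk G 0 x := by
  set ω := AlexanderModule.mk G 0 ⟨genW e, genW_mem e⟩ with hω
  set π := AlexanderModule.mk G 0 ⟨genP e, genP_mem e⟩ with hπ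
  let B : AddSubgroup (AlexanderModule G 0) := AddSubgroup.closure {ω, π}
  rw [← AddSubgroup.mem_closure_pair]
  have hinv : ∀ (g : G) (v : AlexanderModule G 0), gamLeft G 0 g⁻¹ • gamLeft G 0 g • v = v :=
    fun g v => by rw [← mul_smul, ← map_mul, inv_mul_cancel, map_one, one_smul]
  let S : Subgroup G :=
    { carrier := {g | ∀ v, gamLeft G 0 g • v ∈ B ↔ v ∈ B}
      one_mem' := fun v => by rw [map_one, one_smul]
      mul_mem' := fun {g h} hg hh v => by rw [map_mul, mul_smul, hg, hh]
      inv_mem' := fun {g} hg v => by rw [← hg, ← mul_smul, ← map_mul, mul_inv_cancel, map_one,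
        one_smul] }
  have hmemW : ω ∈ B := AddSubgroup.subset_closure (by simp)
  have hmemP : π ∈ B := AddSubgroup.subset_closure (by simp)
  have hS : gen e 0 ∈ S := by
    intro v
    constructor
    · intro hv
      obtain ⟨i, j, hij⟩ := AddSubgroup.mem_closure_pair.1 hv
      rw [← hinv (gen e 0) v, ← hij, smul_add, smul_comm _ i, smul_comm _ j]
      have h1 : gamLeft G 0 (gen e 0)⁻¹ • π = ω := by
        rw [hπ, ← gen_smul_mk_genW, hinv]
      have h2 : gamLeft G 0 (gen e 0)⁻¹ • ω = ω - π := by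
        have := congrArg (gamLeft G 0 (gen e 0)⁻¹ • ·) (gen_smul_mk_genP e)
        simp only [smul_sub, hinv] at this
        rw [← hω, ← hπ, h1] at this
        rw [this, sub_sub_cancel]
      rw [h1, h2]
      exact add_mem (zsmul_mem (sub_mem hmemW hmemP) _) (zsmul_mem hmemW _)
    · intro hv
      obtain ⟨i, j, rfl⟩ := AddSubgroup.mem_closure_pair.1 hv
      rw [smul_add, smul_comm _ i, smul_comm _ j, gen_smul_mk_genW, gen_smul_mk_genP]
      exact add_mem (zsmul_mem hmemP _) (zsmul_mem (sub_mem hmemP hmemW) _)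
  -- Products yσ₁^k with the class of y in the span B form a subgroup because σ₁ preserves B. It
  -- contains σ₂ = Pσ₁ and σ₃ = Aσ₁, the class of A being zero; for x of exponent sum zero, k = 0.
  let P : Subgroup G :=
    { carrier := {g | ∃ (y : rationalDerivedSeries G 1) (k : ℤ), AlexanderModule.mk G 0 y ∈ B ∧
        g = y * gen e 0 ^ k}
      one_mem' := ⟨1, 0, zero_mem B, by simp⟩
      mul_mem' := by
        rintro _ _ ⟨y, k, hy, rfl⟩ ⟨z, l, hz, rfl⟩
        refine ⟨y * MulAut.conjNormal (gen e 0 ^ k) z, k + l, ?_, ?_⟩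
        · rw [AlexanderModule.mk_mul, ← gamLeft_smul_mk]
          exact add_mem hy ((zpow_mem hS k _).2 hz)
        · rw [Subgroup.coe_mul, MulAut.conjNormal_apply, zpow_add]
          group
      inv_mem' := by
        rintro _ ⟨y, k, hy, rfl⟩
        refine ⟨MulAut.conjNormal (gen e 0 ^ (-k)) y⁻¹, -k, ?_, ?_⟩
        · rw [← gamLeft_smul_mk, AlexanderModule.mk_inv]
          exact (zpow_mem hS (-k) _).2 (neg_mem hy)
        · rw [MulAut.conjNormal_apply, Subgroup.coe_inv]
          group }
  obtain ⟨y, k, hy, hxy⟩ := mem_of_gen_mem e (P := P) (by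
    intro i
    fin_cases i
    · exact ⟨1, 1, zero_mem B, by simp⟩
    · exact ⟨⟨genP e, genP_mem e⟩, 1, hmemP, by
        rw [zpow_one]; exact (genP_mul_gen e).symm⟩
    · exact ⟨⟨genA e, genA_mem e⟩, 1, by rw [mk_genA_zero]; exact zero_mem B, by
        rw [zpow_one]; exact (genA_mul_gen e).symm⟩) x
  have h1 := congrArg (exponentSum e) hxy
  rw [map_mul, map_zpow, exponentSum_gen, rationalDerivedSeries_le_ker (exponentSum e) 0 x.2,
    rationalDerivedSeries_le_ker (exponentSum e) 0 y.2, one_mul] at h1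
  obtain rfl : k = 0 := by simpa using (congrArg Multiplicative.toAdd h1).symm
  rwa [Subtype.ext (hxy.trans (by simp)) (a1 := x) (a2 := y)]

include e in
-- As ker ψ = G_r^{(1)}, the group Γ̄₀ is trivial and its group ring is ℤ; the localization only
-- inverts nonzero integers.
theorem exists_eq_intCast_of_mem_opRange (hψ : ψ ≠ 1) {m : GamRingOp G 0}
    (hm : m ∈ opRange (GamBar ψ 0)) : ∃ k : ℤ, m = k := by
  obtain ⟨r, rfl⟩ := hm
  induction r using MulOpposite.rec' with | _ r => ?_
  induction r using MonoidAlgebra.induction_on with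
  | of x =>
    obtain ⟨g, hg⟩ := QuotientGroup.mk_surjective (x : Gam G 0)
    have h1 : ψ g = 1 := mk_mem_gamBar_iff.1 (hg ▸ x.2)
    have h2 : (x : Gam G 0) = 1 := by
      rw [← hg, QuotientGroup.eq_one_iff, ← ker_eq_rationalDerivedSeries e hψ]
      exact h1
    obtain rfl : x = 1 := Subtype.ext h2
    exact ⟨1, by rw [map_one, MulOpposite.op_one, map_one, Int.cast_one]⟩
  | add x y hx hy =>
    obtain ⟨k, hk⟩ := hx
    obtain ⟨l, hl⟩ := hy
    exact ⟨k + l, by rw [MulOpposite.op_add, map_add, hk, hl, Int.cast_add]⟩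
  | smul a x hx =>
    obtain ⟨k, hk⟩ := hx
    exact ⟨a * k, by rw [MulOpposite.op_smul, map_zsmul, hk, zsmul_eq_mul, Int.cast_mul]⟩

include e in
/-- Localization does not identify elements of the Alexander module of order zero that a
homomorphism to a torsion-free group separates. -/
theorem apply_eq_zero_of_locMk_eq_zero (hψ : ψ ≠ 1) (F : AlexanderModule G 0 →+ ℤ × ℤ)
    {v : AlexanderModule G 0} (hv : locMk ψ 0 v = 0) : F v = 0 := by
  obtain ⟨m, hm, hmv⟩ := locMk_eq_zero_iff.1 hv
  obtain ⟨k, hk⟩ := exists_eq_intCast_of_mem_opRange e hψ (mem_opRange_of_mem_nonzeroBar hm)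
  have hk0 : k ≠ 0 := fun h => ne_zero_of_mem_nonzeroBar hm (by rw [hk, h, Int.cast_zero])
  have h1 := congrArg F hmv
  rw [hk, Int.cast_smul_eq_zsmul, map_zsmul, map_zero] at h1
  exact (smul_eq_zero.1 h1).resolve_left hk0

theorem locMk_zsmul {n : ℕ} (k : ℤ) (v : AlexanderModule G n) :
    locMk ψ n (k • v) = k • locMk ψ n v :=
  map_zsmul (AddMonoidHom.mk' (locMk ψ n) locMk_add) k v

include e in
-- The classes of W and P form a basis: they generate the module, and the homomorphism to ℤ² that
-- sends them to the standard basis shows their independence once denominators are cleared.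
theorem degree_zero_eq_two (hψ : ψ ≠ 1) : degree ψ 0 = 2 := by
  set ω := AlexanderModule.mk G 0 ⟨genW e, genW_mem e⟩ with hω
  set π := AlexanderModule.mk G 0 ⟨genP e, genP_mem e⟩ with hπ
  obtain ⟨c, hc, -, hcW, hcP⟩ := exists_abelianization_commutator e
  let F₀ : rationalDerivedSeries G 1 →* Multiplicative (ℤ × ℤ) :=
    MonoidHom.mk' (fun x => Multiplicative.ofAdd (c x)) fun x y => by
      change Multiplicative.ofAdd _ = Multiplicative.ofAdd (c x + c y)
      rw [Subgroup.coe_mul, hc _ x.2]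
  let F : AlexanderModule G 0 →+ ℤ × ℤ := (Abelianization.lift F₀).toAdditiveLeft
  have hFω : F ω = (1, 0) := hcW
  have hFπ : F π = (0, 1) := hcP
  have hind : LinearIndependent (KOp ψ 0) ![locMk ψ 0 ω, locMk ψ 0 π] := by
    rw [LinearIndependent.pair_iff' fun h => by
      simpa [hFω] using apply_eq_zero_of_locMk_eq_zero e hψ F h]
    intro k hk
    obtain ⟨r, s, rfl⟩ : ∃ (r : GamBarRingOp ψ 0) (s : nonZeroDivisors (GamBarRingOp ψ 0)),
        k = OreLocalization.oreDiv r s := by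
      induction k using OreLocalization.ind with | _ r s => exact ⟨r, s, rfl⟩
    have h1 : OreLocalization.numeratorRingHom (s : GamBarRingOp ψ 0) *
        OreLocalization.oreDiv r s = OreLocalization.numeratorRingHom r :=
      OreLocalization.mul_cancel
    have h2 := congrArg (OreLocalization.numeratorRingHom
      (S := nonZeroDivisors (GamBarRingOp ψ 0)) (s : GamBarRingOp ψ 0) • ·) hk
    simp only [← mul_smul, h1] at h2
    rw [K_smul_def, K_smul_def, KToR_numerator, KToR_numerator] at h2
    obtain ⟨i, hi⟩ := exists_eq_intCast_of_mem_opRange e hψ ⟨r, rfl⟩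
    obtain ⟨j, hj⟩ := exists_eq_intCast_of_mem_opRange e hψ ⟨(s : GamBarRingOp ψ 0), rfl⟩
    have hj0 : j ≠ 0 := by
      rintro rfl
      refine nonZeroDivisors.ne_zero s.2 (gamBarIncl_injective ψ 0 ?_)
      rw [map_zero]
      exact hj.trans Int.cast_zero
    rw [show gamBarIncl ψ 0 r = i from hi, show gamBarIncl ψ 0 s = j from hj,
      numerator_smul_locMk, numerator_smul_locMk, Int.cast_smul_eq_zsmul,
      Int.cast_smul_eq_zsmul] at h2
    have h3 := apply_eq_zero_of_locMk_eq_zero e hψ F (v := j • π + (-i) • ω) (by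
      rw [locMk_add, ← h2, ← locMk_add, ← add_smul, add_neg_cancel, zero_smul]
      exact map_zero (AddMonoidHom.mk' (locMk ψ 0) locMk_add))
    rw [map_add, map_zsmul, map_zsmul, hFω, hFπ] at h3
    exact hj0 (by simpa using congrArg Prod.snd h3)
  have hspan : ⊤ ≤ Submodule.span (KOp ψ 0) (Set.range ![locMk ψ 0 ω, locMk ψ 0 π]) := by
    rintro v -
    obtain ⟨k, x, rfl⟩ := exists_smul_locMk v
    obtain ⟨x, rfl⟩ := AlexanderModule.mk_surjective 0 x
    obtain ⟨i, j, hij⟩ := exists_mk_zero_eq e x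
    refine Submodule.smul_mem _ _ ?_
    rw [← hij, locMk_add, locMk_zsmul, locMk_zsmul]
    have h0 : locMk ψ 0 ω ∈ Submodule.span (KOp ψ 0) (Set.range ![locMk ψ 0 ω, locMk ψ 0 π]) :=
      Submodule.subset_span ⟨0, rfl⟩
    have h1 : locMk ψ 0 π ∈ Submodule.span (KOp ψ 0) (Set.range ![locMk ψ 0 ω, locMk ψ 0 π]) :=
      Submodule.subset_span ⟨1, rfl⟩
    exact add_mem (zsmul_mem h0 _) (zsmul_mem h1 _)
  rw [degree, rank_eq_card_basis (Module.Basis.mk hind hspan), Fintype.card_fin]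
  rfl

end DegreeZero

/-! ### The linking number homomorphism is not trivial -/

/-- A continuous logarithm of `z - a` along the circle with centre `c` through `0`. -/
theorem exists_log_circle_sub {c a : ℂ} (hc : c ≠ 0) (ha : ‖c - a‖ ≠ ‖c‖) :
    ∃ w : C(unitInterval, ℂ),
      (∀ t : unitInterval, Complex.exp (w t) =
        c * (1 - Complex.exp (2 * Real.pi * Complex.I * (t : ℝ))) - a) ∧
      w 1 - w 0 = 2 * Real.pi * Complex.I * ((if ‖c - a‖ < ‖c‖ then 1 else 0 : ℕ) : ℂ) := by
  have hexp : ∀ t : ℝ, ‖Complex.exp (2 * Real.pi * Complex.I * t)‖ = 1 := fun t => by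
    rw [show (2 * Real.pi * Complex.I * t : ℂ) = ((2 * Real.pi * t : ℝ) : ℂ) * Complex.I by
      push_cast; ring, Complex.norm_exp_ofReal_mul_I]
  have hslit : ∀ z : ℂ, ‖z‖ < 1 → 1 - z ∈ Complex.slitPlane := fun z hz => by
    rw [sub_eq_add_neg]
    exact Complex.mem_slitPlane_of_norm_lt_one (by rwa [norm_neg])
  rcases lt_or_gt_of_ne ha with h | h
  -- With q = exp(2πit), factor c(1 - q) - a as -c · q · (1 - ((c - a)/c)q⁻¹) if a is enclosed, and
  -- as (c - a)(1 - (c/(c - a))q) if not. The last factor stays in the slit plane, so only the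
  -- explicit q winds.
  · have hz : ∀ t : ℝ, 1 - (c - a) / c * Complex.exp (-(2 * Real.pi * Complex.I * t)) ∈
        Complex.slitPlane := fun t => hslit _ (by
      rw [norm_mul, norm_div, Complex.exp_neg, norm_inv, hexp, inv_one, mul_one,
        div_lt_one (norm_pos_iff.2 hc)]
      exact h)
    refine ⟨⟨fun t => Complex.log (-c) + 2 * Real.pi * Complex.I * (t : ℝ) +
      Complex.log (1 - (c - a) / c * Complex.exp (-(2 * Real.pi * Complex.I * (t : ℝ)))), ?_⟩,
      fun t => ?_, ?_⟩
    · exact (by fun_prop : Continuous fun t : unitInterval => Complex.log (-c) +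
        2 * Real.pi * Complex.I * (t : ℝ)).add (Continuous.clog (by fun_prop) fun t => hz t)
    · rw [ContinuousMap.coe_mk, Complex.exp_add, Complex.exp_add,
        Complex.exp_log (neg_ne_zero.2 hc), Complex.exp_log (Complex.slitPlane_ne_zero (hz t)),
        Complex.exp_neg]
      have := Complex.exp_ne_zero (2 * Real.pi * Complex.I * (t : ℝ))
      field_simp
      ring
    · rw [if_pos h]
      simp [Complex.exp_neg, Complex.exp_two_pi_mul_I]
  · have hca : c - a ≠ 0 := norm_pos_iff.1 ((norm_nonneg c).trans_lt h)
    have hz : ∀ t : ℝ, 1 - c / (c - a) * Complex.exp (2 * Real.pi * Complex.I * t) ∈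
        Complex.slitPlane := fun t => hslit _ (by
      rw [norm_mul, norm_div, hexp, mul_one, div_lt_one (norm_pos_iff.2 hca)]
      exact h)
    refine ⟨⟨fun t => Complex.log (c - a) +
      Complex.log (1 - c / (c - a) * Complex.exp (2 * Real.pi * Complex.I * (t : ℝ))), ?_⟩,
      fun t => ?_, ?_⟩
    · exact continuous_const.add (Continuous.clog (by fun_prop) fun t => hz t)
    · rw [ContinuousMap.coe_mk, Complex.exp_add, Complex.exp_log hca,
        Complex.exp_log (Complex.slitPlane_ne_zero (hz t))]
      field_simp
      ring
    · rw [if_neg h.not_gt]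
      simp [Complex.exp_two_pi_mul_I]

/-- A continuous logarithm of a monic polynomial along the circle with centre `c` through `0`. -/
theorem exists_log_circle_prod {c : ℂ} (hc : c ≠ 0) (s : Multiset ℂ)
    (hs : ∀ a ∈ s, ‖c - a‖ ≠ ‖c‖) : ∃ w : C(unitInterval, ℂ),
      (∀ t : unitInterval, Complex.exp (w t) =
        (s.map fun a => c * (1 - Complex.exp (2 * Real.pi * Complex.I * (t : ℝ))) - a).prod) ∧
      w 1 - w 0 = 2 * Real.pi * Complex.I * (s.countP (fun a => ‖c - a‖ < ‖c‖) : ℂ) := by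
  induction s using Multiset.induction_on with
  | empty => exact ⟨0, fun t => by simp, by simp⟩
  | cons a s ih =>
    obtain ⟨w, hw, hw1⟩ := ih fun b hb => hs b (Multiset.mem_cons_of_mem hb)
    obtain ⟨v, hv, hv1⟩ := exists_log_circle_sub hc (hs a (Multiset.mem_cons_self a s))
    refine ⟨v + w, fun t => ?_, ?_⟩
    · rw [ContinuousMap.add_apply, Complex.exp_add, hv, hw, Multiset.map_cons, Multiset.prod_cons]
    · rw [Multiset.countP_cons, Nat.cast_add, ContinuousMap.add_apply, ContinuousMap.add_apply,
        add_sub_add_comm, hv1, hw1]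
      ring

/-- There is a circle through `0` that avoids a given finite set of nonzero points and encloses a
given one of them. -/
theorem exists_circle_avoiding {s : Finset ℂ} (hs : ∀ b ∈ s, b ≠ 0) {a : ℂ} (ha : a ∈ s) :
    ∃ c : ℂ, c ≠ 0 ∧ ‖c - a‖ < ‖c‖ ∧ ∀ b ∈ s, ‖c - b‖ ≠ ‖c‖ := by
  have ha0 := hs a ha
  -- For the centre ra, the circle through 0 meets b only if |b|² = 2r Re(a b̄), which excludes at
  -- most one r for each nonzero b. The condition r > 1 makes the circle enclose a.
  obtain ⟨r, hr, hrs⟩ := (Set.Ioi_infinite (1 : ℝ)).exists_notMem_finset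
    (s.image fun b => Complex.normSq b / (2 * (a * (starRingEnd ℂ) b).re))
  have hr1 : (1 : ℝ) < r := hr
  refine ⟨r * a, mul_ne_zero (by exact_mod_cast (by linarith : r ≠ 0)) ha0, ?_, fun b hb h => ?_⟩
  · have h1 : (r * a - a : ℂ) = ((r - 1 : ℝ) : ℂ) * a := by push_cast; ring
    rw [h1, norm_mul, norm_mul, Complex.norm_real, Complex.norm_real,
      Real.norm_of_nonneg (by linarith), Real.norm_of_nonneg (by linarith)]
    exact mul_lt_mul_of_pos_right (by linarith) (norm_pos_iff.2 ha0)
  · apply hrs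
    refine Finset.mem_image.2 ⟨b, hb, ?_⟩
    have h1 : Complex.normSq (r * a - b) = Complex.normSq (r * a) := by
      rw [Complex.normSq_eq_norm_sq, Complex.normSq_eq_norm_sq, h]
    rw [Complex.normSq_sub, mul_assoc, Complex.re_ofReal_mul] at h1
    have h2 : Complex.normSq b = r * (2 * (a * (starRingEnd ℂ) b).re) := by linarith
    have h3 : 2 * (a * (starRingEnd ℂ) b).re ≠ 0 := fun h3 => by
      rw [h3, mul_zero, Complex.normSq_eq_zero] at h2
      exact hs b hb h2
    rw [h2, mul_div_cancel_right₀ _ h3]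

/-- A nonconstant polynomial that does not vanish at `0` has nonzero winding number along some
circle through `0`. -/
theorem exists_log_circle_eval {P : Polynomial ℂ} (hP : P.natDegree ≠ 0) (h0 : P.eval 0 ≠ 0) :
    ∃ (c : ℂ) (w : C(unitInterval, ℂ)), (∀ t : unitInterval, Complex.exp (w t) =
      P.eval (c * (1 - Complex.exp (2 * Real.pi * Complex.I * (t : ℝ))))) ∧ w 1 ≠ w 0 := by
  have hP0 : P ≠ 0 := fun h => hP (by rw [h, Polynomial.natDegree_zero])
  obtain ⟨a, ha⟩ := IsAlgClosed.exists_root P fun h =>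
    hP (Polynomial.natDegree_eq_of_degree_eq_some h)
  have ha' : a ∈ P.roots := (Polynomial.mem_roots hP0).2 ha
  have hne : ∀ b ∈ P.roots, b ≠ 0 := by
    rintro b hb rfl
    exact h0 ((Polynomial.mem_roots hP0).1 hb)
  obtain ⟨c, hc, hca, hcs⟩ := exists_circle_avoiding (s := P.roots.toFinset)
    (fun b hb => hne b (Multiset.mem_toFinset.1 hb)) (Multiset.mem_toFinset.2 ha')
  obtain ⟨w, hw, hw1⟩ := exists_log_circle_prod hc P.roots
    fun b hb => hcs b (Multiset.mem_toFinset.2 hb)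
  refine ⟨c, ContinuousMap.const _ (Complex.log P.leadingCoeff) + w, fun t => ?_, fun h => ?_⟩
  · rw [(IsAlgClosed.splits P).eval_eq_prod_roots, ContinuousMap.add_apply,
      ContinuousMap.const_apply, Complex.exp_add, hw,
      Complex.exp_log (Polynomial.leadingCoeff_ne_zero.2 hP0)]
  · rw [ContinuousMap.add_apply, ContinuousMap.add_apply, ContinuousMap.const_apply,
      ContinuousMap.const_apply, add_right_inj] at h
    rw [h, sub_self, eq_comm, mul_eq_zero, or_iff_right Complex.two_pi_I_ne_zero,
      Nat.cast_eq_zero] at hw1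
    exact (Multiset.countP_pos.2 ⟨a, ha', hca⟩).ne' hw1

/-- If `f` is not constant, then the total linking number homomorphism is not trivial. -/
theorem linkingNumber_ne_one {f : MvPolynomial (Fin 2) ℂ} {u : Complement f} {v : Fin 2 → ℂ}
    (hv : MvPolynomial.eval v f ≠ MvPolynomial.eval u.1 f) : linkingNumber f u ≠ 1 := by
  -- The restriction of f to the line from u, at parameter 0, to v, at parameter 1. A circle through
  -- 0 in the parameter plane that avoids the roots is a loop based at u.
  let P : Polynomial ℂ := MvPolynomial.aeval
    (fun i => Polynomial.C (u.1 i) + Polynomial.X * Polynomial.C (v i - u.1 i)) f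
  have hP : ∀ z, P.eval z = MvPolynomial.eval (fun i => u.1 i + z * (v i - u.1 i)) f := fun z => by
    refine DFunLike.congr_fun (f := (Polynomial.evalRingHom z).comp (MvPolynomial.aeval
      fun i => Polynomial.C (u.1 i) + Polynomial.X * Polynomial.C (v i - u.1 i)).toRingHom)
      (MvPolynomial.ringHom_ext (fun r => ?_) fun i => ?_) f
    · simp
    · simp
  have hP0 : P.eval 0 = MvPolynomial.eval u.1 f := by simp [hP]
  have hP1 : P.eval 1 = MvPolynomial.eval v f := by simp [hP]
  have hdeg : P.natDegree ≠ 0 := fun h => hv (by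
    rw [← hP0, ← hP1, Polynomial.eq_C_of_natDegree_eq_zero h, Polynomial.eval_C, Polynomial.eval_C])
  obtain ⟨c, w, hw, hw1⟩ := exists_log_circle_eval hdeg (hP0 ▸ u.2)
  let q : unitInterval → ℂ := fun t => c * (1 - Complex.exp (2 * Real.pi * Complex.I * (t : ℝ)))
  have hq : ∀ t, MvPolynomial.eval (fun i => u.1 i + q t * (v i - u.1 i)) f ≠ 0 := fun t => by
    rw [← hP, ← hw]
    exact Complex.exp_ne_zero _
  let γ : Path u u :=
    { toFun := fun t => ⟨fun i => u.1 i + q t * (v i - u.1 i), hq t⟩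
      continuous_toFun := Continuous.subtype_mk (p := fun p => MvPolynomial.eval p f ≠ 0)
        (by fun_prop) hq
      source' := Subtype.ext (funext fun i => by simp [q])
      target' := Subtype.ext (funext fun i => by simp [q, Complex.exp_two_pi_mul_I]) }
  intro h
  have h1 := windingNumber_spec (γ.map (evalMap f).continuous) w fun t => (hw t).trans (hP _)
  have h2 : windingNumber (evalMap f u) (FundamentalGroup.fromPath
      (Path.Homotopic.Quotient.mk (γ.map (evalMap f).continuous))) = 1 :=
    DFunLike.congr_fun h (FundamentalGroup.fromPath (Path.Homotopic.Quotient.mk γ))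
  rw [h2, toAdd_one, Int.cast_zero, mul_zero, sub_eq_zero] at h1
  exact hw1 h1

/-- If `f` is a nonzero constant, then the complement of the curve `f = 0` is simply connected. -/
theorem subsingleton_fundamentalGroup {f : MvPolynomial (Fin 2) ℂ} (u : Complement f)
    (h : ∀ v, MvPolynomial.eval v f = MvPolynomial.eval u.1 f) :
    Subsingleton (FundamentalGroup (Complement f) u) := by
  let φ : Complement f ≃ₜ (Fin 2 → ℂ) :=
    { toEquiv := Equiv.subtypeUnivEquiv fun v => by rw [h]; exact u.2
      continuous_toFun := continuous_subtype_val
      continuous_invFun := Continuous.subtype_mk continuous_id _ }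
  have := φ.contractibleSpace
  infer_instance

/-- If the complement of a curve has the braid group on four strands as its fundamental group, then
its total linking number homomorphism is not trivial. -/
theorem linkingNumber_ne_one_of_braidGroup {f : MvPolynomial (Fin 2) ℂ} {u : Complement f}
    (e : FundamentalGroup (Complement f) u ≃* BraidGroup4) : linkingNumber f u ≠ 1 := by
  by_cases h : ∀ v, MvPolynomial.eval v f = MvPolynomial.eval u.1 f
  · have := subsingleton_fundamentalGroup u h
    exact absurd (MonoidHom.ext fun g => by rw [Subsingleton.elim g 1, map_one, map_one])
      (exponentSum_ne_one e)
  · push Not at h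
    exact linkingNumber_ne_one h.choose_spec

/-- Group homomorphisms respect the rational derived series. -/
theorem rationalDerivedSeries_map {G H : Type*} [Group G] [Group H] (φ : G →* H) (n : ℕ) {g : G}
    (hg : g ∈ rationalDerivedSeries G n) : φ g ∈ rationalDerivedSeries H n := by
  suffices h : (rationalDerivedSeries G n).map φ ≤ rationalDerivedSeries H n from
    h (Subgroup.mem_map_of_mem φ hg)
  clear hg
  induction n with
  | zero => exact le_top
  | succ n ih =>
    rintro _ ⟨g, ⟨hg, k, hk, hgk⟩, rfl⟩
    refine ⟨ih (Subgroup.mem_map_of_mem φ hg), k, hk, ?_⟩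
    rw [← map_zpow]
    have h1 := Subgroup.mem_map_of_mem φ hgk
    rw [Subgroup.map_commutator] at h1
    exact Subgroup.commutator_mono ih ih h1

theorem genA_mem_iff {G : Type*} [Group G] (e : G ≃* BraidGroup4) (n : ℕ) :
    genA e ∈ rationalDerivedSeries G n ↔
      sigma 2 * (sigma 0)⁻¹ ∈ rationalDerivedSeries BraidGroup4 n := by
  have h : e (genA e) = sigma 2 * (sigma 0)⁻¹ := by simp [genA, gen]
  rw [← h]
  exact ⟨rationalDerivedSeries_map e.toMonoidHom n, fun hg => by
    simpa using rationalDerivedSeries_map e.symm.toMonoidHom n hg⟩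

end CurveComplement

theorem mainTheorem2 (f : MvPolynomial (Fin 2) ℂ) (hf : Squarefree f)
    (u : CurveComplement.Complement f)
    (e : FundamentalGroup (CurveComplement.Complement f) u ≃* CurveComplement.BraidGroup4) :
    CurveComplement.higherOrderDegree f u 0 = 2 ∧
    CurveComplement.higherOrderDegree f u 1 = 1 ∧
    (∀ n : ℕ, 2 ≤ n →
      (CurveComplement.sigma 2 * (CurveComplement.sigma 0)⁻¹ ∈
          CurveComplement.rationalDerivedSeries CurveComplement.BraidGroup4 (n + 1) →
        CurveComplement.higherOrderDegree f u n = 1) ∧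
      (CurveComplement.sigma 2 * (CurveComplement.sigma 0)⁻¹ ∉
          CurveComplement.rationalDerivedSeries CurveComplement.BraidGroup4 (n + 1) →
        CurveComplement.higherOrderDegree f u n = 0)) ∧
    CurveComplement.higherOrderDegree f u 2 = 1 := by
  have hψ := CurveComplement.linkingNumber_ne_one_of_braidGroup e
  have ha := CurveComplement.genA_mem_iff e
  refine ⟨CurveComplement.degree_zero_eq_two e hψ,
    CurveComplement.degree_eq_one e hψ le_rfl (CurveComplement.genA_mem_two e),
    fun n hn => ⟨fun h => CurveComplement.degree_eq_one e hψ (by omega) ((ha _).2 h),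
      fun h => CurveComplement.degree_eq_zero_of_notMem e (by omega) fun h' => h ((ha _).1 h')⟩,
    CurveComplement.degree_eq_one e hψ (by omega) (CurveComplement.genA_mem_three e)⟩
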